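/- For $1\le s\le\infty$ let $\mathbb{B}_s^d=\{\mathbf{x}\in\mathbb{R}^d:\|\mathbf{x}\|_s\le 1\}$, and let $\mathrm{sgn}(u)=1$ if $u\ge 0$ and $\mathrm{sgn}(u)=-1$ otherwise. Let $2\le p\le\infty$ and $1/p+1/q=1$. For a probability distribution $\mathcal{D}$ on $\mathbb{B}_p^d\times\{\pm1\}$ and $\mathbf{w}\in\mathbb{B}_q^d$ put $$\mathrm{err}_\gamma^{\mathcal{D}}(\mathbf{w})=\Pr_{(\mathbf{x},y)\sim\mathcal{D}}\big[\mathrm{sgn}(\langle\mathbf{w},\mathbf{x}\rangle-y\gamma)\neq y\big],\qquad \mathrm{opt}_\gamma^{\mathcal{D}}=\inf_{\mathbf{w}\in\mathbb{B}_q^d}\mathrm{err}_\gamma^{\mathcal{D}}(\mathbf{w}).$$ Let $0<\gamma,\nu<1$, $\alpha\ge 1$ and $0<\epsilon<1$. A proper $\nu$-robust $\alpha$-agnostic learner for $L_p$-$\gamma$-margin halfspaces is a randomized algorithm that draws i.i.d. examples from an unknown distribution $\mathcal{D}$ on $\mathbb{B}_p^d\times\{\pm1\}$ and always outputs some $\mathbf{w}\in\mathbb{B}_q^d$,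 such that for every $\mathcal{D}$, with probability at least $2/3$, $$\mathrm{err}_{(1-\nu)\gamma}^{\mathcal{D}}(\mathbf{w})\le\alpha\cdot\mathrm{opt}_\gamma^{\mathcal{D}}+\epsilon .$$ Algorithms are programs for a randomized real RAM that uses fair random bits, addition, subtraction, multiplication, division and comparison of exact real numbers, and addition, subtraction and comparison of natural numbers serving as counters and addresses, every operation taking unit time. Bounds on time and on the number of samples hold in the worst case. All constants and polynomials below are absolute. **Theorem.** (1) There are a single program, constants $C_1,C_2$ and a polynomial $Q$ such that for all real $2\le p<\infty$, all $0<\gamma,\nu,\delta,\epsilon<1$ and all $d\ge 1$ the program, given $p,\gamma,\nu,\delta,\epsilon,d$, is a proper $\nu$-robust $(1+\delta)$-agnostic learner for $L_p$-$\gamma$-margin halfspaces in $\mathbb{R}^d$ that draws at most $C_1\,\frac{p}{\epsilon^2\nu^2\gamma^2}$ samples and runs in time at most $(2/\delta)^{C_2\,p/(\nu^2\gamma^2)}\cdot Q(d/\epsilon)$. (2) There are a single program, constants $C_1,C_2$ and a polynomial $Q$ such that for all $0<\gamma,\nu,\delta,\epsilon<1$ and all $d\ge 2$ the program, given $\gamma,\nu,\delta,\epsilon,d$,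 is a proper $\nu$-robust $(1+\delta)$-agnostic learner for $L_\infty$-$\gamma$-margin halfspaces in $\mathbb{R}^d$ that draws at most $C_1\,\frac{\log d}{\epsilon^2\nu^2\gamma^2}$ samples and runs in time at most $d^{\,C_2\log(2/\delta)/(\nu^2\gamma^2)}\cdot Q(1/\epsilon)$. -/

import Mathlib

open MeasureTheory
open scoped ENNReal

/-! ### A randomized real RAM

Programs are while-programs over two unbounded memories: one whose cells hold natural numbers
(used for counters and addresses) and one whose cells hold exact real numbers.  Every elementary
operation, every test and every control-flow transition costs one unit of time.  The operations
on reals are the four arithmetic operations and comparison; there is no rounding, no root, no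
logarithm and no exponential.  The operations on naturals are addition, truncated subtraction
and comparison.  A program is a finite object containing only natural-number constants. -/

namespace RealRAM

/-- An operand: the cell with the given index, or the cell whose index is stored in the natural
cell with the given index (indirect addressing). -/
inductive Addr where
  | dir (i : ℕ)
  | ind (i : ℕ)

/-- Elementary operations; the first operand is the destination.
`nconst … nsub` act on the natural memory, `rcopy … rdiv` on the real memory, `rofNat a b`
copies the natural cell `b` into the real cell `a`; `flip` stores a fresh fair random bit in a
natural cell; `draw` requests a fresh labelled example, `coord a b` reads into the real cell `a`
the coordinate of the last drawn example whose index is in the natural cell `b`, and `label a`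
reads the label of the last drawn example. -/
inductive Op where
  | nconst (a : Addr) (n : ℕ)
  | ncopy (a b : Addr)
  | nadd (a b c : Addr)
  | nsub (a b c : Addr)
  | rofNat (a b : Addr)
  | rcopy (a b : Addr)
  | radd (a b c : Addr)
  | rsub (a b c : Addr)
  | rmul (a b c : Addr)
  | rdiv (a b c : Addr)
  | flip (a : Addr)
  | draw
  | coord (a b : Addr)
  | label (a : Addr)

/-- Tests: `<` and `≤` on natural cells and on real cells. -/
inductive Test where
  | nlt (a b : Addr)
  | nle (a b : Addr)
  | rlt (a b : Addr)
  | rle (a b : Addr)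

/-- Programs. -/
inductive Prog where
  | op (o : Op)
  | seq (P Q : Prog)
  | ite (t : Test) (P Q : Prog)
  | loop (t : Test) (P : Prog)

/-- The memory of the machine: natural cells, real cells, the coordinates and the label of the
last drawn example (zero before the first draw), and the numbers of examples and of random bits
consumed so far. -/
structure State where
  nat : ℕ → ℕ
  real : ℕ → ℝ
  exX : ℕ → ℝ
  exY : ℝ
  draws : ℕ
  flips : ℕ

/-- A configuration: the program fragments still to be executed, and the memory. -/
structure Config where
  todo : List Prog
  mem : State

/-- The index of the cell an operand refers to. -/
def State.addr (s : State) : Addr → ℕ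
  | .dir i => i
  | .ind i => s.nat i

/-- The content of a natural cell. -/
def State.getN (s : State) (a : Addr) : ℕ := s.nat (s.addr a)

/-- The content of a real cell. -/
def State.getR (s : State) (a : Addr) : ℝ := s.real (s.addr a)

/-- Writing to a natural cell. -/
def State.setN (s : State) (a : Addr) (n : ℕ) : State :=
  { s with nat := Function.update s.nat (s.addr a) n }

/-- Writing to a real cell. -/
noncomputable def State.setR (s : State) (a : Addr) (x : ℝ) : State :=
  { s with real := Function.update s.real (s.addr a) x }

/-- Effect of an elementary operation, given the stream `S` of labelled examples (coordinate
sequence and label) and the stream `r` of random bits.  Division by zero returns zero. -/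
noncomputable def Op.exec (S : ℕ → (ℕ → ℝ) × ℝ) (r : ℕ → Bool) (s : State) : Op → State
  | .nconst a n => s.setN a n
  | .ncopy a b => s.setN a (s.getN b)
  | .nadd a b c => s.setN a (s.getN b + s.getN c)
  | .nsub a b c => s.setN a (s.getN b - s.getN c)
  | .rofNat a b => s.setR a (s.getN b : ℝ)
  | .rcopy a b => s.setR a (s.getR b)
  | .radd a b c => s.setR a (s.getR b + s.getR c)
  | .rsub a b c => s.setR a (s.getR b - s.getR c)
  | .rmul a b c => s.setR a (s.getR b * s.getR c)
  | .rdiv a b c => s.setR a (s.getR b / s.getR c)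
  | .flip a => { s.setN a (if r s.flips then 1 else 0) with flips := s.flips + 1 }
  | .draw => { s with exX := (S s.draws).1, exY := (S s.draws).2, draws := s.draws + 1 }
  | .coord a b => s.setR a (s.exX (s.getN b))
  | .label a => s.setR a s.exY

/-- Truth of a test. -/
def Test.Holds (s : State) : Test → Prop
  | .nlt a b => s.getN a < s.getN b
  | .nle a b => s.getN a ≤ s.getN b
  | .rlt a b => s.getR a < s.getR b
  | .rle a b => s.getR a ≤ s.getR b

open Classical in
/-- One unit of time.  A configuration with nothing left to do has halted. -/
noncomputable def step (S : ℕ → (ℕ → ℝ) × ℝ) (r : ℕ → Bool) : Config → Config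
  | ⟨[], s⟩ => ⟨[], s⟩
  | ⟨.op o :: k, s⟩ => ⟨k, o.exec S r s⟩
  | ⟨.seq P Q :: k, s⟩ => ⟨P :: Q :: k, s⟩
  | ⟨.ite t P Q :: k, s⟩ => if t.Holds s then ⟨P :: k, s⟩ else ⟨Q :: k, s⟩
  | ⟨.loop t P :: k, s⟩ => if t.Holds s then ⟨P :: .loop t P :: k, s⟩ else ⟨k, s⟩

/-- The initial memory: natural cell `0` holds the dimension `d`, the first real cells hold the
real parameters, and everything else is zero. -/
noncomputable def initState (d : ℕ) (params : List ℝ) : State where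
  nat := fun i => if i = 0 then d else 0
  real := fun i => params.getD i 0
  exX := fun _ => 0
  exY := 0
  draws := 0
  flips := 0

/-- The configuration reached by `P` after `T` units of time. -/
noncomputable def run (P : Prog) (d : ℕ) (params : List ℝ) (S : ℕ → (ℕ → ℝ) × ℝ) (r : ℕ → Bool)
    (T : ℕ) : Config :=
  (step S r)^[T] ⟨[P], initState d params⟩

/-- The `d`-dimensional output vector: the block of `d` real cells that starts at the address
held by natural cell `0`. -/
def State.output (s : State) (d : ℕ) : Fin d → ℝ := fun i => s.real (s.nat 0 + i)

end RealRAM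

/-! ### Halfspaces with an `L_p` margin -/

namespace MarginLearning

/-- The closed unit ball of `ℝ^d` for the `L_p` norm. -/
def lpBall (p : ℝ≥0∞) (d : ℕ) : Set (Fin d → ℝ) := {x | ‖WithLp.toLp p x‖ ≤ 1}

/-- Labelled examples: points of the `L_p` unit ball with a label in `{1, -1}`. -/
abbrev Example (p : ℝ≥0∞) (d : ℕ) : Type := ↥(lpBall p d) × ↥({1, -1} : Set ℝ)

/-- The sign function with values in `{1, -1}`, `sgn 0 = 1`. -/
noncomputable def sgn (u : ℝ) : ℝ := if 0 ≤ u then 1 else -1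

/-- The `γ`-margin error of `w`. -/
noncomputable def err {p : ℝ≥0∞} {d : ℕ} (D : Measure (Example p d)) (γ : ℝ) (w : Fin d → ℝ) : ℝ :=
  D.real {z | sgn (w ⬝ᵥ z.1.1 - z.2.1 * γ) ≠ z.2.1}

/-- The best `γ`-margin error over the unit ball of the dual norm. -/
noncomputable def opt {p : ℝ≥0∞} {d : ℕ} (D : Measure (Example p d)) (γ : ℝ) : ℝ :=
  ⨅ w : ↥(lpBall p.conjExponent d), err D γ w.1

/-- An example as the machine sees it: the coordinates (zero beyond the dimension), the label. -/
def encode {p : ℝ≥0∞} {d : ℕ} (z : Example p d) : (ℕ → ℝ) × ℝ :=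
  (fun j => if h : j < d then z.1.1 ⟨j, h⟩ else 0, z.2.1)

/-- The law of an infinite sequence of independent fair bits. -/
noncomputable def coinMeasure : Measure (ℕ → Bool) :=
  Measure.infinitePi fun _ => (PMF.uniformOfFintype Bool).toMeasure

/-- The final configuration of the program `P` on input `d`, `params` after at most `T` steps, on
the examples `S` and the random bits `r`. -/
noncomputable def outcome {p : ℝ≥0∞} {d : ℕ} (P : RealRAM.Prog) (params : List ℝ) (T : ℕ)
    (S : ℕ → Example p d) (r : ℕ → Bool) : RealRAM.Config :=
  RealRAM.run P d params (fun n => encode (S n)) r T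

/-- On the input `d`, `params`, the program `P` is a proper `ν`-robust `α`-agnostic learner for
`L_p`-`γ`-margin halfspaces in dimension `d`, with additive error `ε` and failure probability
`τ`, that draws at most `m` examples and runs in time at most `t`.  The bounds `m` and `t`, and
membership of the output in the dual unit ball, hold for all examples and all random bits. -/
structure IsProperRobustLearner (P : RealRAM.Prog) (params : List ℝ) (p : ℝ≥0∞) (d : ℕ)
    (γ ν α ε τ m t : ℝ) : Prop where
  halts : ∀ (S : ℕ → Example p d) (r : ℕ → Bool), (outcome P params ⌊t⌋₊ S r).todo = []
  draws_le : ∀ (S : ℕ → Example p d) (r : ℕ → Bool),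
    ((outcome P params ⌊t⌋₊ S r).mem.draws : ℝ) ≤ m
  proper : ∀ (S : ℕ → Example p d) (r : ℕ → Bool),
    (outcome P params ⌊t⌋₊ S r).mem.output d ∈ lpBall p.conjExponent d
  robust : ∀ (D : Measure (Example p d)) [IsProbabilityMeasure D],
    ((Measure.infinitePi fun _ : ℕ => D).prod coinMeasure)
      {ω | ¬ err D ((1 - ν) * γ) ((outcome P params ⌊t⌋₊ ω.1 ω.2).mem.output d)
          ≤ α * opt D γ + ε} ≤ ENNReal.ofReal τ

end MarginLearning

/-!
# A proper robust agnostic learner for halfspaces with a margin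

The learner draws `m = O(H / (ε ν γ)²)` examples, where `H` is `3 p` for finite `p` and of order
`log d` for `p = ∞`, and replaces `(x, y)` by the vector `z = y x`: the halfspace `w` errs at margin
`γ` when `⟨w, z⟩ < γ`.  It then makes `R` trials.  A trial starts at `θ = 0` and takes
`T = O(H / (ν γ)²)` steps; a step forms the halfspace `w = L θ`, compares its number of mistakes at
the intermediate margin `γ₁ = (1 - ν / 2) γ` with the best one so far, and adds to `θ` a random
example `z i` on which `w` makes a mistake.

*Optimization.*  `L θ` approximates the gradient at `θ` of a potential `g` that dominates `⟨w, θ⟩`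
for every `w` in the dual ball and grows in a step by at most `⟨L θ, z⟩ + κ`: a smoothed norm
`(∑ |θ j| ^ p + a ^ p) ^ (1 / p)` (`lpPot_add_le`) or a softmax (`softmax_add_le`).  If `L θ` makes
more than `1 + δ` times as many mistakes at `γ₁` as `w` at `γ`, then with probability at least
`δ / 4` the selected mistake of `L θ` is an example on which `w` has margin `γ` (`card_good_ge`).
After `T` such steps in a row `T γ ≤ ⟨w, θ⟩ ≤ g θ ≤ g 0 + T (γ₁ + κ)`, which the choice of `T`
excludes (`trialLength_bound`).  So a trial fails with probability at most `1 - (δ / 4) ^ T`, and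
`R ≥ 3 (4 / δ) ^ T` independent trials find a good halfspace (`coinMeasure_fail_le`).

*Generalization.*  The same potentials give uniform convergence: the expected supremum of the
deviations of a ramp loss is bounded by symmetrizing and contracting one example after the other,
each step costing the second-order term `κ` of the potential
(`measure_exists_margin_error_le`).  Together with Chebyshev's inequality for a nearly optimal `w`
(`measure_frequency_le`), this bounds the probability of failure by `1 / 3` (`measure_fail_le`).

*The machine.*  The learner is written in a small structured language with a denotation `Cmd.den`
and a running time `Cmd.cost`, which is compiled to the real RAM (`Cmd.compile_runs`,
`Cmd.run_toProg`).  The machine has neither roots nor exponentials, so powers are replaced by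
powers of a base `b` slightly above `1`, found by repeated multiplication (`powA`, `raise`); the
error is a factor close to `1`, and `κ` absorbs it (`lpLink_approx`, `softLink_approx`).  All
factors of the running time other than the powers of `d / ε` (of `1 / ε` for `p = ∞`) are absorbed
in the exponential one (`time_le`).
-/

/-! ### A structured language over the real RAM -/

namespace RealRAM

/-- Names of arithmetic operations on reals. -/
inductive ROp where
  | add | sub | mul | div

/-- The function denoted by the name of an arithmetic operation. -/
noncomputable def ROp.fn : ROp → ℝ → ℝ → ℝ
  | .add => (· + ·)
  | .sub => (· - ·)
  | .mul => (· * ·)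
  | .div => (· / ·)

/-- The machine instruction for an arithmetic operation. -/
def ROp.toOp : ROp → Addr → Addr → Addr → Op
  | .add => .radd
  | .sub => .rsub
  | .mul => .rmul
  | .div => .rdiv

/-- A structured program: natural variables, real variables and six real arrays, each named by a
numeral.  `ceil v x` stores the natural ceiling of the real variable `x` in the natural variable
`v`; `ifLt x y A B` branches on `x < y`; `loop i n A` runs `A` for `i = 0, …, n - 1`. -/
inductive Cmd where
  | skip
  | nconst (v k : ℕ)
  | nadd (v u w : ℕ)
  | rofNat (v u : ℕ)
  | rcopy (v u : ℕ)
  | rop (o : ROp) (v u w : ℕ)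
  | load (v : ℕ) (c : Fin 6) (i : ℕ)
  | store (c : Fin 6) (i v : ℕ)
  | flip (v : ℕ)
  | draw
  | coord (v i : ℕ)
  | label (v : ℕ)
  | ceil (v x : ℕ)
  | seq (A B : Cmd)
  | ifLt (x y : ℕ) (A B : Cmd)
  | loop (i n : ℕ) (A : Cmd)

/-- Sequential composition of a list of commands. -/
def Cmd.block : List Cmd → Cmd
  | [] => .skip
  | c :: l => .seq c (Cmd.block l)

/-- The memory seen by a structured program. -/
@[ext] structure Mem where
  n : ℕ → ℕ
  r : ℕ → ℝ
  a : Fin 6 → ℕ → ℝ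
  exX : ℕ → ℝ
  exY : ℝ
  draws : ℕ
  flips : ℕ

namespace Mem

/-- Writing to a natural variable. -/
def setN (s : Mem) (v k : ℕ) : Mem := { s with n := Function.update s.n v k }

/-- Writing to a real variable. -/
noncomputable def setR (s : Mem) (v : ℕ) (x : ℝ) : Mem := { s with r := Function.update s.r v x }

/-- Writing to an array. -/
noncomputable def setA (s : Mem) (c : Fin 6) (i : ℕ) (x : ℝ) : Mem :=
  { s with a := Function.update s.a c (Function.update (s.a c) i x) }

variable (s : Mem) (v k i : ℕ) (x : ℝ) (c : Fin 6)

@[simp] lemma setN_n : (s.setN v k).n = Function.update s.n v k := rfl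
@[simp] lemma setN_r : (s.setN v k).r = s.r := rfl
@[simp] lemma setN_a : (s.setN v k).a = s.a := rfl
@[simp] lemma setN_exX : (s.setN v k).exX = s.exX := rfl
@[simp] lemma setN_exY : (s.setN v k).exY = s.exY := rfl
@[simp] lemma setN_draws : (s.setN v k).draws = s.draws := rfl
@[simp] lemma setN_flips : (s.setN v k).flips = s.flips := rfl
@[simp] lemma setR_n : (s.setR v x).n = s.n := rfl
@[simp] lemma setR_r : (s.setR v x).r = Function.update s.r v x := rfl
@[simp] lemma setR_a : (s.setR v x).a = s.a := rfl
@[simp] lemma setR_exX : (s.setR v x).exX = s.exX := rfl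
@[simp] lemma setR_exY : (s.setR v x).exY = s.exY := rfl
@[simp] lemma setR_draws : (s.setR v x).draws = s.draws := rfl
@[simp] lemma setR_flips : (s.setR v x).flips = s.flips := rfl
@[simp] lemma setA_n : (s.setA c i x).n = s.n := rfl
@[simp] lemma setA_r : (s.setA c i x).r = s.r := rfl
@[simp] lemma setA_a :
    (s.setA c i x).a = Function.update s.a c (Function.update (s.a c) i x) := rfl
@[simp] lemma setA_exX : (s.setA c i x).exX = s.exX := rfl
@[simp] lemma setA_exY : (s.setA c i x).exY = s.exY := rfl
@[simp] lemma setA_draws : (s.setA c i x).draws = s.draws := rfl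
@[simp] lemma setA_flips : (s.setA c i x).flips = s.flips := rfl

end Mem

/-- Iteration of a step that knows its index. -/
def iter {α : Type*} (f : ℕ → α → α) : ℕ → α → α
  | 0, s => s
  | k + 1, s => f k (iter f k s)

namespace Cmd

/-- The effect of a structured program. -/
noncomputable def den (S : ℕ → (ℕ → ℝ) × ℝ) (b : ℕ → Bool) : Cmd → Mem → Mem
  | skip, s => s
  | nconst v k, s => s.setN v k
  | nadd v u w, s => s.setN v (s.n u + s.n w)
  | rofNat v u, s => s.setR v (s.n u)
  | rcopy v u, s => s.setR v (s.r u)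
  | rop o v u w, s => s.setR v (o.fn (s.r u) (s.r w))
  | load v c i, s => s.setR v (s.a c (s.n i))
  | store c i v, s => s.setA c (s.n i) (s.r v)
  | flip v, s => { s.setN v (if b s.flips then 1 else 0) with flips := s.flips + 1 }
  | draw, s => { s with exX := (S s.draws).1, exY := (S s.draws).2, draws := s.draws + 1 }
  | coord v i, s => s.setR v (s.exX (s.n i))
  | label v, s => s.setR v s.exY
  | ceil v x, s => s.setN v ⌈s.r x⌉₊
  | seq A B, s => den S b B (den S b A s)
  | ifLt x y A B, s => if s.r x < s.r y then den S b A s else den S b B s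
  | loop i n A, s => (iter (fun k t => den S b A (t.setN i k)) (s.n n) s).setN i (s.n n)

/-- An upper bound for the running time of the compiled program. -/
noncomputable def cost (S : ℕ → (ℕ → ℝ) × ℝ) (b : ℕ → Bool) : Cmd → Mem → ℕ
  | ceil _ x, s => 5 + 6 * ⌈s.r x⌉₊
  | seq A B, s => 1 + cost S b A s + cost S b B (den S b A s)
  | ifLt x y A B, s => 1 + (if s.r x < s.r y then cost S b A s else cost S b B s)
  | loop i n A, s => 3 + ∑ k ∈ Finset.range (s.n n),
      (cost S b A ((iter (fun k t => den S b A (t.setN i k)) k s).setN i k) + 6)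
  | load _ _ _, _ => 14
  | store _ _ _, _ => 14
  | _, _ => 1

/-- The natural variables that a program writes to. -/
def wn : Cmd → List ℕ
  | nconst v _ => [v]
  | nadd v _ _ => [v]
  | flip v => [v]
  | ceil v _ => [v]
  | seq A B => wn A ++ wn B
  | ifLt _ _ A B => wn A ++ wn B
  | loop i _ A => i :: wn A
  | _ => []

/-- The real variables that a program writes to. -/
def wr : Cmd → List ℕ
  | rofNat v _ => [v]
  | rcopy v _ => [v]
  | rop _ v _ _ => [v]
  | load v _ _ => [v]
  | coord v _ => [v]
  | label v => [v]
  | seq A B => wr A ++ wr B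
  | ifLt _ _ A B => wr A ++ wr B
  | loop _ _ A => wr A
  | _ => []

/-- The arrays that a program writes to. -/
def wa : Cmd → List (Fin 6)
  | store c _ _ => [c]
  | seq A B => wa A ++ wa B
  | ifLt _ _ A B => wa A ++ wa B
  | loop _ _ A => wa A
  | _ => []

/-- The program tosses no coin. -/
def noFlip : Cmd → Bool
  | flip _ => false
  | seq A B => noFlip A && noFlip B
  | ifLt _ _ A B => noFlip A && noFlip B
  | loop _ _ A => noFlip A
  | _ => true

/-- The program draws no example. -/
def noDraw : Cmd → Bool
  | draw => false
  | seq A B => noDraw A && noDraw B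
  | ifLt _ _ A B => noDraw A && noDraw B
  | loop _ _ A => noDraw A
  | _ => true

/-- No loop body modifies the counter or the bound of its loop. -/
def WF : Cmd → Prop
  | seq A B => WF A ∧ WF B
  | ifLt _ _ A B => WF A ∧ WF B
  | loop i n A => i ∉ wn A ∧ n ∉ wn A ∧ i ≠ n ∧ WF A
  | _ => True

end Cmd

lemma iter_inv {α : Type*} {f : ℕ → α → α} {I : ℕ → α → Prop} {s : α} (N : ℕ) (h0 : I 0 s)
    (h : ∀ k t, k < N → I k t → I (k + 1) (f k t)) : I N (iter f N s) := by
  induction N with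
  | zero => exact h0
  | succ N ih => exact h N _ N.lt_succ_self (ih fun k t hk => h k t (hk.trans N.lt_succ_self))

namespace Cmd
variable (S : ℕ → (ℕ → ℝ) × ℝ) (b : ℕ → Bool)

lemma den_n_of_notMem (c : Cmd) : ∀ (s : Mem) {v : ℕ}, v ∉ c.wn → (den S b c s).n v = s.n v := by
  induction c with
  | seq A B ihA ihB =>
    intro s v h; simp only [wn, List.mem_append, not_or] at h
    simp only [den, ihB _ h.2, ihA _ h.1]
  | ifLt x y A B ihA ihB =>
    intro s v h; simp only [wn, List.mem_append, not_or] at h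
    simp only [den]; split
    · exact ihA _ h.1
    · exact ihB _ h.2
  | loop i n A ih =>
    intro s v h; simp only [wn, List.mem_cons, not_or] at h
    simp only [den, Mem.setN_n, Function.update_of_ne h.1]
    refine iter_inv (I := fun _ (t : Mem) => t.n v = s.n v) _ rfl fun k t _ ht => ?_
    rw [ih _ h.2, Mem.setN_n, Function.update_of_ne h.1, ht]
  | _ => intro s v h; simp_all [wn, den]

lemma den_r_of_notMem (c : Cmd) : ∀ (s : Mem) {v : ℕ}, v ∉ c.wr → (den S b c s).r v = s.r v := by
  induction c with
  | seq A B ihA ihB =>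
    intro s v h; simp only [wr, List.mem_append, not_or] at h
    simp only [den, ihB _ h.2, ihA _ h.1]
  | ifLt x y A B ihA ihB =>
    intro s v h; simp only [wr, List.mem_append, not_or] at h
    simp only [den]; split
    · exact ihA _ h.1
    · exact ihB _ h.2
  | loop i n A ih =>
    intro s v h; simp only [wr] at h
    simp only [den, Mem.setN_r]
    refine iter_inv (I := fun _ (t : Mem) => t.r v = s.r v) _ rfl fun k t _ ht => ?_
    rw [ih _ h, Mem.setN_r, ht]
  | _ => intro s v h; simp_all [wr, den]

lemma den_a_of_notMem (c : Cmd) : ∀ (s : Mem) {v : Fin 6}, v ∉ c.wa →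
    (den S b c s).a v = s.a v := by
  induction c with
  | seq A B ihA ihB =>
    intro s v h; simp only [wa, List.mem_append, not_or] at h
    simp only [den, ihB _ h.2, ihA _ h.1]
  | ifLt x y A B ihA ihB =>
    intro s v h; simp only [wa, List.mem_append, not_or] at h
    simp only [den]; split
    · exact ihA _ h.1
    · exact ihB _ h.2
  | loop i n A ih =>
    intro s v h; simp only [wa] at h
    simp only [den, Mem.setN_a]
    refine iter_inv (I := fun _ (t : Mem) => t.a v = s.a v) _ rfl fun k t _ ht => ?_
    rw [ih _ h, Mem.setN_a, ht]
  | _ => intro s v h; simp_all [wa, den]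

lemma den_flips_of_noFlip (c : Cmd) : ∀ (s : Mem), c.noFlip = true →
    (den S b c s).flips = s.flips := by
  induction c with
  | seq A B ihA ihB =>
    intro s h; simp only [noFlip, Bool.and_eq_true] at h
    simp only [den, ihB _ h.2, ihA _ h.1]
  | ifLt x y A B ihA ihB =>
    intro s h; simp only [noFlip, Bool.and_eq_true] at h
    simp only [den]; split
    · exact ihA _ h.1
    · exact ihB _ h.2
  | loop i n A ih =>
    intro s h; simp only [noFlip] at h
    simp only [den, Mem.setN_flips]
    refine iter_inv (I := fun _ (t : Mem) => t.flips = s.flips) _ rfl fun k t _ ht => ?_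
    rw [ih _ h, Mem.setN_flips, ht]
  | _ => intro s h; simp_all [noFlip, den]

lemma den_draws_of_noDraw (c : Cmd) : ∀ (s : Mem), c.noDraw = true →
    (den S b c s).draws = s.draws := by
  induction c with
  | seq A B ihA ihB =>
    intro s h; simp only [noDraw, Bool.and_eq_true] at h
    simp only [den, ihB _ h.2, ihA _ h.1]
  | ifLt x y A B ihA ihB =>
    intro s h; simp only [noDraw, Bool.and_eq_true] at h
    simp only [den]; split
    · exact ihA _ h.1
    · exact ihB _ h.2
  | loop i n A ih =>
    intro s h; simp only [noDraw] at h
    simp only [den, Mem.setN_draws]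
    refine iter_inv (I := fun _ (t : Mem) => t.draws = s.draws) _ rfl fun k t _ ht => ?_
    rw [ih _ h, Mem.setN_draws, ht]
  | _ => intro s h; simp_all [noDraw, den]

end Cmd
end RealRAM

/-! ### Compilation to machine programs -/

namespace RealRAM

/-- The structured view of the machine memory: natural variable `v` is cell `2 v`, real variable
`v` is cell `8 v`, and entry `i` of array `c` is cell `8 i + c + 1`. -/
def State.toMem (s : State) : Mem where
  n := fun v => s.nat (2 * v)
  r := fun v => s.real (8 * v)
  a := fun c i => s.real (8 * i + c + 1)
  exX := s.exX
  exY := s.exY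
  draws := s.draws
  flips := s.flips

lemma toMem_setN_even (s : State) (v k : ℕ) :
    (s.setN (.dir (2 * v)) k).toMem = s.toMem.setN v k := by
  ext i <;> simp [State.toMem, State.setN, State.addr, Function.update_apply]

lemma toMem_setN_odd (s : State) {v : ℕ} (k : ℕ) (hv : v % 2 = 1) :
    (s.setN (.dir v) k).toMem = s.toMem := by
  ext i <;> simp [State.toMem, State.setN, State.addr, Function.update_apply]
  intro h; omega

lemma toMem_setR_var (s : State) (v : ℕ) (x : ℝ) :
    (s.setR (.dir (8 * v)) x).toMem = s.toMem.setR v x := by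
  ext i j <;> simp [State.toMem, State.setR, State.addr, Function.update_apply]
  intro h; omega

lemma toMem_setR_temp (s : State) (x : ℝ) : (s.setR (.dir 7) x).toMem = s.toMem := by
  ext i j <;> simp [State.toMem, State.setR, State.addr, Function.update_apply]
  · intro h; omega
  · intro h; omega

lemma toMem_setR_arr (s : State) {v : ℕ} (c : Fin 6) (i : ℕ) (x : ℝ)
    (hv : s.nat v = 8 * i + c + 1) :
    (s.setR (.ind v) x).toMem = s.toMem.setA c i x := by
  ext c' j
  all_goals simp only [State.toMem, State.setR, State.addr, Function.update_apply, hv,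
    Mem.setA_n, Mem.setA_a, Mem.setA_r, Mem.setA_exX, Mem.setA_exY, Mem.setA_draws, Mem.setA_flips]
  · rw [if_neg (by omega)]
  · by_cases hc : c' = c
    · subst hc
      simp only [if_true, Function.update_apply]
      congr 1
      simp
    · rw [if_neg (by intro h; apply hc; ext; omega), if_neg hc]

/-- Executing `P` from memory `s` takes `n` steps and leads to memory `s'`. -/
def Runs (S : ℕ → (ℕ → ℝ) × ℝ) (b : ℕ → Bool) (P : Prog) (s s' : State) (n : ℕ) : Prop :=
  ∀ k, (step S b)^[n] ⟨P :: k, s⟩ = ⟨k, s'⟩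

section
variable {S : ℕ → (ℕ → ℝ) × ℝ} {b : ℕ → Bool} {P Q : Prog} {s s' s'' : State} {n m : ℕ} {t : Test}

lemma Runs.op (o : Op) (s : State) : Runs S b (.op o) s (o.exec S b s) 1 := fun _ => rfl

lemma Runs.seq (hP : Runs S b P s s' n) (hQ : Runs S b Q s' s'' m) :
    Runs S b (.seq P Q) s s'' (1 + n + m) := fun k => by
  rw [show 1 + n + m = m + n + 1 by ring, Function.iterate_add_apply, Function.iterate_add_apply]
  change (step S b)^[m] ((step S b)^[n] ⟨P :: Q :: k, s⟩) = _
  rw [hP, hQ]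

lemma Runs.ite_pos (ht : t.Holds s) (hP : Runs S b P s s' n) :
    Runs S b (.ite t P Q) s s' (1 + n) := fun k => by
  rw [add_comm, Function.iterate_add_apply]
  have : (step S b)^[1] ⟨.ite t P Q :: k, s⟩ = ⟨P :: k, s⟩ := by simp [step, ht]
  rw [this, hP]

lemma Runs.ite_neg (ht : ¬ t.Holds s) (hQ : Runs S b Q s s' n) :
    Runs S b (.ite t P Q) s s' (1 + n) := fun k => by
  rw [add_comm, Function.iterate_add_apply]
  have : (step S b)^[1] ⟨.ite t P Q :: k, s⟩ = ⟨Q :: k, s⟩ := by simp [step, ht]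
  rw [this, hQ]

lemma Runs.loop_pos (ht : t.Holds s) (hP : Runs S b P s s' n) (hL : Runs S b (.loop t P) s' s'' m) :
    Runs S b (.loop t P) s s'' (1 + n + m) := fun k => by
  rw [show 1 + n + m = m + n + 1 by ring, Function.iterate_add_apply, Function.iterate_add_apply]
  have : (step S b)^[1] ⟨.loop t P :: k, s⟩ = ⟨P :: .loop t P :: k, s⟩ := by simp [step, ht]
  rw [this, hP, hL]

lemma Runs.loop_neg (ht : ¬ t.Holds s) : Runs S b (.loop t P) s s 1 := fun k => by
  simp [step, ht]

lemma Runs.cast (h : Runs S b P s s' n) (hs : s' = s'') (hn : n = m) : Runs S b P s s'' m := by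
  subst hs; subst hn; exact h

end

/-- The address computation for entry `i` of array `c`; the address is left in cell `1`. -/
def addrProg (c : Fin 6) (i : ℕ) : Prog :=
  .seq (.op (.ncopy (.dir 1) (.dir (2 * i)))) <|
  .seq (.op (.nadd (.dir 1) (.dir 1) (.dir 1))) <|
  .seq (.op (.nadd (.dir 1) (.dir 1) (.dir 1))) <|
  .seq (.op (.nadd (.dir 1) (.dir 1) (.dir 1))) <|
  .seq (.op (.nconst (.dir 3) (c + 1))) <|
  .op (.nadd (.dir 1) (.dir 1) (.dir 3))

/-- The machine program of a structured program. -/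
def Cmd.compile : Cmd → Prog
  | skip => .op (.nconst (.dir 1) 0)
  | nconst v k => .op (.nconst (.dir (2 * v)) k)
  | nadd v u w => .op (.nadd (.dir (2 * v)) (.dir (2 * u)) (.dir (2 * w)))
  | rofNat v u => .op (.rofNat (.dir (8 * v)) (.dir (2 * u)))
  | rcopy v u => .op (.rcopy (.dir (8 * v)) (.dir (8 * u)))
  | rop o v u w => .op (o.toOp (.dir (8 * v)) (.dir (8 * u)) (.dir (8 * w)))
  | load v c i => .seq (addrProg c i) (.op (.rcopy (.dir (8 * v)) (.ind 1)))
  | store c i v => .seq (addrProg c i) (.op (.rcopy (.ind 1) (.dir (8 * v))))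
  | flip v => .op (.flip (.dir (2 * v)))
  | draw => .op .draw
  | coord v i => .op (.coord (.dir (8 * v)) (.dir (2 * i)))
  | label v => .op (.label (.dir (8 * v)))
  | ceil v x =>
    .seq (.op (.nconst (.dir (2 * v)) 0)) <|
    .seq (.op (.rofNat (.dir 7) (.dir (2 * v)))) <|
    .loop (.rlt (.dir 7) (.dir (8 * x))) <|
      .seq (.op (.nconst (.dir 1) 1)) <|
      .seq (.op (.nadd (.dir (2 * v)) (.dir (2 * v)) (.dir 1))) <|
      .op (.rofNat (.dir 7) (.dir (2 * v)))
  | seq A B => .seq A.compile B.compile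
  | ifLt x y A B => .ite (.rlt (.dir (8 * x)) (.dir (8 * y))) A.compile B.compile
  | loop i n A =>
    .seq (.op (.nconst (.dir (2 * i)) 0)) <|
    .loop (.nlt (.dir (2 * i)) (.dir (2 * n))) <|
      .seq A.compile <|
      .seq (.op (.nconst (.dir 1) 1)) <|
      .op (.nadd (.dir (2 * i)) (.dir (2 * i)) (.dir 1))

variable (S : ℕ → (ℕ → ℝ) × ℝ) (b : ℕ → Bool)

lemma addrProg_runs (c : Fin 6) (i : ℕ) (s : State) :
    ∃ s', Runs S b (addrProg c i) s s' 11 ∧ s'.nat 1 = 8 * s.nat (2 * i) + c + 1 ∧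
      s'.toMem = s.toMem ∧ s'.real = s.real := by
  refine ⟨_, ((Runs.op _ _).seq <| (Runs.op _ _).seq <| (Runs.op _ _).seq <| (Runs.op _ _).seq <|
    (Runs.op _ _).seq <| Runs.op _ _), ?_, ?_, ?_⟩
  · simp [Op.exec, State.setN, State.getN, State.addr]; ring
  · simp only [Op.exec]
    repeat rw [toMem_setN_odd _ _ (by norm_num)]
  · simp [Op.exec, State.setN]

lemma ceil_runs (v x : ℕ) (s : State) :
    ∃ s', Runs S b (Cmd.ceil v x).compile s s' (5 + 6 * ⌈s.real (8 * x)⌉₊) ∧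
      s'.toMem = s.toMem.setN v ⌈s.real (8 * x)⌉₊ := by
  set y := s.real (8 * x) with hy
  have main : ∀ (j : ℕ) (s1 : State), s1.nat (2 * v) + j = ⌈y⌉₊ → s1.real 7 = s1.nat (2 * v) →
      s1.real (8 * x) = y → s1.toMem = s.toMem.setN v (s1.nat (2 * v)) →
      ∃ s', Runs S b (.loop (.rlt (.dir 7) (.dir (8 * x))) <|
      .seq (.op (.nconst (.dir 1) 1)) <|
      .seq (.op (.nadd (.dir (2 * v)) (.dir (2 * v)) (.dir 1))) <|
      .op (.rofNat (.dir 7) (.dir (2 * v)))) s1 s' (1 + 6 * j) ∧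
        s'.toMem = s.toMem.setN v ⌈y⌉₊ := by
    intro j
    induction j with
    | zero =>
      intro s1 h1 h2 h3 h4
      refine ⟨s1, Runs.loop_neg ?_, ?_⟩
      · simp only [Test.Holds, State.getR, State.addr, h2, h3, not_lt]
        rw [add_zero] at h1; rw [h1]; exact Nat.le_ceil y
      · rw [h4, ← h1, add_zero]
    | succ j ih =>
      intro s1 h1 h2 h3 h4
      have hlt : (Test.rlt (.dir 7) (.dir (8 * x))).Holds s1 := by
        simp only [Test.Holds, State.getR, State.addr, h2, h3]
        exact Nat.lt_ceil.1 (by omega)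
      have hb : Runs S b (.seq (.op (.nconst (.dir 1) 1)) <|
        .seq (.op (.nadd (.dir (2 * v)) (.dir (2 * v)) (.dir 1))) <|
        .op (.rofNat (.dir 7) (.dir (2 * v)))) s1 _ _ :=
        (Runs.op _ _).seq <| (Runs.op _ _).seq <| Runs.op _ _
      have hv1 : ¬ (2 * v = 1) := by omega
      have hx7 : ¬ (8 * x = 7) := by omega
      obtain ⟨s', hs', hm⟩ := ih ((Op.rofNat (.dir 7) (.dir (2 * v))).exec S b
        ((Op.nadd (.dir (2 * v)) (.dir (2 * v)) (.dir 1)).exec S b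
          ((Op.nconst (.dir 1) 1).exec S b s1)))
        (by simp [Op.exec, State.setN, State.getN, State.addr, State.setR, hv1]; omega)
        (by simp [Op.exec, State.setN, State.getN, State.addr, State.setR])
        (by simp [Op.exec, State.setN, State.getN, State.addr, State.setR, hx7, h3])
        (by
          simp only [Op.exec]
          rw [toMem_setR_temp, toMem_setN_even, toMem_setN_odd _ _ (by norm_num), h4]
          ext i <;> simp [State.setN, State.setR, State.addr, State.getN, hv1,
            Function.update_apply]
          split_ifs <;> simp)
      exact ⟨s', (Runs.loop_pos hlt hb hs').cast rfl (by ring), hm⟩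
  obtain ⟨s', hs', hm⟩ := main ⌈y⌉₊ ((Op.rofNat (.dir 7) (.dir (2 * v))).exec S b
    ((Op.nconst (.dir (2 * v)) 0).exec S b s))
    (by simp [Op.exec, State.setN, State.getN, State.addr, State.setR])
    (by simp [Op.exec, State.setN, State.getN, State.addr, State.setR])
    (by
      have hx7 : ¬ (8 * x = 7) := by omega
      simp [Op.exec, State.setN, State.getN, State.addr, State.setR, hx7, hy])
    (by
      simp only [Op.exec]
      rw [toMem_setR_temp, toMem_setN_even]
      simp [State.setN, State.setR, State.addr])
  exact ⟨s', ((Runs.op _ _).seq <| (Runs.op _ _).seq hs').cast rfl (by ring), hm⟩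

/-- The compiled program computes the denotation, within the stated cost. -/
theorem Cmd.compile_runs (c : Cmd) : c.WF → ∀ s : State,
    ∃ s' n, Runs S b c.compile s s' n ∧ s'.toMem = c.den S b s.toMem ∧ n ≤ c.cost S b s.toMem := by
  induction c with
  | skip => exact fun _ s => ⟨_, _, Runs.op _ _, toMem_setN_odd _ _ (by norm_num), le_rfl⟩
  | nconst v k => exact fun _ s => ⟨_, _, Runs.op _ _, toMem_setN_even _ _ _, le_rfl⟩
  | nadd v u w => exact fun _ s => ⟨_, _, Runs.op _ _, toMem_setN_even _ _ _, le_rfl⟩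
  | rofNat v u => exact fun _ s => ⟨_, _, Runs.op _ _, toMem_setR_var _ _ _, le_rfl⟩
  | rcopy v u => exact fun _ s => ⟨_, _, Runs.op _ _, toMem_setR_var _ _ _, le_rfl⟩
  | rop o v u w =>
    refine fun _ s => ⟨_, _, Runs.op _ _, ?_, le_rfl⟩
    cases o <;> exact toMem_setR_var _ _ _
  | load v c i =>
    intro _ s
    obtain ⟨s', h1, h2, h3, h4⟩ := addrProg_runs S b c i s
    refine ⟨_, _, h1.seq (Runs.op _ _), ?_, by simp [Cmd.cost]⟩
    simp only [Op.exec]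
    rw [toMem_setR_var, h3]
    simp [Cmd.den, State.getR, State.addr, h2, h4, State.toMem]
  | store c i v =>
    intro _ s
    obtain ⟨s', h1, h2, h3, h4⟩ := addrProg_runs S b c i s
    refine ⟨_, _, h1.seq (Runs.op _ _), ?_, by simp [Cmd.cost]⟩
    simp only [Op.exec]
    rw [toMem_setR_arr _ c (s.nat (2 * i)) _ h2, h3]
    simp [Cmd.den, State.getR, State.addr, h4, State.toMem]
  | flip v =>
    refine fun _ s => ⟨_, _, Runs.op _ _, ?_, le_rfl⟩
    simp only [Op.exec]
    have := toMem_setN_even s v (if b s.flips then 1 else 0)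
    simp only [Cmd.den]
    exact congrArg (fun m : Mem => ({ m with flips := s.flips + 1 } : Mem)) this
  | draw => exact fun _ s => ⟨_, _, Runs.op _ _, rfl, le_rfl⟩
  | coord v i => exact fun _ s => ⟨_, _, Runs.op _ _, toMem_setR_var _ _ _, le_rfl⟩
  | label v => exact fun _ s => ⟨_, _, Runs.op _ _, toMem_setR_var _ _ _, le_rfl⟩
  | ceil v x =>
    intro _ s
    obtain ⟨s', h1, h2⟩ := ceil_runs S b v x s
    exact ⟨s', _, h1, h2, by simp [Cmd.cost, State.toMem]⟩
  | seq A B ihA ihB =>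
    intro h s
    obtain ⟨s1, n1, h1, h2, h3⟩ := ihA h.1 s
    obtain ⟨s2, n2, h4, h5, h6⟩ := ihB h.2 s1
    refine ⟨s2, _, h1.seq h4, by rw [h5, h2]; rfl, ?_⟩
    rw [h2] at h6
    simp only [Cmd.cost]; omega
  | ifLt x y A B ihA ihB =>
    intro h s
    by_cases hxy : s.toMem.r x < s.toMem.r y
    · obtain ⟨s1, n1, h1, h2, h3⟩ := ihA h.1 s
      refine ⟨s1, _, h1.ite_pos hxy, by simp [Cmd.den, hxy, h2], ?_⟩
      simp only [Cmd.cost, if_pos hxy]; omega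
    · obtain ⟨s1, n1, h1, h2, h3⟩ := ihB h.2 s
      refine ⟨s1, _, h1.ite_neg hxy, by simp [Cmd.den, hxy, h2], ?_⟩
      simp only [Cmd.cost, if_neg hxy]; omega
  | loop i n A ih =>
    intro ⟨hi, hn, hin, hA⟩ s
    set N := s.toMem.n n with hN
    set f : ℕ → Mem → Mem := fun k t => den S b A (t.setN i k) with hf
    have key : ∀ (j k : ℕ) (s1 : State), k + j = N → s1.toMem = (iter f k s.toMem).setN i k →
        ∃ s' m, Runs S b (.loop (.nlt (.dir (2 * i)) (.dir (2 * n))) <|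
          .seq A.compile <| .seq (.op (.nconst (.dir 1) 1)) <|
          .op (.nadd (.dir (2 * i)) (.dir (2 * i)) (.dir 1))) s1 s' m ∧
          s'.toMem = (iter f N s.toMem).setN i N ∧
          m ≤ 1 + ∑ l ∈ Finset.Ico k N, (cost S b A ((iter f l s.toMem).setN i l) + 6) := by
      have hnk : ∀ k, (iter f k s.toMem).n n = N := fun k =>
        iter_inv (I := fun _ (t : Mem) => t.n n = N) k rfl fun l t _ ht => by
          simp only [hf, den_n_of_notMem S b A _ hn, Mem.setN_n, Function.update_of_ne hin.symm, ht]
      intro j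
      induction j with
      | zero =>
        intro k s1 hk hs1
        have hkN : k = N := hk
        rw [hkN] at hs1 ⊢
        refine ⟨s1, _, Runs.loop_neg ?_, hs1, by simp⟩
        have e1 : s1.nat (2 * i) = N := by
          have := congrFun (congrArg Mem.n hs1) i; simpa [State.toMem] using this
        have e2 : s1.nat (2 * n) = N := by
          have := congrFun (congrArg Mem.n hs1) n
          rw [Mem.setN_n, Function.update_of_ne hin.symm, hnk] at this; exact this
        simp [Test.Holds, State.getN, State.addr, e1, e2]
      | succ j ihj =>
        intro k s1 hk hs1
        have e1 : s1.nat (2 * i) = k := by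
          have := congrFun (congrArg Mem.n hs1) i; simpa [State.toMem] using this
        have e2 : s1.nat (2 * n) = N := by
          have := congrFun (congrArg Mem.n hs1) n
          rw [Mem.setN_n, Function.update_of_ne hin.symm, hnk] at this; exact this
        have ht : (Test.nlt (.dir (2 * i)) (.dir (2 * n))).Holds s1 := by
          simp only [Test.Holds, State.getN, State.addr, e1, e2]; omega
        obtain ⟨s2, n2, r2, d2, c2⟩ := ih hA s1
        have e3 : s2.nat (2 * i) = k := by
          have := congrFun (congrArg Mem.n d2) i
          rw [den_n_of_notMem S b A _ hi] at this
          exact this.trans e1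
        have hv1 : ¬ (2 * i = 1) := by omega
        obtain ⟨s3, n3, r3, d3, c3⟩ := ihj (k + 1)
          ((Op.nadd (.dir (2 * i)) (.dir (2 * i)) (.dir 1)).exec S b
            ((Op.nconst (.dir 1) 1).exec S b s2)) (by omega) (by
              simp only [Op.exec]
              rw [toMem_setN_even, toMem_setN_odd _ _ (by norm_num), d2, hs1]
              simp [iter, hf, State.getN, State.addr, State.setN, hv1, e3])
        refine ⟨s3, _, Runs.loop_pos ht (r2.seq <| (Runs.op _ _).seq (Runs.op _ _)) r3, d3, ?_⟩
        rw [Finset.sum_eq_sum_Ico_succ_bot (by omega : k < N)]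
        rw [hs1] at c2
        omega
    obtain ⟨s', m, r, d, c⟩ := key N 0 ((Op.nconst (.dir (2 * i)) 0).exec S b s) (by omega)
      (by simp only [Op.exec]; rw [toMem_setN_even]; rfl)
    refine ⟨s', _, (Runs.op _ _).seq r, d, ?_⟩
    simp only [Cmd.cost]
    rw [Finset.range_eq_Ico]
    change _ ≤ 3 + ∑ l ∈ Finset.Ico 0 N, (cost S b A ((iter f l s.toMem).setN i l) + 6)
    omega

end RealRAM

/-! ### Output and complete runs -/

namespace RealRAM

/-- The final phase of a run: the first `d` entries of array `4` are moved to the real cells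
`0, …, d - 1`, where `d` is the content of natural cell `0`, and natural cell `0` is then cleared.
The move in place is safe because entry `j` sits at address `8 j + 5 > j`. -/
def outputProg : Prog :=
  .seq (.op (.nconst (.dir 2) 0)) <|
  .seq (.loop (.nlt (.dir 2) (.dir 0)) <|
      .seq (addrProg 4 1) <|
      .seq (.op (.rcopy (.ind 2) (.ind 1))) <|
      .seq (.op (.nconst (.dir 1) 1)) <|
      .op (.nadd (.dir 2) (.dir 2) (.dir 1))) <|
  .op (.nconst (.dir 0) 0)

section
variable (S : ℕ → (ℕ → ℝ) × ℝ) (b : ℕ → Bool)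

lemma addrProg_runs_nat (c : Fin 6) (i : ℕ) (s : State) :
    ∃ s', Runs S b (addrProg c i) s s' 11 ∧ s'.nat 1 = 8 * s.nat (2 * i) + c + 1 ∧
      s'.real = s.real ∧ s'.draws = s.draws ∧ ∀ j, j % 2 = 0 → s'.nat j = s.nat j := by
  obtain ⟨s', h1, h2, h3, h4⟩ := addrProg_runs S b c i s
  refine ⟨s', h1, h2, h4, congrArg Mem.draws h3, fun j hj => ?_⟩
  have := congrFun (congrArg Mem.n h3) (j / 2)
  simp only [State.toMem] at this
  rwa [show 2 * (j / 2) = j by omega] at this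

lemma outputProg_runs (s : State) (d : ℕ) (hd : s.nat 0 = d) :
    ∃ s' n, Runs S b outputProg s s' n ∧ n ≤ 18 * d + 6 ∧ s'.draws = s.draws ∧
      s'.output d = fun i : Fin d => s.toMem.a 4 i := by
  have key : ∀ (j k : ℕ) (s1 : State), k + j = d → s1.nat 0 = d → s1.nat 2 = k →
      s1.draws = s.draws →
      (∀ i, i < k → s1.real i = s.real (8 * i + 5)) →
      (∀ i, k ≤ i → s1.real (8 * i + 5) = s.real (8 * i + 5)) →
      ∃ s' n, Runs S b (.loop (.nlt (.dir 2) (.dir 0)) <|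
        .seq (addrProg 4 1) <|
        .seq (.op (.rcopy (.ind 2) (.ind 1))) <|
        .seq (.op (.nconst (.dir 1) 1)) <|
        .op (.nadd (.dir 2) (.dir 2) (.dir 1))) s1 s' n ∧ n ≤ 18 * j + 1 ∧ s'.draws = s.draws ∧
        ∀ i, i < d → s'.real i = s.real (8 * i + 5) := by
    intro j
    induction j with
    | zero =>
      intro k s1 hk h0 h2 hdr hlo hhi
      refine ⟨s1, 1, Runs.loop_neg ?_, by simp, hdr, fun i hi => hlo i (by omega)⟩
      simp [Test.Holds, State.getN, State.addr, h0, h2]; omega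
    | succ j ih =>
      intro k s1 hk h0 h2 hdr hlo hhi
      obtain ⟨s2, r2, e1, e2, e3, e4⟩ := addrProg_runs_nat S b 4 1 s1
      have h20 := e4 0 rfl
      have h22 := e4 2 rfl
      have e1' : s2.nat 1 = 8 * k + 5 := by rw [e1, mul_one, h2]; rfl
      obtain ⟨s', n, r, hn, hdr', hs'⟩ := ih (k + 1)
        ((Op.nadd (.dir 2) (.dir 2) (.dir 1)).exec S b ((Op.nconst (.dir 1) 1).exec S b
          ((Op.rcopy (.ind 2) (.ind 1)).exec S b s2))) (by omega)
        (by simp [Op.exec, State.setN, State.setR, State.addr, State.getN, h20, h0])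
        (by simp [Op.exec, State.setN, State.setR, State.addr, State.getN, h22, h2])
        (by simp [Op.exec, State.setN, State.setR, e3, hdr])
        (by
          intro i hi
          simp only [Op.exec, State.setN, State.setR, State.addr, State.getR, e1', e2, h22, h2]
          rcases eq_or_ne i k with rfl | h
          · simp [hhi i le_rfl]
          · simp [h, hlo i (by omega)])
        (by
          intro i hi
          simp only [Op.exec, State.setN, State.setR, State.addr, State.getR, e1', e2, h22, h2]
          rw [Function.update_of_ne (by omega), hhi i (by omega)])
      refine ⟨s', _, Runs.loop_pos ?_ (r2.seq <| (Runs.op _ _).seq <| (Runs.op _ _).seq <|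
        Runs.op _ _) r, by omega, hdr', hs'⟩
      simp [Test.Holds, State.getN, State.addr, h0, h2]; omega
  obtain ⟨s', n, r, hn, hdr, hs'⟩ := key d 0 ((Op.nconst (.dir 2) 0).exec S b s) (by omega)
    (by simp [Op.exec, State.setN, State.addr, hd]) (by simp [Op.exec, State.setN, State.addr])
    rfl (fun i hi => by omega) (fun i hi => rfl)
  refine ⟨_, _, (Runs.op _ _).seq <| r.seq (Runs.op _ _), by omega, hdr, ?_⟩
  funext i
  simp only [State.output, Op.exec, State.setN, State.addr, Function.update_self, zero_add]
  rw [hs' i i.2]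
  rfl

/-- The machine program that runs `c` and then outputs array `4`. -/
def Cmd.toProg (c : Cmd) : Prog := .seq c.compile outputProg

/-- The structured view of the initial memory. -/
noncomputable def initMem (d : ℕ) (params : List ℝ) : Mem := (initState d params).toMem

lemma step_iterate_nil (n : ℕ) (s : State) : (step S b)^[n] ⟨[], s⟩ = ⟨[], s⟩ := by
  induction n with
  | zero => rfl
  | succ n ih => rw [Function.iterate_succ_apply]; exact ih

/-- A structured program that keeps the dimension in variable `0` runs on the machine within its
cost plus `18 d + 7`. -/
theorem Cmd.run_toProg (c : Cmd) (hc : c.WF) (h0 : 0 ∉ c.wn) (d : ℕ) (params : List ℝ) (T : ℕ)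
    (hT : c.cost S b (initMem d params) + 18 * d + 7 ≤ T) :
    (run c.toProg d params S b T).todo = [] ∧
    (run c.toProg d params S b T).mem.draws = (c.den S b (initMem d params)).draws ∧
    (run c.toProg d params S b T).mem.output d =
      fun i : Fin d => (c.den S b (initMem d params)).a 4 i := by
  obtain ⟨s1, n1, r1, d1, c1⟩ := c.compile_runs S b hc (initState d params)
  have hd : s1.nat 0 = d := by
    have := congrFun (congrArg Mem.n d1) 0
    rw [den_n_of_notMem S b c _ h0] at this
    simpa [State.toMem, initState] using this
  obtain ⟨s2, n2, r2, c2, h1, h2⟩ := outputProg_runs S b s1 d hd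
  have hr := (r1.seq r2) []
  have hle : 1 + n1 + n2 ≤ T := by
    have : c.cost S b (initMem d params) = c.cost S b (initState d params).toMem := rfl
    omega
  have : run c.toProg d params S b T = ⟨[], s2⟩ := by
    rw [run, ← Nat.sub_add_cancel hle, Function.iterate_add_apply]
    rw [Cmd.toProg, hr, step_iterate_nil]
  rw [this]
  refine ⟨rfl, ?_, ?_⟩
  · rw [h1]; exact congrArg Mem.draws d1
  · rw [h2, d1]; rfl

end

/-! ### Measurability of the outcome -/

/-- A random memory all of whose components are measurable. -/
structure Mem.Meas {Ω : Type*} [MeasurableSpace Ω] (f : Ω → Mem) : Prop where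
  n : ∀ v, Measurable fun ω => (f ω).n v
  r : ∀ v, Measurable fun ω => (f ω).r v
  a : ∀ c i, Measurable fun ω => (f ω).a c i
  exX : ∀ i, Measurable fun ω => (f ω).exX i
  exY : Measurable fun ω => (f ω).exY
  draws : Measurable fun ω => (f ω).draws
  flips : Measurable fun ω => (f ω).flips

section
variable {Ω : Type*} [MeasurableSpace Ω]

lemma measurable_apply_nat {β : Type*} [MeasurableSpace β] {g : Ω → ℕ → β} {k : Ω → ℕ}
    (hg : ∀ i, Measurable fun ω => g ω i) (hk : Measurable k) : Measurable fun ω => g ω (k ω) := by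
  have : Measurable fun q : (ℕ → β) × ℕ => q.1 q.2 :=
    measurable_from_prod_countable_left fun i => measurable_pi_apply i
  exact this.comp ((measurable_pi_lambda _ hg).prodMk hk)

lemma Mem.Meas.piecewise {f g : Ω → Mem} (hf : Mem.Meas f) (hg : Mem.Meas g) {p : Ω → Prop}
    [DecidablePred p] (hp : MeasurableSet {ω | p ω}) :
    Mem.Meas fun ω => if p ω then f ω else g ω := by
  constructor
  · intro v; simp only [apply_ite Mem.n, ite_apply]; exact Measurable.ite hp (hf.n v) (hg.n v)
  · intro v; simp only [apply_ite Mem.r, ite_apply]; exact Measurable.ite hp (hf.r v) (hg.r v)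
  · intro c i; simp only [apply_ite Mem.a, ite_apply]; exact Measurable.ite hp (hf.a c i) (hg.a c i)
  · intro v; simp only [apply_ite Mem.exX, ite_apply]; exact Measurable.ite hp (hf.exX v) (hg.exX v)
  · simp only [apply_ite Mem.exY]; exact Measurable.ite hp hf.exY hg.exY
  · simp only [apply_ite Mem.draws]; exact Measurable.ite hp hf.draws hg.draws
  · simp only [apply_ite Mem.flips]; exact Measurable.ite hp hf.flips hg.flips

lemma Mem.Meas.apply_nat {g : ℕ → Ω → Mem} {k : Ω → ℕ} (hg : ∀ i, Mem.Meas (g i))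
    (hk : Measurable k) : Mem.Meas fun ω => g (k ω) ω where
  n v := measurable_apply_nat (g := fun ω i => (g i ω).n v) (fun i => (hg i).n v) hk
  r v := measurable_apply_nat (g := fun ω i => (g i ω).r v) (fun i => (hg i).r v) hk
  a c j := measurable_apply_nat (g := fun ω i => (g i ω).a c j) (fun i => (hg i).a c j) hk
  exX v := measurable_apply_nat (g := fun ω i => (g i ω).exX v) (fun i => (hg i).exX v) hk
  exY := measurable_apply_nat (g := fun ω i => (g i ω).exY) (fun i => (hg i).exY) hk
  draws := measurable_apply_nat (g := fun ω i => (g i ω).draws) (fun i => (hg i).draws) hk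
  flips := measurable_apply_nat (g := fun ω i => (g i ω).flips) (fun i => (hg i).flips) hk

lemma Mem.Meas.setN {f : Ω → Mem} (hf : Mem.Meas f) (v : ℕ) {k : Ω → ℕ} (hk : Measurable k) :
    Mem.Meas fun ω => (f ω).setN v (k ω) := by
  refine ⟨fun u => ?_, hf.r, hf.a, hf.exX, hf.exY, hf.draws, hf.flips⟩
  rcases eq_or_ne u v with rfl | h
  · simpa using hk
  · simpa [h] using hf.n u

lemma Mem.Meas.setR {f : Ω → Mem} (hf : Mem.Meas f) (v : ℕ) {x : Ω → ℝ} (hx : Measurable x) :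
    Mem.Meas fun ω => (f ω).setR v (x ω) := by
  refine ⟨hf.n, fun u => ?_, hf.a, hf.exX, hf.exY, hf.draws, hf.flips⟩
  rcases eq_or_ne u v with rfl | h
  · simpa using hx
  · simpa [h] using hf.r u

lemma Mem.Meas.setA {f : Ω → Mem} (hf : Mem.Meas f) (c : Fin 6) {i : Ω → ℕ} {x : Ω → ℝ}
    (hi : Measurable i) (hx : Measurable x) :
    Mem.Meas fun ω => (f ω).setA c (i ω) (x ω) := by
  refine ⟨hf.n, hf.r, fun u j => ?_, hf.exX, hf.exY, hf.draws, hf.flips⟩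
  rcases eq_or_ne u c with rfl | h
  · simp only [Mem.setA_a, Function.update_self, Function.update_apply]
    exact Measurable.ite (measurableSet_eq_fun measurable_const hi) hx (hf.a _ _)
  · simpa [h] using hf.a u j

/-- The memory after a structured program depends measurably on the examples, the random bits and
the initial memory. -/
theorem Cmd.meas_den {S : Ω → ℕ → (ℕ → ℝ) × ℝ} {b : Ω → ℕ → Bool} (hS : Measurable S)
    (hb : Measurable b) (c : Cmd) : ∀ {f : Ω → Mem}, Mem.Meas f →
      Mem.Meas fun ω => c.den (S ω) (b ω) (f ω) := by
  have hSi : ∀ i, Measurable fun ω => S ω i := fun i => (measurable_pi_apply i).comp hS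
  have hbi : ∀ i, Measurable fun ω => b ω i := fun i => (measurable_pi_apply i).comp hb
  induction c with
  | skip => exact fun hf => hf
  | nconst v k => exact fun hf => hf.setN v measurable_const
  | nadd v u w => exact fun hf => hf.setN v ((hf.n u).add (hf.n w))
  | rofNat v u => exact fun hf => hf.setR v (measurable_from_nat.comp (hf.n u))
  | rcopy v u => exact fun hf => hf.setR v (hf.r u)
  | rop o v u w =>
    intro f hf
    refine hf.setR v ?_
    cases o
    · exact (hf.r u).add (hf.r w)
    · exact (hf.r u).sub (hf.r w)
    · exact (hf.r u).mul (hf.r w)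
    · exact (hf.r u).div (hf.r w)
  | load v c i => exact fun hf => hf.setR v (measurable_apply_nat (fun j => hf.a c j) (hf.n i))
  | store c i v => exact fun hf => hf.setA c (hf.n i) (hf.r v)
  | flip v =>
    intro f hf
    have h1 : Measurable fun ω => if b ω (f ω).flips then 1 else 0 :=
      (measurable_of_finite (fun x : Bool => if x then 1 else 0)).comp
        (measurable_apply_nat hbi hf.flips)
    have := hf.setN v h1
    exact ⟨this.n, this.r, this.a, this.exX, this.exY, this.draws, hf.flips.add_const 1⟩
  | draw =>
    intro f hf
    have := measurable_apply_nat hSi hf.draws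
    exact ⟨hf.n, hf.r, hf.a, fun i => (measurable_pi_apply i).comp this.fst, this.snd,
      hf.draws.add_const 1, hf.flips⟩
  | coord v i => exact fun hf => hf.setR v (measurable_apply_nat hf.exX (hf.n i))
  | label v => exact fun hf => hf.setR v hf.exY
  | ceil v x => exact fun hf => hf.setN v (Nat.measurable_ceil.comp (hf.r x))
  | seq A B ihA ihB => exact fun hf => ihB (ihA hf)
  | ifLt x y A B ihA ihB =>
    intro f hf
    exact (ihA hf).piecewise (ihB hf) (measurableSet_lt (hf.r x) (hf.r y))
  | loop i n A ih =>
    intro f hf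
    refine Mem.Meas.setN ?_ i (hf.n n)
    refine Mem.Meas.apply_nat (g := fun k ω => iter (fun k t => den (S ω) (b ω) A (t.setN i k)) k
      (f ω)) (fun k => ?_) (hf.n n)
    induction k with
    | zero => exact hf
    | succ k ihk => exact ih (ihk.setN i measurable_const)

end

/-! ### Cost bounds for programs with fixed loop bounds -/

namespace Cmd

/-- An upper bound for the running time of a program in which the natural variables that bound
loops keep the values `e` throughout. -/
def costB (e : ℕ → ℕ) : Cmd → ℕ
  | seq A B => 1 + costB e A + costB e B
  | ifLt _ _ A B => 1 + (costB e A + costB e B)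
  | loop _ n A => 3 + e n * (costB e A + 6)
  | load _ _ _ => 14
  | store _ _ _ => 14
  | _ => 1

/-- The natural variables that bound loops. -/
def bounds : Cmd → List ℕ
  | seq A B => bounds A ++ bounds B
  | ifLt _ _ A B => bounds A ++ bounds B
  | loop _ n A => n :: bounds A
  | _ => []

/-- The program takes no ceiling. -/
def noCeil : Cmd → Bool
  | ceil _ _ => false
  | seq A B => noCeil A && noCeil B
  | ifLt _ _ A B => noCeil A && noCeil B
  | loop _ _ A => noCeil A
  | _ => true

variable (S : ℕ → (ℕ → ℝ) × ℝ) (b : ℕ → Bool)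

lemma cost_le_costB (e : ℕ → ℕ) {B : List ℕ} (c : Cmd) : ∀ s : Mem, c.noCeil = true →
    (∀ v ∈ c.bounds, v ∈ B) → (∀ v ∈ B, v ∉ c.wn) → (∀ v ∈ B, s.n v = e v) →
    c.cost S b s ≤ c.costB e := by
  induction c with
  | seq A C ihA ihC =>
    intro s h0 h1 h2 h3
    simp only [noCeil, Bool.and_eq_true, bounds, wn, List.mem_append, not_or] at h0 h1 h2
    simp only [cost, costB]
    have := ihA s h0.1 (fun v hv => h1 v (.inl hv)) (fun v hv => (h2 v hv).1) h3
    have := ihC (den S b A s) h0.2 (fun v hv => h1 v (.inr hv)) (fun v hv => (h2 v hv).2)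
      (fun v hv => by rw [den_n_of_notMem S b A _ (h2 v hv).1, h3 v hv])
    omega
  | ifLt x y A C ihA ihC =>
    intro s h0 h1 h2 h3
    simp only [noCeil, Bool.and_eq_true, bounds, wn, List.mem_append, not_or] at h0 h1 h2
    simp only [cost, costB]
    have := ihA s h0.1 (fun v hv => h1 v (.inl hv)) (fun v hv => (h2 v hv).1) h3
    have := ihC s h0.2 (fun v hv => h1 v (.inr hv)) (fun v hv => (h2 v hv).2) h3
    split <;> omega
  | loop i n A ih =>
    intro s h0 h1 h2 h3
    simp only [noCeil, bounds, wn, List.mem_cons, not_or] at h0 h1 h2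
    simp only [cost, costB]
    rw [h3 n (h1 n (.inl rfl))]
    have : ∀ k, ∀ v ∈ B, (iter (fun k t => den S b A (t.setN i k)) k s).n v = e v := by
      intro k v hv
      refine iter_inv (I := fun _ (t : Mem) => t.n v = e v) k (h3 v hv) fun k t _ ht => ?_
      rw [den_n_of_notMem S b A _ (h2 v hv).2, Mem.setN_n, Function.update_of_ne (h2 v hv).1, ht]
    have hle : ∀ k ∈ Finset.range (e n),
        cost S b A ((iter (fun k t => den S b A (t.setN i k)) k s).setN i k) + 6 ≤
          costB e A + 6 := fun k _ => by
      have := ih ((iter (fun k t => den S b A (t.setN i k)) k s).setN i k) h0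
        (fun v hv => h1 v (.inr hv)) (fun v hv => (h2 v hv).2)
        (fun v hv => by rw [Mem.setN_n, Function.update_of_ne (h2 v hv).1, this k v hv])
      omega
    have := Finset.sum_le_card_nsmul _ _ _ hle
    simp only [Finset.card_range, smul_eq_mul] at this
    omega
  | _ => intro s h0 h1 h2 h3; simp_all [cost, costB, noCeil]

end Cmd
end RealRAM

/-! ### Independent sequences: splitting off the first term -/

section Split
variable {X : Type*} [MeasurableSpace X] (D : Measure X) [IsProbabilityMeasure D]

/-- Under a product of copies of `D`, the first term and the remaining sequence are independent,
and the remaining sequence has the same law as the whole. -/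
theorem measurePreserving_head_tail :
    MeasurePreserving (fun S : ℕ → X => (S 0, fun n => S (n + 1)))
      (Measure.infinitePi fun _ : ℕ => D) (D.prod (Measure.infinitePi fun _ : ℕ => D)) := by
  set π := Measure.infinitePi fun _ : ℕ => D with hπ
  let cons : X × (ℕ → X) → ℕ → X := fun q n => Nat.casesOn n q.1 q.2
  have hcons : Measurable cons := by
    refine measurable_pi_lambda _ fun n => ?_
    cases n with
    | zero => exact measurable_fst
    | succ n => exact (measurable_pi_apply n).comp measurable_snd
  have hsplit : Measurable fun S : ℕ → X => (S 0, fun n => S (n + 1)) :=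
    (measurable_pi_apply 0).prodMk (measurable_pi_lambda _ fun n => measurable_pi_apply (n + 1))
  have key : (D.prod π).map cons = π := by
    refine Measure.eq_infinitePi _ fun s t ht => ?_
    classical
    obtain ⟨N, hN⟩ : ∃ N, s ⊆ Finset.range (N + 1) :=
      ⟨s.sup id, fun i hi => Finset.mem_range.2 (Nat.lt_succ_of_le (Finset.le_sup (f := id) hi))⟩
    set t' : ℕ → Set X := fun i => if i ∈ s then t i else Set.univ with ht'
    have ht'm : ∀ i, MeasurableSet (t' i) := fun i => by
      simp only [ht']; split
      · exact ht i
      · exact .univ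
    have hset : Set.pi (s : Set ℕ) t = Set.pi (Finset.range (N + 1) : Finset ℕ) t' := by
      ext f
      simp only [Set.mem_pi, Finset.mem_coe, ht']
      constructor
      · intro h i _; split
        · exact h i ‹_›
        · trivial
      · intro h i hi
        have := h i (hN hi); rwa [if_pos hi] at this
    have hpre : cons ⁻¹' (Set.pi (Finset.range (N + 1) : Finset ℕ) t') =
        t' 0 ×ˢ Set.pi (Finset.range N : Finset ℕ) (fun i => t' (i + 1)) := by
      ext q
      simp only [Set.mem_preimage, Set.mem_pi, Finset.mem_coe, Set.mem_prod, Finset.mem_range]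
      constructor
      · exact fun h => ⟨h 0 (by omega), fun i hi => h (i + 1) (by omega)⟩
      · rintro ⟨h0, h1⟩ i hi
        cases i with
        | zero => exact h0
        | succ i => exact h1 i (by omega)
    have hprod : ∏ i ∈ s, D (t i) = ∏ i ∈ Finset.range (N + 1), D (t' i) := by
      rw [← Finset.prod_subset hN (f := fun i => D (t' i))]
      · exact Finset.prod_congr rfl fun i hi => by simp [ht', hi]
      · intro i _ hi; simp [ht', hi]
    rw [hset, Measure.map_apply hcons (.pi (Finset.countable_toSet _) fun i _ => ht'm i), hpre,
      Measure.prod_prod, hπ, Measure.infinitePi_pi _ (fun i _ => ht'm _), hprod,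
      Finset.prod_range_succ', mul_comm]
  refine ⟨hsplit, ?_⟩
  conv_lhs => rw [← key]
  rw [Measure.map_map hsplit hcons]
  exact Measure.map_id

end Split

/-! ### Blocks of fair random bits -/

namespace MarginLearning

instance : IsProbabilityMeasure coinMeasure := by unfold coinMeasure; infer_instance

/-- The stream of bits that remains after `k` bits have been read. -/
def dropBits (k : ℕ) (b : ℕ → Bool) : ℕ → Bool := fun n => b (n + k)

lemma dropBits_dropBits (k l : ℕ) (b : ℕ → Bool) :
    dropBits k (dropBits l b) = dropBits (l + k) b := by
  funext n; simp only [dropBits]; congr 1; ring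

lemma measurable_dropBits (k : ℕ) : Measurable (dropBits k) :=
  measurable_pi_lambda _ fun n => measurable_pi_apply (n + k)

/-- The number whose binary digits are those of `u` followed by the next `k` bits of `b`. -/
def readBits (b : ℕ → Bool) (u : ℕ) : ℕ → ℕ
  | 0 => u
  | k + 1 => 2 * readBits b u k + if b k then 1 else 0

lemma readBits_succ' (b : ℕ → Bool) (u k : ℕ) :
    readBits b u (k + 1) = readBits (dropBits 1 b) (2 * u + if b 0 then 1 else 0) k := by
  induction k with
  | zero => rfl
  | succ k ih => rw [readBits, ih]; rfl

lemma coinMeasure_head_tail (A : Bool → Set (ℕ → Bool)) (hA : ∀ x, MeasurableSet (A x)) :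
    coinMeasure {b | dropBits 1 b ∈ A (b 0)} =
      2⁻¹ * (coinMeasure (A true) + coinMeasure (A false)) := by
  have h := measurePreserving_head_tail (PMF.uniformOfFintype Bool).toMeasure
  have hset : MeasurableSet {q : Bool × (ℕ → Bool) | q.2 ∈ A q.1} := by
    have : {q : Bool × (ℕ → Bool) | q.2 ∈ A q.1} = ⋃ x, {x} ×ˢ A x := by
      ext q; simp
    rw [this]
    exact .iUnion fun x => (measurableSet_singleton x).prod (hA x)
  have h2 := h.measure_preimage hset.nullMeasurableSet
  have h3 : (fun S : ℕ → Bool => (S 0, fun n => S (n + 1))) ⁻¹'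
      {q : Bool × (ℕ → Bool) | q.2 ∈ A q.1} = {b | dropBits 1 b ∈ A (b 0)} := rfl
  rw [h3] at h2
  rw [coinMeasure, h2]
  have hsplit : {q : Bool × (ℕ → Bool) | q.2 ∈ A q.1} =
      ({true} ×ˢ A true) ∪ ({false} ×ˢ A false) := by
    ext ⟨x, y⟩; cases x <;> simp
  rw [hsplit, measure_union _ ((measurableSet_singleton _).prod (hA _)), Measure.prod_prod,
    Measure.prod_prod, PMF.toMeasure_apply_singleton _ _ (measurableSet_singleton _),
    PMF.toMeasure_apply_singleton _ _ (measurableSet_singleton _)]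
  · simp [PMF.uniformOfFintype_apply, mul_add]
  · rw [Set.disjoint_left]; rintro ⟨x, y⟩ h1 h2
    simp at h1 h2; rw [h1.1] at h2; simp at h2

lemma measurable_readBits (u k : ℕ) : Measurable fun b => readBits b u k := by
  induction k with
  | zero => exact measurable_const
  | succ k ih =>
    have : Measurable fun b : ℕ → Bool => if b k then 1 else 0 :=
      (measurable_of_finite (fun x : Bool => if x then 1 else 0)).comp (measurable_pi_apply k)
    exact (ih.const_mul 2).add this

lemma measurableSet_drop_mem {α : Type*} [Countable α] [MeasurableSpace α]
    [MeasurableSingletonClass α] (k : ℕ) {f : (ℕ → Bool) → α} (hf : Measurable f)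
    {A : α → Set (ℕ → Bool)} (hA : ∀ u, MeasurableSet (A u)) :
    MeasurableSet {b | dropBits k b ∈ A (f b)} := by
  have : {b | dropBits k b ∈ A (f b)} = ⋃ u, f ⁻¹' {u} ∩ dropBits k ⁻¹' A u := by
    ext b; simp
  rw [this]
  exact .iUnion fun u => (hf (measurableSet_singleton u)).inter (measurable_dropBits k (hA u))

/-- A block of `k` fresh bits is uniformly distributed on `{0, …, 2 ^ k - 1}` and independent of
the bits after it. -/
theorem coinMeasure_readBits (k : ℕ) : ∀ (u : ℕ) (A : ℕ → Set (ℕ → Bool)),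
    (∀ x, MeasurableSet (A x)) →
    coinMeasure {b | dropBits k b ∈ A (readBits b u k)} =
      (2⁻¹) ^ k * ∑ x ∈ Finset.range (2 ^ k), coinMeasure (A (u * 2 ^ k + x)) := by
  induction k with
  | zero =>
    intro u A hA
    simp [readBits, show ∀ b, dropBits 0 b = b from fun _ => rfl]
  | succ k ih =>
    intro u A hA
    have h1 : {b | dropBits (k + 1) b ∈ A (readBits b u (k + 1))} =
        {b | dropBits 1 b ∈ (fun x : Bool => {b' | dropBits k b' ∈
          A (readBits b' (2 * u + if x then 1 else 0) k)}) (b 0)} := by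
      ext b
      simp only [Set.mem_ofPred_eq, readBits_succ', dropBits_dropBits, add_comm 1 k]
    rw [h1, coinMeasure_head_tail (fun x : Bool => {b' | dropBits k b' ∈
      A (readBits b' (2 * u + if x then 1 else 0) k)}) (fun x => measurableSet_drop_mem k
      (measurable_readBits _ _) hA), ih _ _ hA, ih _ _ hA, ← mul_add, pow_succ' (2⁻¹ : ℝ≥0∞),
      mul_assoc, pow_succ 2 k, mul_two, Finset.sum_range_add, add_comm (∑ x ∈ _, _)]
    congr 3
    · refine Finset.sum_congr rfl fun x _ => ?_
      congr 2; simp; ring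
    · refine Finset.sum_congr rfl fun x _ => ?_
      congr 2; simp; ring

/-- The event that a run of `n` steps, which starts in the state `θ` and updates it by `F` with a
fresh block of `B` bits, visits only states in `Bad` before its last step and is followed by a
stream of bits in `A`. -/
def badRun {Θ : Type*} (F : Θ → ℕ → Θ) (Bad : Θ → Prop) (B : ℕ) (A : Set (ℕ → Bool)) :
    ℕ → Θ → Set (ℕ → Bool)
  | 0, _ => A
  | n + 1, θ => {b | Bad θ ∧ dropBits B b ∈ badRun F Bad B A n (F θ (readBits b 0 B))}

section
variable {Θ : Type*} {F : Θ → ℕ → Θ} {Bad : Θ → Prop} {B : ℕ} {A : Set (ℕ → Bool)}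

lemma measurableSet_badRun (hA : MeasurableSet A) (n : ℕ) :
    ∀ θ, MeasurableSet (badRun F Bad B A n θ) := by
  induction n with
  | zero => exact fun _ => hA
  | succ n ih =>
    intro θ
    by_cases h : Bad θ
    · simpa [badRun, h] using measurableSet_drop_mem B (measurable_readBits 0 B)
        (A := fun u => badRun F Bad B A n (F θ u)) (fun u => ih _)
    · simp [badRun, h]

lemma coinMeasure_badRun_succ (hA : MeasurableSet A) (n : ℕ) (θ : Θ) (h : Bad θ) :
    coinMeasure (badRun F Bad B A (n + 1) θ) =
      (2⁻¹) ^ B * ∑ u ∈ Finset.range (2 ^ B), coinMeasure (badRun F Bad B A n (F θ u)) := by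
  have := coinMeasure_readBits B 0 (fun u => badRun F Bad B A n (F θ u))
    (fun u => measurableSet_badRun hA n _)
  simpa [badRun, h] using this

lemma coinMeasure_badRun_le (hA : MeasurableSet A) (n : ℕ) :
    ∀ θ, coinMeasure.real (badRun F Bad B A n θ) ≤ coinMeasure.real A := by
  induction n with
  | zero => exact fun _ => le_rfl
  | succ n ih =>
    intro θ
    by_cases h : Bad θ
    · rw [Measure.real, coinMeasure_badRun_succ hA n θ h, ENNReal.toReal_mul, ENNReal.toReal_sum
        (fun _ _ => measure_ne_top _ _)]
      have := Finset.sum_le_card_nsmul (Finset.range (2 ^ B))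
        (fun u => (coinMeasure (badRun F Bad B A n (F θ u))).toReal) _ (fun u _ => ih (F θ u))
      calc _ ≤ ((2⁻¹ : ℝ≥0∞) ^ B).toReal * ((Finset.range (2 ^ B)).card • coinMeasure.real A) := by
            gcongr
        _ = _ := by
            simp only [Finset.card_range, nsmul_eq_mul, ENNReal.toReal_pow, ENNReal.toReal_inv,
              ENNReal.toReal_ofNat, Nat.cast_pow, Nat.cast_ofNat]
            rw [← mul_assoc, ← mul_pow]; norm_num
    · simp [badRun, h]

/-- If every bad state that is reachable by `k` good updates has a proportion at least `β` of good
blocks, and no state is reachable by `T` good updates, then a run visits only bad states with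
probability at most `1 - β ^ n`. -/
theorem coinMeasure_badRun_le_of_good (hA : MeasurableSet A) {β : ℝ} (hβ : 0 ≤ β)
    (hβ1 : β ≤ 1) (Inv : ℕ → Θ → Prop) (T : ℕ) (hT : ∀ θ, ¬ Inv T θ)
    (hgood : ∀ k θ, Inv k θ → Bad θ → ∃ G ⊆ Finset.range (2 ^ B), β * 2 ^ B ≤ G.card ∧
      ∀ u ∈ G, Inv (k + 1) (F θ u)) :
    ∀ n k θ, n + k = T → Inv k θ →
      coinMeasure.real (badRun F Bad B A n θ) ≤ (1 - β ^ n) * coinMeasure.real A := by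
  intro n
  induction n with
  | zero =>
    intro k θ hk h
    rw [zero_add] at hk; subst hk
    exact absurd h (hT θ)
  | succ n ih =>
    intro k θ hk h
    by_cases hb : Bad θ
    swap
    · have : badRun F Bad B A (n + 1) θ = ∅ := by simp [badRun, hb]
      rw [this, measureReal_empty]
      exact mul_nonneg (sub_nonneg.2 (pow_le_one₀ hβ hβ1)) measureReal_nonneg
    obtain ⟨G, hG, hcard, hinv⟩ := hgood k θ h hb
    rw [Measure.real, coinMeasure_badRun_succ hA n θ hb, ENNReal.toReal_mul, ENNReal.toReal_sum
        (fun _ _ => measure_ne_top _ _), ← Finset.sum_sdiff hG]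
    set a := coinMeasure.real A with ha
    have ha0 : 0 ≤ a := measureReal_nonneg
    have h1 := Finset.sum_le_card_nsmul (Finset.range (2 ^ B) \ G)
        (fun u => (coinMeasure (badRun F Bad B A n (F θ u))).toReal) a
        (fun u _ => coinMeasure_badRun_le hA n (F θ u))
    have h2 := Finset.sum_le_card_nsmul G
        (fun u => (coinMeasure (badRun F Bad B A n (F θ u))).toReal) ((1 - β ^ n) * a)
        (fun u hu => ih (k + 1) (F θ u) (by omega) (hinv u hu))
    have h3 : (((Finset.range (2 ^ B) \ G).card : ℕ) : ℝ) = 2 ^ B - G.card := by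
      rw [Finset.card_sdiff_of_subset hG, Nat.cast_sub (Finset.card_le_card hG)]; simp
    rw [nsmul_eq_mul] at h1 h2
    rw [h3] at h1
    have h4 : ((2⁻¹ : ℝ≥0∞) ^ B).toReal = (2 ^ B)⁻¹ := by simp
    rw [h4, inv_mul_le_iff₀ (by positivity)]
    have h5 : β * 2 ^ B * (β ^ n * a) ≤ G.card * (β ^ n * a) := by gcongr
    calc _ ≤ (2 ^ B - (G.card : ℝ)) * a + G.card * ((1 - β ^ n) * a) := add_le_add h1 h2
      _ = 2 ^ B * a - G.card * (β ^ n * a) := by ring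
      _ ≤ 2 ^ B * a - β * 2 ^ B * (β ^ n * a) := by linarith
      _ = _ := by ring

end

/-- The event that `R` consecutive runs of `T` steps from the state `θ₀` visit only bad states. -/
def badRuns {Θ : Type*} (F : Θ → ℕ → Θ) (Bad : Θ → Prop) (B T : ℕ) (θ₀ : Θ) :
    ℕ → Set (ℕ → Bool)
  | 0 => Set.univ
  | R + 1 => badRun F Bad B (badRuns F Bad B T θ₀ R) T θ₀

lemma measurableSet_badRuns {Θ : Type*} {F : Θ → ℕ → Θ} {Bad : Θ → Prop} {B T : ℕ} {θ₀ : Θ}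
    (R : ℕ) : MeasurableSet (badRuns F Bad B T θ₀ R) := by
  induction R with
  | zero => exact .univ
  | succ R ih => exact measurableSet_badRun ih _ _

/-- If the invariant `Inv` can never survive `T` steps, but survives every bad step with probability
at least `β`, then each of the `R` trials meets a parameter that is not bad with probability at
least `β ^ T`. -/
theorem coinMeasure_badRuns_le {Θ : Type*} {F : Θ → ℕ → Θ} {Bad : Θ → Prop} {B T : ℕ} {θ₀ : Θ}
    {β : ℝ} (hβ : 0 ≤ β) (hβ1 : β ≤ 1) (Inv : ℕ → Θ → Prop) (hT : ∀ θ, ¬ Inv T θ) (h0 : Inv 0 θ₀)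
    (hgood : ∀ k θ, Inv k θ → Bad θ → ∃ G ⊆ Finset.range (2 ^ B), β * 2 ^ B ≤ G.card ∧
      ∀ u ∈ G, Inv (k + 1) (F θ u)) (R : ℕ) :
    coinMeasure.real (badRuns F Bad B T θ₀ R) ≤ (1 - β ^ T) ^ R := by
  induction R with
  | zero => simp [badRuns]
  | succ R ih =>
    refine (coinMeasure_badRun_le_of_good (measurableSet_badRuns R) hβ hβ1 Inv T hT hgood T 0 θ₀ rfl
      h0).trans ?_
    rw [pow_succ, mul_comm]
    exact mul_le_mul_of_nonneg_right ih (sub_nonneg.2 (pow_le_one₀ hβ hβ1))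

end MarginLearning

/-! ### Uniform convergence of margin errors -/

namespace MarginLearning

section Finite
variable {X ι : Type*} [MeasurableSpace X] (D : Measure X) [IsProbabilityMeasure D]
  [Finite ι] [Nonempty ι]

lemma abs_ciSup_le_of_finite {f : ι → ℝ} {C : ℝ} (h : ∀ i, |f i| ≤ C) : |⨆ i, f i| ≤ C := by
  obtain ⟨i, hi⟩ := exists_eq_ciSup_of_finite (f := f)
  rw [← hi]; exact h i

omit [Nonempty ι] in
lemma le_ciSup_of_finite (f : ι → ℝ) (i : ι) : f i ≤ ⨆ i, f i :=
  le_ciSup (Set.finite_range f).bddAbove i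

lemma integrable_ciSup {Y : Type*} [MeasurableSpace Y] {μ : Measure Y} [IsFiniteMeasure μ]
    {f : ι → Y → ℝ} (hf : ∀ i, Measurable (f i)) {C : ℝ} (hC : ∀ i y, |f i y| ≤ C) :
    Integrable (fun y => ⨆ i, f i y) μ := by
  have : Countable ι := Finite.to_countable
  refine Integrable.of_bound (C := C) (Measurable.iSup hf).aestronglyMeasurable ?_
  exact .of_forall fun y => abs_ciSup_le_of_finite fun i => hC i y

omit [Finite ι] [Nonempty ι] in
lemma abs_integral_le_one {f : X → ℝ} (h : ∀ x, |f x| ≤ 1) : |∫ x, f x ∂D| ≤ 1 := by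
  have := norm_integral_le_of_norm_le_const (μ := D) (f := f) (C := 1) (.of_forall h)
  simpa using this

variable {ψ a : ι → X → ℝ} {L : ℝ}

/-- Symmetrization and contraction for a single example: in a supremum of loss deviations, the
deviation of one example may be replaced by a random sign times the linear functional. -/
lemma integral_ciSup_deviation_le (hψ : ∀ i, Measurable (ψ i)) (hψ1 : ∀ i x, |ψ i x| ≤ 1)
    (ha : ∀ i, Measurable (a i)) (ha1 : ∀ i x, |a i x| ≤ 1)
    (hL : ∀ i j x, |ψ i x - ψ j x| ≤ L * |a i x - a j x|) (hL0 : 0 ≤ L) (c : ι → ℝ) :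
    ∫ x, ⨆ i, (c i + (∫ y, ψ i y ∂D - ψ i x)) ∂D ≤
      ∫ x, 2⁻¹ * ((⨆ i, (c i + 2 * L * a i x)) + ⨆ i, (c i - 2 * L * a i x)) ∂D := by
  obtain ⟨C, hC⟩ : ∃ C, ∀ i, |c i| ≤ C := ⟨⨆ i, |c i|, le_ciSup_of_finite fun i => |c i|⟩
  have hI : ∀ i, Integrable (ψ i) D := fun i =>
    Integrable.of_bound (C := 1) (hψ i).aestronglyMeasurable (.of_forall (hψ1 i))
  have hint : ∀ i, |∫ y, ψ i y ∂D| ≤ 1 := fun i =>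
    abs_integral_le_one D (hψ1 i)
  have Iup : Integrable (fun x => ⨆ i, (c i + 2 * ψ i x)) D :=
    integrable_ciSup (C := C + 2) (fun i => ((hψ i).const_mul 2).const_add (c i)) fun i x => by
      have := hψ1 i x; have := hC i; rw [abs_le] at *; constructor <;> linarith
  have Idn : Integrable (fun x => ⨆ i, (c i - 2 * ψ i x)) D :=
    integrable_ciSup (C := C + 2) (fun i => ((hψ i).const_mul 2).const_sub (c i)) fun i x => by
      have := hψ1 i x; have := hC i; rw [abs_le] at *; constructor <;> linarith
  have hLa : ∀ i x, |2 * L * a i x| ≤ 2 * L := fun i x => by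
    rw [abs_mul, abs_of_nonneg (by positivity : 0 ≤ 2 * L)]
    exact mul_le_of_le_one_right (by positivity) (ha1 i x)
  have Jup : Integrable (fun x => ⨆ i, (c i + 2 * L * a i x)) D :=
    integrable_ciSup (C := C + 2 * L) (fun i => ((ha i).const_mul (2 * L)).const_add (c i))
      fun i x => by
        have := hLa i x; have := hC i; rw [abs_le] at *; constructor <;> linarith
  have Jdn : Integrable (fun x => ⨆ i, (c i - 2 * L * a i x)) D :=
    integrable_ciSup (C := C + 2 * L) (fun i => ((ha i).const_mul (2 * L)).const_sub (c i))
      fun i x => by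
        have := hLa i x; have := hC i; rw [abs_le] at *; constructor <;> linarith
  have step1 : ∀ x, (⨆ i, (c i + (∫ y, ψ i y ∂D - ψ i x))) ≤
      2⁻¹ * (∫ y, ⨆ i, (c i + 2 * ψ i y) ∂D) + 2⁻¹ * ⨆ i, (c i - 2 * ψ i x) := by
    intro x
    refine ciSup_le fun i => ?_
    have h1 : c i + 2 * ∫ y, ψ i y ∂D ≤ ∫ y, ⨆ i, (c i + 2 * ψ i y) ∂D := by
      have : c i + 2 * ∫ y, ψ i y ∂D = ∫ y, (c i + 2 * ψ i y) ∂D := by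
        rw [integral_add (integrable_const _) ((hI i).const_mul 2), integral_const_mul]; simp
      rw [this]
      exact integral_mono ((integrable_const _).add ((hI i).const_mul 2)) Iup
        fun y => le_ciSup_of_finite (fun i => c i + 2 * ψ i y) i
    have h2 := le_ciSup_of_finite (fun i => c i - 2 * ψ i x) i
    beta_reduce at h2
    linarith
  have I0 : Integrable (fun x => ⨆ i, (c i + (∫ y, ψ i y ∂D - ψ i x))) D :=
    integrable_ciSup (C := C + 2) (fun i => ((hψ i).const_sub _).const_add (c i)) fun i x => by
      have := hψ1 i x; have := hC i; have := hint i; rw [abs_le] at *; constructor <;> linarith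
  calc _ ≤ ∫ x, (2⁻¹ * (∫ y, ⨆ i, (c i + 2 * ψ i y) ∂D) + 2⁻¹ * ⨆ i, (c i - 2 * ψ i x)) ∂D :=
        integral_mono I0 ((integrable_const _).add (Idn.const_mul _)) step1
    _ = ∫ x, 2⁻¹ * ((⨆ i, (c i + 2 * ψ i x)) + ⨆ i, (c i - 2 * ψ i x)) ∂D := by
        have e : ∫ x, 2⁻¹ * ((⨆ i, (c i + 2 * ψ i x)) + ⨆ i, (c i - 2 * ψ i x)) ∂D =
            2⁻¹ * (∫ x, (⨆ i, (c i + 2 * ψ i x)) ∂D + ∫ x, (⨆ i, (c i - 2 * ψ i x)) ∂D) := by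
          rw [integral_const_mul, integral_add Iup Idn]
        rw [e, integral_add (integrable_const _) (Idn.const_mul _),
          integral_const_mul _ (fun x => ⨆ i, (c i - 2 * ψ i x)), integral_const, probReal_univ,
          one_smul, mul_add]
    _ ≤ _ := by
        refine integral_mono ((Iup.add Idn).const_mul _) ((Jup.add Jdn).const_mul _) fun x => ?_
        refine mul_le_mul_of_nonneg_left ?_ (by norm_num)
        obtain ⟨i, hi⟩ := exists_eq_ciSup_of_finite (f := fun i => c i + 2 * ψ i x)
        obtain ⟨j, hj⟩ := exists_eq_ciSup_of_finite (f := fun i => c i - 2 * ψ i x)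
        rw [← hi, ← hj]
        have h := (abs_le.1 (hL i j x)).2
        have u1 := le_ciSup_of_finite (fun i => c i + 2 * L * a i x)
        have u2 := le_ciSup_of_finite (fun i => c i - 2 * L * a i x)
        -- the maximizers `i`, `j` are assigned to the two signs according to the order of `a`
        rcases le_total (a j x) (a i x) with hij | hij
        · rw [abs_of_nonneg (sub_nonneg.2 hij)] at h
          have := u1 i; have := u2 j; beta_reduce at *; nlinarith
        · rw [abs_of_nonpos (sub_nonpos.2 hij)] at h
          have := u1 j; have := u2 i; beta_reduce at *; nlinarith

variable {d : ℕ} {v : X → Fin d → ℝ} {w : ι → Fin d → ℝ}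

/-- The expected largest total deviation over a finite family of halfspaces, bounded by a potential
function that increases by at most `κ` on average when a random signed example is added. -/
lemma integral_ciSup_sum_deviation_le (hv : Measurable v)
    (hψ : ∀ i, Measurable (ψ i)) (hψ1 : ∀ i x, |ψ i x| ≤ 1) (hw1 : ∀ i x, |w i ⬝ᵥ v x| ≤ 1)
    (hL : ∀ i j x, |ψ i x - ψ j x| ≤ L * |w i ⬝ᵥ v x - w j ⬝ᵥ v x|) (hL0 : 0 ≤ L)
    {g : (Fin d → ℝ) → ℝ} {κ : ℝ} (hg : ∀ i θ, w i ⬝ᵥ θ ≤ g θ)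
    (hκ : ∀ θ x, 2⁻¹ * (g (θ + v x) + g (θ - v x)) ≤ g θ + κ) (m : ℕ) : ∀ θ : Fin d → ℝ,
    ∫ S, ⨆ i, (2 * L * (w i ⬝ᵥ θ) + ∑ k ∈ Finset.range m, (∫ y, ψ i y ∂D - ψ i (S k)))
      ∂(Measure.infinitePi fun _ : ℕ => D) ≤ 2 * L * (g θ + m * κ) := by
  have hwm : ∀ i, Measurable fun x => w i ⬝ᵥ v x := fun i => by
    unfold dotProduct
    exact Finset.measurable_sum _ fun j _ => ((measurable_pi_apply j).comp hv).const_mul _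
  have hint : ∀ i, |∫ y, ψ i y ∂D| ≤ 1 := fun i =>
    abs_integral_le_one D (hψ1 i)
  induction m with
  | zero =>
    intro θ
    simp only [Finset.range_zero, Finset.sum_empty, add_zero, Nat.cast_zero, zero_mul,
      integral_const, probReal_univ, one_smul]
    exact ciSup_le fun i => mul_le_mul_of_nonneg_left (hg i θ) (by positivity)
  | succ m ih =>
    intro θ
    set π := Measure.infinitePi fun _ : ℕ => D with hπ
    have hsum : ∀ i (S : ℕ → X), |∑ k ∈ Finset.range m, (∫ y, ψ i y ∂D - ψ i (S k))| ≤ m * 2 :=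
      fun i S => by
        refine (Finset.abs_sum_le_sum_abs _ _).trans ?_
        refine (Finset.sum_le_card_nsmul _ _ 2 fun k _ => ?_).trans (by simp)
        have := hint i; have := hψ1 i (S k); rw [abs_le] at *; constructor <;> linarith
    have hsm : ∀ i, Measurable fun S : ℕ → X =>
        ∑ k ∈ Finset.range m, (∫ y, ψ i y ∂D - ψ i (S k)) := fun i =>
      Finset.measurable_sum _ fun k _ => ((hψ i).comp (measurable_pi_apply k)).const_sub _
    obtain ⟨C, hC⟩ : ∃ C, ∀ i, |2 * L * (w i ⬝ᵥ θ)| ≤ C :=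
      ⟨⨆ i, |2 * L * (w i ⬝ᵥ θ)|, le_ciSup_of_finite fun i => |2 * L * (w i ⬝ᵥ θ)|⟩
    have hLa : ∀ i x, |2 * L * (w i ⬝ᵥ v x)| ≤ 2 * L := fun i x => by
      rw [abs_mul, abs_of_nonneg (by positivity : 0 ≤ 2 * L)]
      exact mul_le_of_le_one_right (by positivity) (hw1 i x)
    let F : X × (ℕ → X) → ℝ := fun q => ⨆ i, (2 * L * (w i ⬝ᵥ θ) +
      ∑ k ∈ Finset.range m, (∫ y, ψ i y ∂D - ψ i (q.2 k)) + (∫ y, ψ i y ∂D - ψ i q.1))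
    let Gp : X × (ℕ → X) → ℝ := fun q => ⨆ i, (2 * L * (w i ⬝ᵥ θ) +
      ∑ k ∈ Finset.range m, (∫ y, ψ i y ∂D - ψ i (q.2 k)) + 2 * L * (w i ⬝ᵥ v q.1))
    let Gm : X × (ℕ → X) → ℝ := fun q => ⨆ i, (2 * L * (w i ⬝ᵥ θ) +
      ∑ k ∈ Finset.range m, (∫ y, ψ i y ∂D - ψ i (q.2 k)) - 2 * L * (w i ⬝ᵥ v q.1))
    have hF : Integrable F (D.prod π) := integrable_ciSup (C := C + m * 2 + 2)
      (fun i => (((hsm i).comp measurable_snd).const_add _).add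
        (((hψ i).comp measurable_fst).const_sub _)) fun i q => by
        have := hC i; have := hsum i q.2; have := hint i; have := hψ1 i q.1
        rw [abs_le] at *; constructor <;> linarith
    have hGp : Integrable Gp (D.prod π) := integrable_ciSup (C := C + m * 2 + 2 * L)
      (fun i => (((hsm i).comp measurable_snd).const_add _).add
        (((hwm i).comp measurable_fst).const_mul _)) fun i q => by
        have := hC i; have := hsum i q.2; have := hLa i q.1
        rw [abs_le] at *; constructor <;> linarith
    have hGm : Integrable Gm (D.prod π) := integrable_ciSup (C := C + m * 2 + 2 * L)
      (fun i => (((hsm i).comp measurable_snd).const_add _).sub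
        (((hwm i).comp measurable_fst).const_mul _)) fun i q => by
        have := hC i; have := hsum i q.2; have := hLa i q.1
        rw [abs_le] at *; constructor <;> linarith
    have hG : Integrable (fun q => 2⁻¹ * (Gp q + Gm q)) (D.prod π) := (hGp.add hGm).const_mul _
    have hpres := measurePreserving_head_tail D
    have e1 : ∫ S, ⨆ i, (2 * L * (w i ⬝ᵥ θ) +
        ∑ k ∈ Finset.range (m + 1), (∫ y, ψ i y ∂D - ψ i (S k))) ∂π = ∫ q, F q ∂(D.prod π) := by
      rw [hπ, ← hpres.map_eq, integral_map hpres.measurable.aemeasurable]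
      · refine integral_congr_ae (.of_forall fun S => ?_)
        simp only [F, Finset.sum_range_succ', add_assoc]
      · rw [hpres.map_eq]; exact hF.aestronglyMeasurable
    have e2 : ∫ q, F q ∂(D.prod π) ≤ ∫ q, 2⁻¹ * (Gp q + Gm q) ∂(D.prod π) := by
      rw [integral_prod_symm _ hF, integral_prod_symm _ hG]
      refine integral_mono hF.integral_prod_right hG.integral_prod_right
        fun S => ?_
      exact integral_ciSup_deviation_le D hψ hψ1 hwm hw1 hL hL0 (fun i => 2 * L * (w i ⬝ᵥ θ) +
        ∑ k ∈ Finset.range m, (∫ y, ψ i y ∂D - ψ i (S k)))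
    rw [e1]
    refine e2.trans ?_
    rw [integral_prod _ hG]
    have e3 : ∀ᵐ x ∂D, ∫ S, 2⁻¹ * (Gp (x, S) + Gm (x, S)) ∂π ≤ 2 * L * (g θ + (m + 1) * κ) := by
      filter_upwards [hGp.prod_right_ae, hGm.prod_right_ae] with x hx1 hx2
      rw [integral_const_mul, integral_add hx1 hx2]
      have f1 := ih (θ + v x)
      have f2 := ih (θ - v x)
      have g1 : ∫ S, Gp (x, S) ∂π = ∫ S, ⨆ i, (2 * L * (w i ⬝ᵥ (θ + v x)) +
          ∑ k ∈ Finset.range m, (∫ y, ψ i y ∂D - ψ i (S k))) ∂π := by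
        refine integral_congr_ae (.of_forall fun S => ?_)
        simp only [Gp, dotProduct_add]; congr 1; funext i; ring
      have g2 : ∫ S, Gm (x, S) ∂π = ∫ S, ⨆ i, (2 * L * (w i ⬝ᵥ (θ - v x)) +
          ∑ k ∈ Finset.range m, (∫ y, ψ i y ∂D - ψ i (S k))) ∂π := by
        refine integral_congr_ae (.of_forall fun S => ?_)
        simp only [Gm, dotProduct_sub]; congr 1; funext i; ring
      rw [g1, g2]
      have := mul_le_mul_of_nonneg_left (hκ θ x) (by positivity : 0 ≤ 2 * L)
      linarith
    calc _ ≤ ∫ _ : X, 2 * L * (g θ + (m + 1) * κ) ∂D :=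
          integral_mono_ae hG.integral_prod_left (integrable_const _) e3
      _ = _ := by simp

/-- Markov's inequality for the largest deviation over a finite family that contains a halfspace
with constant loss, so that the largest deviation is nonnegative. -/
lemma measure_exists_deviation_le (hv : Measurable v)
    (hψ : ∀ i, Measurable (ψ i)) (hψ1 : ∀ i x, |ψ i x| ≤ 1) (hw1 : ∀ i x, |w i ⬝ᵥ v x| ≤ 1)
    (hL : ∀ i j x, |ψ i x - ψ j x| ≤ L * |w i ⬝ᵥ v x - w j ⬝ᵥ v x|) (hL0 : 0 ≤ L)
    {g : (Fin d → ℝ) → ℝ} {κ : ℝ} (hg : ∀ i θ, w i ⬝ᵥ θ ≤ g θ)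
    (hκ : ∀ θ x, 2⁻¹ * (g (θ + v x) + g (θ - v x)) ≤ g θ + κ)
    (i₀ : ι) {c₀ : ℝ} (hi₀ : ∀ x, ψ i₀ x = c₀) (m : ℕ) {η : ℝ} (hη : 0 < η) :
    (Measure.infinitePi fun _ : ℕ => D).real
      {S | ∃ i, η ≤ ∑ k ∈ Finset.range m, (∫ y, ψ i y ∂D - ψ i (S k))} ≤
      2 * L * (g 0 + m * κ) / η := by
  set π := Measure.infinitePi fun _ : ℕ => D with hπ
  have h1 := integral_ciSup_sum_deviation_le D hv hψ hψ1 hw1 hL hL0 hg hκ m 0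
  simp only [dotProduct_zero, mul_zero, zero_add] at h1
  have hint : ∀ i, |∫ y, ψ i y ∂D| ≤ 1 := fun i =>
    abs_integral_le_one D (hψ1 i)
  have hsum : ∀ i (S : ℕ → X), |∑ k ∈ Finset.range m, (∫ y, ψ i y ∂D - ψ i (S k))| ≤ m * 2 :=
    fun i S => by
      refine (Finset.abs_sum_le_sum_abs _ _).trans ?_
      refine (Finset.sum_le_card_nsmul _ _ 2 fun k _ => ?_).trans (by simp)
      have := hint i; have := hψ1 i (S k); rw [abs_le] at *; constructor <;> linarith
  have hsm : ∀ i, Measurable fun S : ℕ → X =>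
      ∑ k ∈ Finset.range m, (∫ y, ψ i y ∂D - ψ i (S k)) := fun i =>
    Finset.measurable_sum _ fun k _ => ((hψ i).comp (measurable_pi_apply k)).const_sub _
  have hI := integrable_ciSup (μ := π) hsm hsum
  have hnn : 0 ≤ᵐ[π] fun S => ⨆ i, ∑ k ∈ Finset.range m, (∫ y, ψ i y ∂D - ψ i (S k)) :=
    .of_forall fun S => by
      have := le_ciSup_of_finite
        (fun i => ∑ k ∈ Finset.range m, (∫ y, ψ i y ∂D - ψ i (S k))) i₀
      simpa [hi₀] using this
  have hM := mul_meas_ge_le_integral_of_nonneg hnn hI η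
  have hset : {S : ℕ → X | ∃ i, η ≤ ∑ k ∈ Finset.range m, (∫ y, ψ i y ∂D - ψ i (S k))} =
      {S | η ≤ ⨆ i, ∑ k ∈ Finset.range m, (∫ y, ψ i y ∂D - ψ i (S k))} := by
    ext S
    constructor
    · rintro ⟨i, hi⟩
      exact hi.trans (le_ciSup_of_finite
        (fun i => ∑ k ∈ Finset.range m, (∫ y, ψ i y ∂D - ψ i (S k))) i)
    · intro h
      obtain ⟨i, hi⟩ := exists_eq_ciSup_of_finite
        (f := fun i => ∑ k ∈ Finset.range m, (∫ y, ψ i y ∂D - ψ i (S k)))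
      exact ⟨i, hi ▸ h⟩
  rw [hset, le_div_iff₀ hη, mul_comm]
  exact hM.trans h1

end Finite

/-- The piecewise linear function that is `1` up to `s₁` and `0` from `s₂` on. -/
noncomputable def ramp (s₁ s₂ t : ℝ) : ℝ := max 0 (min 1 ((s₂ - t) / (s₂ - s₁)))

lemma ramp_nonneg (s₁ s₂ t : ℝ) : 0 ≤ ramp s₁ s₂ t := le_max_left _ _

lemma ramp_le_one (s₁ s₂ t : ℝ) : ramp s₁ s₂ t ≤ 1 := max_le zero_le_one (min_le_left _ _)

lemma abs_ramp_le_one (s₁ s₂ t : ℝ) : |ramp s₁ s₂ t| ≤ 1 := by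
  rw [abs_of_nonneg (ramp_nonneg _ _ _)]; exact ramp_le_one _ _ _

lemma ramp_of_le {s₁ s₂ t : ℝ} (h : s₁ < s₂) (ht : t ≤ s₁) : ramp s₁ s₂ t = 1 := by
  have : 1 ≤ (s₂ - t) / (s₂ - s₁) := by rw [le_div_iff₀ (by linarith)]; linarith
  simp [ramp, this]

lemma ramp_of_ge {s₁ s₂ t : ℝ} (h : s₁ < s₂) (ht : s₂ ≤ t) : ramp s₁ s₂ t = 0 := by
  have : (s₂ - t) / (s₂ - s₁) ≤ 0 := div_nonpos_of_nonpos_of_nonneg (by linarith) (by linarith)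
  rw [ramp, max_eq_left]
  exact (min_le_right _ _).trans this

lemma continuous_ramp (s₁ s₂ : ℝ) : Continuous (ramp s₁ s₂) := by
  unfold ramp; fun_prop

lemma abs_ramp_sub_le {s₁ s₂ : ℝ} (h : s₁ < s₂) (t u : ℝ) :
    |ramp s₁ s₂ t - ramp s₁ s₂ u| ≤ (s₂ - s₁)⁻¹ * |t - u| := by
  have h1 := abs_max_sub_max_le_abs (min 1 ((s₂ - t) / (s₂ - s₁))) (min 1 ((s₂ - u) / (s₂ - s₁))) 0
  have h2 := abs_min_sub_min_le_max 1 ((s₂ - t) / (s₂ - s₁)) 1 ((s₂ - u) / (s₂ - s₁))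
  simp only [sub_self, abs_zero, abs_nonneg, sup_of_le_right] at h2
  have h3 : (s₂ - t) / (s₂ - s₁) - (s₂ - u) / (s₂ - s₁) = -((s₂ - s₁)⁻¹ * (t - u)) := by
    rw [← sub_div]; rw [div_eq_inv_mul]; ring
  rw [h3, abs_neg, abs_mul, abs_of_pos (inv_pos.2 (sub_pos.2 h))] at h2
  unfold ramp
  rw [max_comm 0, max_comm 0]
  exact h1.trans h2

section Uniform
variable {X : Type*} [MeasurableSpace X] (D : Measure X) [IsProbabilityMeasure D]
  {d : ℕ} {v : X → Fin d → ℝ}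

/-- Uniform convergence with a gap between the margins: simultaneously for all halfspaces of a
class, the probability of a margin at most `s₁` hardly exceeds the observed frequency of margins
below `s₂`. -/
theorem measure_exists_margin_error_le (hv : Measurable v) {W : Set (Fin d → ℝ)} (h0 : 0 ∈ W)
    (hw1 : ∀ w ∈ W, ∀ x, |w ⬝ᵥ v x| ≤ 1) {s₁ s₂ : ℝ} (hs : s₁ < s₂)
    {g : (Fin d → ℝ) → ℝ} {κ : ℝ} (hg : ∀ w ∈ W, ∀ θ, w ⬝ᵥ θ ≤ g θ)
    (hκ : ∀ θ x, 2⁻¹ * (g (θ + v x) + g (θ - v x)) ≤ g θ + κ)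
    {m : ℕ} (hm : 0 < m) {η : ℝ} (hη : 0 < η) :
    (Measure.infinitePi fun _ : ℕ => D)
      {S | ∃ w ∈ W, (∑ k ∈ Finset.range m, if w ⬝ᵥ v (S k) < s₂ then (1 : ℝ) else 0) / m + η <
        D.real {x | w ⬝ᵥ v x ≤ s₁}} ≤
      ENNReal.ofReal (2 * (s₂ - s₁)⁻¹ * (g 0 + m * κ) / (m * η)) := by
  set π := Measure.infinitePi fun _ : ℕ => D with hπ
  have hm' : (0 : ℝ) < m := Nat.cast_pos.2 hm
  have hdot : Continuous fun q : (Fin d → ℝ) × (Fin d → ℝ) => q.1 ⬝ᵥ q.2 := by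
    unfold dotProduct; fun_prop
  have hψm : ∀ w : Fin d → ℝ, Measurable fun x => ramp s₁ s₂ (w ⬝ᵥ v x) := fun w =>
    (continuous_ramp s₁ s₂).measurable.comp
      ((hdot.comp (continuous_const.prodMk continuous_id)).measurable.comp hv)
  set Δ : (Fin d → ℝ) → (ℕ → X) → ℝ := fun w S => ∑ k ∈ Finset.range m,
    (∫ y, ramp s₁ s₂ (w ⬝ᵥ v y) ∂D - ramp s₁ s₂ (w ⬝ᵥ v (S k))) with hΔ
  have hcont : ∀ S, Continuous fun w => Δ w S := by
    intro S
    refine continuous_finsetSum _ fun k _ => Continuous.sub ?_ ?_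
    · refine continuous_of_dominated (bound := fun _ => 1)
        (fun w => (hψm w).aestronglyMeasurable)
        (fun w => .of_forall fun x => abs_ramp_le_one _ _ _) (integrable_const _)
        (.of_forall fun x => ?_)
      exact (continuous_ramp s₁ s₂).comp (hdot.comp (continuous_id.prodMk continuous_const))
    · exact (continuous_ramp s₁ s₂).comp (hdot.comp (continuous_id.prodMk continuous_const))
  have : Nonempty W := ⟨⟨0, h0⟩⟩
  let u : ℕ → W := TopologicalSpace.denseSeq W
  have hsub : {S : ℕ → X | ∃ w ∈ W,
      (∑ k ∈ Finset.range m, if w ⬝ᵥ v (S k) < s₂ then (1 : ℝ) else 0) / m + η <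
        D.real {x | w ⬝ᵥ v x ≤ s₁}} ⊆ ⋃ N : ℕ, {S | ∃ n, n < N ∧ m * η ≤ Δ (u n) S} := by
    rintro S ⟨w, hw, hlt⟩
    have h1 : D.real {x | w ⬝ᵥ v x ≤ s₁} ≤ ∫ y, ramp s₁ s₂ (w ⬝ᵥ v y) ∂D := by
      have hms : MeasurableSet {x | w ⬝ᵥ v x ≤ s₁} := measurableSet_le
        ((hdot.comp (continuous_const.prodMk continuous_id)).measurable.comp hv) measurable_const
      rw [← integral_indicator_one hms]
      refine integral_mono ((integrable_const (1 : ℝ)).indicator hms)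
        (Integrable.of_bound (C := 1) (hψm w).aestronglyMeasurable
          (.of_forall fun x => abs_ramp_le_one _ _ _)) fun x => ?_
      by_cases hx : w ⬝ᵥ v x ≤ s₁
      · simp [hx, ramp_of_le hs hx]
      · simp [hx, ramp_nonneg]
    have h2 : ∑ k ∈ Finset.range m, ramp s₁ s₂ (w ⬝ᵥ v (S k)) ≤
        ∑ k ∈ Finset.range m, if w ⬝ᵥ v (S k) < s₂ then (1 : ℝ) else 0 := by
      refine Finset.sum_le_sum fun k _ => ?_
      split
      · exact ramp_le_one _ _ _
      · rw [ramp_of_ge hs (by linarith)]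
    have h3 : m * η < Δ w S := by
      simp only [hΔ, Finset.sum_sub_distrib, Finset.sum_const, Finset.card_range, nsmul_eq_mul]
      have := (hlt.trans_le h1)
      rw [← lt_sub_iff_add_lt, div_lt_iff₀ hm', sub_mul, mul_comm _ (m : ℝ), mul_comm η] at this
      linarith
    have hopen : IsOpen {w : W | m * η < Δ w S} :=
      isOpen_lt continuous_const ((hcont S).comp continuous_subtype_val)
    obtain ⟨_, hn, n, rfl⟩ := (TopologicalSpace.denseRange_denseSeq W).inter_open_nonempty _ hopen
      ⟨⟨w, hw⟩, h3⟩
    exact Set.mem_iUnion.2 ⟨n + 1, n, Nat.lt_succ_self n, le_of_lt hn⟩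
  refine (measure_mono hsub).trans ?_
  have hmono : Monotone fun N : ℕ => {S : ℕ → X | ∃ n, n < N ∧ m * η ≤ Δ (u n) S} :=
    fun N M hNM S ⟨n, hn, h⟩ => ⟨n, hn.trans_le hNM, h⟩
  rw [hmono.measure_iUnion]
  refine iSup_le fun N => ?_
  let w : Option (Fin N) → Fin d → ℝ := fun i => i.elim 0 fun n => u n
  have hwW : ∀ i, w i ∈ W := by
    rintro (_ | n)
    · exact h0
    · exact (u n).2
  have hmain := measure_exists_deviation_le D (ψ := fun i x => ramp s₁ s₂ (w i ⬝ᵥ v x)) (w := w) hv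
    (fun i => hψm _) (fun i x => abs_ramp_le_one _ _ _) (fun i x => hw1 _ (hwW i) x)
    (fun i j x => abs_ramp_sub_le hs _ _) (inv_nonneg.2 (sub_nonneg.2 hs.le))
    (fun i θ => hg _ (hwW i) θ) hκ none (c₀ := ramp s₁ s₂ 0) (fun x => by simp [w]) m
    (mul_pos hm' hη)
  refine (measure_mono fun S hS => ?_).trans
    ((ENNReal.le_ofReal_iff_toReal_le (measure_ne_top _ _) ?_).2 hmain)
  · obtain ⟨n, hn, h⟩ := hS
    exact ⟨some ⟨n, hn⟩, h⟩
  · exact le_trans measureReal_nonneg hmain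

/-- Chebyshev's inequality for the observed frequency of an event. -/
theorem measure_frequency_le {A : Set X} [DecidablePred (· ∈ A)] (hA : MeasurableSet A) {m : ℕ}
    (hm : 0 < m) {η : ℝ} (hη : 0 < η) :
    (Measure.infinitePi fun _ : ℕ => D)
      {S | D.real A + η ≤ (∑ k ∈ Finset.range m, if S k ∈ A then (1 : ℝ) else 0) / m} ≤
      ENNReal.ofReal (1 / (m * η ^ 2)) := by
  set π := Measure.infinitePi fun _ : ℕ => D with hπ
  have hm' : (0 : ℝ) < m := Nat.cast_pos.2 hm
  set f : X → ℝ := fun x => if x ∈ A then 1 else 0 with hf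
  have hfm : Measurable f := Measurable.ite hA measurable_const measurable_const
  have hfi : ∫ x, f x ∂D = D.real A := by
    rw [← integral_indicator_one hA]; congr 1; funext x; simp [hf, Set.indicator_apply]
  set Y : ℕ → (ℕ → X) → ℝ := fun k S => f (S k) with hY
  have hind : ProbabilityTheory.iIndepFun Y π :=
    ProbabilityTheory.iIndepFun_infinitePi (P := fun _ : ℕ => D) (X := fun _ => f) fun _ => hfm
  have hYm : ∀ k, Measurable (Y k) := fun k => hfm.comp (measurable_pi_apply k)
  have hYb : ∀ k S, Y k S ∈ Set.Icc (0 : ℝ) 1 := fun k S => by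
    simp only [hY, hf]; split <;> simp
  have hL2 : ∀ k, MemLp (Y k) 2 π := fun k =>
    MemLp.of_bound (hYm k).aestronglyMeasurable 1 (.of_forall fun S => by
      have := hYb k S; rw [Real.norm_eq_abs, abs_of_nonneg this.1]; exact this.2)
  have hE : ∀ k, ∫ S, Y k S ∂π = D.real A := fun k => by
    rw [← hfi]
    have := measurePreserving_eval_infinitePi (fun _ : ℕ => D) k
    rw [← this.map_eq, integral_map this.measurable.aemeasurable hfm.aestronglyMeasurable]
  have hvar : ∀ k, ProbabilityTheory.variance (Y k) π ≤ 1 := fun k => by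
    have := ProbabilityTheory.variance_le_sq_of_bounded (.of_forall (hYb k))
      (hYm k).aemeasurable (μ := π)
    refine this.trans (by norm_num)
  have hsumvar : ProbabilityTheory.variance (∑ k ∈ Finset.range m, Y k) π ≤ m := by
    rw [ProbabilityTheory.IndepFun.variance_sum (fun k _ => hL2 k)
      (fun i _ j _ hij => hind.indepFun hij)]
    exact (Finset.sum_le_card_nsmul _ _ 1 fun k _ => hvar k).trans (by simp)
  have hsL2 : MemLp (∑ k ∈ Finset.range m, Y k) 2 π := memLp_finsetSum' _ fun k _ => hL2 k
  have hmean : ∫ S, (∑ k ∈ Finset.range m, Y k) S ∂π = m * D.real A := by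
    simp only [Finset.sum_apply]
    rw [integral_finsetSum _ fun k _ => (hL2 k).integrable (by norm_num)]
    simp [hE]
  have hch := ProbabilityTheory.meas_ge_le_variance_div_sq hsL2 (mul_pos hm' hη)
  refine (measure_mono fun S hS => ?_).trans (hch.trans (ENNReal.ofReal_le_ofReal ?_))
  · have hS' : D.real A + η ≤ (∑ k ∈ Finset.range m, Y k S) / m := hS
    rw [le_div_iff₀ hm'] at hS'
    change m * η ≤ |(∑ k ∈ Finset.range m, Y k) S - ∫ S, (∑ k ∈ Finset.range m, Y k) S ∂π|
    rw [hmean, Finset.sum_apply]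
    refine le_trans ?_ (le_abs_self _)
    linarith
  · calc _ ≤ (m : ℝ) / (m * η) ^ 2 := by gcongr
      _ = _ := by field_simp

end Uniform
end MarginLearning

/-! ### Potential functions: finite exponents -/

namespace MarginLearning

/-- Up to a factor, the derivative of `|·| ^ p`. -/
noncomputable def signedPow (p t : ℝ) : ℝ := |t| ^ (p - 2) * t

lemma abs_signedPow {p : ℝ} (hp : 2 ≤ p) (t : ℝ) : |signedPow p t| = |t| ^ (p - 1) := by
  rw [signedPow, abs_mul, abs_of_nonneg (Real.rpow_nonneg (abs_nonneg t) _)]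
  rcases eq_or_ne t 0 with rfl | h
  · rw [abs_zero, mul_zero, Real.zero_rpow (by linarith)]
  · rw [show p - 1 = p - 2 + 1 by ring, Real.rpow_add_one (abs_ne_zero.2 h)]

lemma signedPow_mul_self {p : ℝ} (hp : 2 ≤ p) (t : ℝ) : signedPow p t * t = |t| ^ p := by
  rw [signedPow, mul_assoc, ← abs_mul_abs_self t]
  rcases eq_or_ne t 0 with rfl | h
  · rw [abs_zero, mul_zero, mul_zero, Real.zero_rpow (by linarith)]
  · rw [← mul_assoc, ← Real.rpow_add_one (abs_ne_zero.2 h), ← Real.rpow_add_one (abs_ne_zero.2 h)]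
    congr 1; ring

lemma rpow_sub_rpow_le {r s t : ℝ} (hr : 1 ≤ r) (hs : 0 ≤ s) (hst : s ≤ t) :
    t ^ r - s ^ r ≤ r * t ^ (r - 1) * (t - s) := by
  rcases eq_or_lt_of_le (hs.trans hst) with h | ht
  · subst h
    have : s = 0 := le_antisymm hst hs
    subst this; simp
  have h1 := one_add_mul_self_le_rpow_one_add (s := (s - t) / t) (by
    rw [le_div_iff₀ ht]; linarith) hr
  rw [show 1 + (s - t) / t = s / t by field_simp; ring, Real.div_rpow hs ht.le,
    le_div_iff₀ (Real.rpow_pos_of_pos ht _)] at h1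
  have h2 : t ^ r = t ^ (r - 1) * t := by
    rw [← Real.rpow_add_one ht.ne']; congr 1; ring
  have h3 : (1 + r * ((s - t) / t)) * t ^ r = t ^ r - r * t ^ (r - 1) * (t - s) := by
    rw [add_mul, one_mul]
    conv_lhs => rw [h2]
    rw [h2]
    field_simp; ring
  linarith

/-- The slopes of `signedPow p` on `[-M, M]` are at most `(p - 1) M ^ (p - 2)`. -/
lemma signedPow_sub_mul_le {p M s t : ℝ} (hp : 2 ≤ p) (hs : |s| ≤ M) (ht : |t| ≤ M) :
    (signedPow p t - signedPow p s) * (t - s) ≤ (p - 1) * M ^ (p - 2) * (t - s) ^ 2 := by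
  have hM : 0 ≤ M := (abs_nonneg s).trans hs
  have nonneg : ∀ {u}, 0 ≤ u → signedPow p u = u ^ (p - 1) := fun {u} hu => by
    have h0 : 0 ≤ signedPow p u := mul_nonneg (Real.rpow_nonneg (abs_nonneg u) _) hu
    rw [← abs_of_nonneg h0, abs_signedPow hp, abs_of_nonneg hu]
  have neg : ∀ u, signedPow p (-u) = - signedPow p u := fun u => by simp [signedPow]
  have same : ∀ {u v : ℝ}, 0 ≤ u → u ≤ v → v ≤ M →
      (v ^ (p - 1) - u ^ (p - 1)) * (v - u) ≤ (p - 1) * M ^ (p - 2) * (v - u) ^ 2 := by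
    intro u v hu huv hv
    have h1 := rpow_sub_rpow_le (r := p - 1) (by linarith) hu huv
    rw [show p - 1 - 1 = p - 2 by ring] at h1
    have h2 : v ^ (p - 2) ≤ M ^ (p - 2) := Real.rpow_le_rpow (hu.trans huv) hv (by linarith)
    have h3 : 0 ≤ v - u := sub_nonneg.2 huv
    calc _ ≤ ((p - 1) * v ^ (p - 2) * (v - u)) * (v - u) := by gcongr
      _ ≤ ((p - 1) * M ^ (p - 2) * (v - u)) * (v - u) := by
          have : 0 ≤ p - 1 := by linarith
          gcongr
      _ = _ := by ring
  have opp : ∀ {u v : ℝ}, 0 ≤ u → u ≤ M → 0 ≤ v → v ≤ M →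
      (v ^ (p - 1) + u ^ (p - 1)) * (v + u) ≤ (p - 1) * M ^ (p - 2) * (v + u) ^ 2 := by
    intro u v hu huM hv hvM
    have h1 : ∀ {z : ℝ}, 0 ≤ z → z ≤ M → z ^ (p - 1) ≤ M ^ (p - 2) * z := fun {z} hz hzM => by
      rcases eq_or_lt_of_le hz with rfl | hz
      · rw [Real.zero_rpow (by linarith)]; simp
      · rw [show p - 1 = p - 2 + 1 by ring, Real.rpow_add_one hz.ne']
        gcongr
    have h2 : (0 : ℝ) ≤ M ^ (p - 2) := Real.rpow_nonneg hM _
    calc _ ≤ (M ^ (p - 2) * v + M ^ (p - 2) * u) * (v + u) := by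
          gcongr
          · exact h1 hv hvM
          · exact h1 hu huM
      _ = 1 * M ^ (p - 2) * (v + u) ^ 2 := by ring
      _ ≤ _ := by gcongr; linarith
  rw [abs_le] at hs ht
  rcases le_total 0 s with h0s | h0s <;> rcases le_total 0 t with h0t | h0t
  · rw [nonneg h0s, nonneg h0t]
    rcases le_total s t with h | h
    · exact same h0s h ht.2
    · have := same h0t h hs.2; nlinarith
  · have e : signedPow p t = - (-t) ^ (p - 1) := by
      rw [← nonneg (neg_nonneg.2 h0t), neg, neg_neg]
    rw [nonneg h0s, e]
    have := opp (neg_nonneg.2 h0t) (by linarith) h0s hs.2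
    nlinarith
  · have e : signedPow p s = - (-s) ^ (p - 1) := by
      rw [← nonneg (neg_nonneg.2 h0s), neg, neg_neg]
    rw [nonneg h0t, e]
    have := opp (neg_nonneg.2 h0s) (by linarith) h0t ht.2
    nlinarith
  · have e : signedPow p t = - (-t) ^ (p - 1) := by
      rw [← nonneg (neg_nonneg.2 h0t), neg, neg_neg]
    have e' : signedPow p s = - (-s) ^ (p - 1) := by
      rw [← nonneg (neg_nonneg.2 h0s), neg, neg_neg]
    rw [e, e']
    rcases le_total s t with h | h
    · have := same (neg_nonneg.2 h0t) (neg_le_neg h) (by linarith); nlinarith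
    · have := same (neg_nonneg.2 h0s) (neg_le_neg h) (by linarith); nlinarith

/-- A second order expansion of `|·| ^ p` with remainder. -/
lemma abs_add_rpow_le {p : ℝ} (hp : 2 ≤ p) (u v : ℝ) :
    |u + v| ^ p ≤ |u| ^ p + p * (signedPow p u * v) +
      p * (p - 1) * ((|u| + |v|) ^ (p - 2) * v ^ 2) := by
  have hp0 : 0 < p := by linarith
  have hc : p.HolderConjugate p.conjExponent := .conjExponent (by linarith)
  have hy := Real.young_inequality_of_nonneg (abs_nonneg u)
    (Real.rpow_nonneg (abs_nonneg (u + v)) (p - 1)) hc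
  have he : (|u + v| ^ (p - 1)) ^ p.conjExponent = |u + v| ^ p := by
    rw [← Real.rpow_mul (abs_nonneg _), hc.sub_one_mul_conj]
  rw [he] at hy
  have hq : (p.conjExponent)⁻¹ = 1 - p⁻¹ := by have := hc.inv_add_inv_eq_one; linarith
  rw [div_eq_mul_inv _ p.conjExponent, hq] at hy
  -- convexity: the tangent of `|·| ^ p` at `u + v` lies below the value at `u`
  have h1 : signedPow p (u + v) * u ≤ |u| * |u + v| ^ (p - 1) := by
    refine (le_abs_self _).trans ?_
    rw [abs_mul, abs_signedPow hp, mul_comm]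
  have h2 := signedPow_mul_self hp (u + v)
  have h3 : p * (|u| ^ p / p + |u + v| ^ p * (1 - p⁻¹)) = |u| ^ p + (p - 1) * |u + v| ^ p := by
    field_simp
  have h4 : p * (signedPow p (u + v) * u) ≤ |u| ^ p + (p - 1) * |u + v| ^ p := by
    rw [← h3]; exact mul_le_mul_of_nonneg_left (h1.trans hy) hp0.le
  have h5 := signedPow_sub_mul_le (M := |u| + |v|) hp (s := u) (t := u + v)
    (le_add_of_nonneg_right (abs_nonneg v)) (abs_add_le u v)
  rw [add_sub_cancel_left] at h5
  have h6 := mul_le_mul_of_nonneg_left h5 hp0.le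
  have h7 : p * (signedPow p (u + v) * (u + v)) = p * |u + v| ^ p := by rw [h2]
  nlinarith

section
variable {d : ℕ} {p a : ℝ}

/-- The sum `a ^ p + ∑ |θ j| ^ p`. -/
noncomputable def powSum (p a : ℝ) (θ : Fin d → ℝ) : ℝ := a ^ p + ∑ j, |θ j| ^ p

/-- The potential function for a finite exponent: the `L_p` norm of the vector `θ` extended by one
coordinate `a`, which keeps the norm away from its singularity. -/
noncomputable def lpPot (p a : ℝ) (θ : Fin d → ℝ) : ℝ := powSum p a θ ^ (1 / p)

/-- The gradient of `lpPot`. -/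
noncomputable def lpGrad (p a : ℝ) (θ : Fin d → ℝ) (j : Fin d) : ℝ :=
  signedPow p (θ j) / powSum p a θ ^ (1 - 1 / p)

lemma sum_abs_rpow_nonneg (θ : Fin d → ℝ) : 0 ≤ ∑ j, |θ j| ^ p :=
  Finset.sum_nonneg fun _ _ => Real.rpow_nonneg (abs_nonneg _) _

lemma powSum_pos (ha : 0 < a) (θ : Fin d → ℝ) : 0 < powSum p a θ :=
  add_pos_of_pos_of_nonneg (Real.rpow_pos_of_pos ha _) (sum_abs_rpow_nonneg θ)

lemma lpPot_pos (ha : 0 < a) (θ : Fin d → ℝ) : 0 < lpPot p a θ :=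
  Real.rpow_pos_of_pos (powSum_pos ha θ) _

lemma lpPot_rpow (hp : 2 ≤ p) (ha : 0 < a) (θ : Fin d → ℝ) : lpPot p a θ ^ p = powSum p a θ := by
  rw [lpPot, ← Real.rpow_mul (powSum_pos ha θ).le, one_div, inv_mul_cancel₀ (by linarith),
    Real.rpow_one]

lemma le_lpPot (hp : 2 ≤ p) (ha : 0 < a) (θ : Fin d → ℝ) : a ≤ lpPot p a θ := by
  have h : a ^ p ≤ powSum p a θ := le_add_of_nonneg_right (sum_abs_rpow_nonneg θ)
  have := Real.rpow_le_rpow (Real.rpow_nonneg ha.le _) h (by positivity : 0 ≤ 1 / p)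
  rwa [← Real.rpow_mul ha.le, mul_one_div_cancel (by linarith), Real.rpow_one] at this

lemma norm_le_lpPot (hp : 2 ≤ p) (ha : 0 < a) (θ : Fin d → ℝ) :
    (∑ j, |θ j| ^ p) ^ (1 / p) ≤ lpPot p a θ :=
  Real.rpow_le_rpow (sum_abs_rpow_nonneg θ)
    (le_add_of_nonneg_left (Real.rpow_nonneg ha.le _)) (by positivity)

lemma lpPot_zero (hp : 2 ≤ p) (ha : 0 < a) : lpPot p a (0 : Fin d → ℝ) = a := by
  have : powSum p a (0 : Fin d → ℝ) = a ^ p := by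
    simp [powSum, Real.zero_rpow (by linarith : p ≠ 0)]
  rw [lpPot, this, ← Real.rpow_mul ha.le, mul_one_div_cancel (by linarith), Real.rpow_one]

lemma dotProduct_le_lpPot (hp : 2 ≤ p) (ha : 0 < a) {w : Fin d → ℝ}
    (hw : ∑ j, |w j| ^ p.conjExponent ≤ 1) (θ : Fin d → ℝ) : w ⬝ᵥ θ ≤ lpPot p a θ := by
  have hc : p.HolderConjugate p.conjExponent := .conjExponent (by linarith)
  have h := Real.inner_le_Lp_mul_Lq Finset.univ w θ hc.symm
  refine h.trans ?_
  have h1 : (∑ j, |w j| ^ p.conjExponent) ^ (1 / p.conjExponent) ≤ 1 :=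
    Real.rpow_le_one (sum_abs_rpow_nonneg w) hw (by have := hc.symm.pos; positivity)
  calc _ ≤ 1 * (∑ j, |θ j| ^ p) ^ (1 / p) := by
        gcongr
    _ ≤ _ := by rw [one_mul]; exact norm_le_lpPot hp ha θ

/-- Bound on the second-order term of the potential, by the inequalities of Minkowski and Young. -/
lemma sum_remainder_le (hp : 2 ≤ p) (ha : 0 < a) (θ x : Fin d → ℝ) (hx : ∑ j, |x j| ^ p ≤ 1) :
    ∑ j, (|θ j| + |x j|) ^ (p - 2) * x j ^ 2 ≤ (lpPot p a θ + 1) ^ (p - 2) := by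
  set l := lpPot p a θ + 1 with hl
  have hl0 : 0 < l := by have := lpPot_pos (p := p) ha θ; linarith
  have hp0 : 0 < p := by linarith
  have hmink : ∑ j, (|θ j| + |x j|) ^ p ≤ l ^ p := by
    have h := Real.Lp_add_le_of_nonneg Finset.univ (f := fun j => |θ j|) (g := fun j => |x j|)
      (p := p) (by linarith) (fun j _ => abs_nonneg _) (fun j _ => abs_nonneg _)
    have h1 : (∑ j, |x j| ^ p) ^ (1 / p) ≤ 1 :=
      Real.rpow_le_one (sum_abs_rpow_nonneg x) hx (by positivity)
    have h2 := h.trans (add_le_add (norm_le_lpPot hp ha θ) h1)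
    have h3 : (0 : ℝ) ≤ ∑ j, (|θ j| + |x j|) ^ p :=
      Finset.sum_nonneg fun j _ => Real.rpow_nonneg (by positivity) _
    have h4 := Real.rpow_le_rpow (Real.rpow_nonneg h3 _) h2 hp0.le
    rwa [← Real.rpow_mul h3, one_div_mul_cancel hp0.ne', Real.rpow_one] at h4
  have hterm : ∀ j, (|θ j| + |x j|) ^ (p - 2) * x j ^ 2 ≤
      l ^ (p - 2) * ((p - 2) / p * ((|θ j| + |x j|) ^ p / l ^ p) + 2 / p * |x j| ^ p) := by
    intro j
    set M := |θ j| + |x j| with hM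
    have hM0 : 0 ≤ M := by positivity
    have h := Real.geom_mean_le_arith_mean2_weighted (w₁ := (p - 2) / p) (w₂ := 2 / p)
      (p₁ := (M / l) ^ p) (p₂ := |x j| ^ p) (div_nonneg (by linarith) hp0.le) (by positivity)
      (by positivity) (by positivity) (by field_simp; ring)
    rw [← Real.rpow_mul (by positivity), ← Real.rpow_mul (by positivity),
      mul_div_cancel₀ _ hp0.ne', mul_div_cancel₀ _ hp0.ne', Real.div_rpow hM0 hl0.le,
      Real.div_rpow hM0 hl0.le, Real.rpow_two, sq_abs] at h
    have h2 := mul_le_mul_of_nonneg_left h (Real.rpow_nonneg hl0.le (p - 2))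
    refine le_trans (le_of_eq ?_) h2
    have : l ^ (p - 2) ≠ 0 := (Real.rpow_pos_of_pos hl0 _).ne'
    field_simp
  refine (Finset.sum_le_sum fun j _ => hterm j).trans ?_
  rw [← Finset.mul_sum, Finset.sum_add_distrib, ← Finset.mul_sum, ← Finset.mul_sum,
    ← Finset.sum_div]
  refine mul_le_of_le_one_right (Real.rpow_nonneg hl0.le _) ?_
  have h1 : (∑ j, (|θ j| + |x j|) ^ p) / l ^ p ≤ 1 :=
    (div_le_one (Real.rpow_pos_of_pos hl0 _)).2 hmink
  calc _ ≤ (p - 2) / p * 1 + 2 / p * 1 := by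
        have : 0 ≤ (p - 2) / p := div_nonneg (by linarith) hp0.le
        gcongr
    _ = 1 := by field_simp; ring

/-- Smoothness of the potential function. -/
theorem lpPot_add_le (hp : 2 ≤ p) (ha : p ≤ a) (θ x : Fin d → ℝ) (hx : ∑ j, |x j| ^ p ≤ 1) :
    lpPot p a (θ + x) ≤ lpPot p a θ + lpGrad p a θ ⬝ᵥ x + 3 * p / a := by
  have ha0 : 0 < a := by linarith
  have hp0 : 0 < p := by linarith
  set g := lpPot p a θ with hg
  set h := powSum p a θ with hh
  have hg0 : 0 < g := lpPot_pos ha0 θ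
  have hh0 : 0 < h := powSum_pos ha0 θ
  have hga : a ≤ g := le_lpPot hp ha0 θ
  have hgp : g ^ p = h := lpPot_rpow hp ha0 θ
  set k := ∑ j, signedPow p (θ j) * x j with hk
  set δ := p * k + p * (p - 1) * (g + 1) ^ (p - 2) with hδ
  have hsum : powSum p a (θ + x) ≤ h + δ := by
    have h1 : ∑ j, |θ j + x j| ^ p ≤ ∑ j, |θ j| ^ p + p * k +
        p * (p - 1) * ∑ j, (|θ j| + |x j|) ^ (p - 2) * x j ^ 2 := by
      rw [hk, Finset.mul_sum, Finset.mul_sum, ← Finset.sum_add_distrib, ← Finset.sum_add_distrib]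
      exact Finset.sum_le_sum fun j _ => abs_add_rpow_le hp _ _
    have h2 := mul_le_mul_of_nonneg_left (sum_remainder_le hp ha0 θ x hx)
      (mul_nonneg hp0.le (by linarith : 0 ≤ p - 1))
    simp only [powSum, Pi.add_apply, hh, hδ] at *
    linarith
  have hpos := powSum_pos (p := p) ha0 (θ + x)
  have hδh : -1 ≤ δ / h := by rw [le_div_iff₀ hh0]; linarith
  have h1 : lpPot p a (θ + x) ≤ g * (1 + 1 / p * (δ / h)) := by
    calc lpPot p a (θ + x) ≤ (h * (1 + δ / h)) ^ (1 / p) := by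
          refine Real.rpow_le_rpow hpos.le (hsum.trans (le_of_eq ?_)) (by positivity)
          field_simp
      _ = g * (1 + δ / h) ^ (1 / p) := by
          rw [Real.mul_rpow hh0.le (by linarith)]; rfl
      _ ≤ _ := by
          gcongr
          exact rpow_one_add_le_one_add_mul_self hδh (by positivity)
            ((div_le_one hp0).2 (by linarith))
  have hgrad : lpGrad p a θ ⬝ᵥ x = k * (g / h) := by
    have e : g / h = (h ^ (1 - 1 / p))⁻¹ := by
      rw [hg, lpPot, ← hh, ← Real.rpow_neg hh0.le, show -(1 - 1 / p) = 1 / p - 1 by ring,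
        Real.rpow_sub_one hh0.ne']
    rw [e, hk, Finset.sum_mul]
    refine Finset.sum_congr rfl fun j _ => ?_
    rw [lpGrad, ← hh, div_eq_mul_inv]; ring
  have hrem : (g + 1) ^ (p - 2) * (g / h) ≤ 3 / a := by
    have e1 : (g + 1) ^ (p - 2) * (g / h) = (1 + 1 / g) ^ (p - 2) / g := by
      have e2 : 1 + 1 / g = (g + 1) / g := by field_simp
      have e3 : h = g ^ (p - 2) * g ^ 2 := by
        rw [← hgp, ← Real.rpow_natCast g 2, ← Real.rpow_add hg0]; congr 1; norm_num
      rw [e2, Real.div_rpow (by positivity) hg0.le, e3]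
      have : g ^ (p - 2) ≠ 0 := (Real.rpow_pos_of_pos hg0 _).ne'
      field_simp
    rw [e1]
    have e4 : (1 + 1 / g) ^ (p - 2) ≤ 3 := by
      calc (1 + 1 / g) ^ (p - 2) ≤ (Real.exp (1 / g)) ^ (p - 2) := by
            refine Real.rpow_le_rpow (by positivity) ?_ (by linarith)
            rw [add_comm]; exact Real.add_one_le_exp _
        _ = Real.exp (1 / g * (p - 2)) := (Real.exp_mul _ _).symm
        _ ≤ Real.exp 1 := by
            refine Real.exp_le_exp.2 ?_
            rw [one_div, inv_mul_le_iff₀ hg0]; linarith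
        _ ≤ 3 := Real.exp_one_lt_three.le
    exact div_le_div₀ (by norm_num) e4 ha0 hga
  refine h1.trans ?_
  have e5 : g * (1 + 1 / p * (δ / h)) =
      g + k * (g / h) + (p - 1) * ((g + 1) ^ (p - 2) * (g / h)) := by
    rw [hδ]; field_simp; ring
  rw [e5, hgrad]
  have : (p - 1) * ((g + 1) ^ (p - 2) * (g / h)) ≤ p * (3 / a) := by
    have h0 : 0 ≤ (g + 1) ^ (p - 2) * (g / h) := by positivity
    nlinarith
  have e6 : p * (3 / a) = 3 * p / a := by ring
  linarith

lemma sum_abs_lpGrad_rpow_le (hp : 2 ≤ p) (ha : 0 < a) (θ : Fin d → ℝ) :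
    ∑ j, |lpGrad p a θ j| ^ p.conjExponent ≤ 1 := by
  have hc : p.HolderConjugate p.conjExponent := .conjExponent (by linarith)
  have hh := powSum_pos (p := p) ha θ
  have : ∀ j, |lpGrad p a θ j| ^ p.conjExponent = |θ j| ^ p / powSum p a θ := by
    intro j
    rw [lpGrad, abs_div, abs_signedPow hp, abs_of_pos (Real.rpow_pos_of_pos hh _),
      Real.div_rpow (by positivity) (by positivity), ← Real.rpow_mul (abs_nonneg _),
      hc.sub_one_mul_conj, ← Real.rpow_mul hh.le]
    have : (1 - 1 / p) * p.conjExponent = 1 := by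
      have h1 : 1 - 1 / p = (p.conjExponent)⁻¹ := by
        have := hc.inv_add_inv_eq_one; rw [one_div]; linarith
      rw [h1, inv_mul_cancel₀ hc.symm.ne_zero]
    rw [this, Real.rpow_one]
  simp only [this]
  rw [← Finset.sum_div, div_le_one hh]
  exact le_add_of_nonneg_left (Real.rpow_nonneg ha.le _)

end

/-! ### Potential functions: the supremum norm -/

section
variable {d : ℕ} {η : ℝ}

/-- The sum of the weights `e ^ (η θ j)` and `e ^ (-η θ j)`. -/
noncomputable def expSum (η : ℝ) (θ : Fin d → ℝ) : ℝ :=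
  ∑ j, (Real.exp (η * θ j) + Real.exp (-(η * θ j)))

/-- The potential function for the supremum norm: a smooth version of `max_j |θ j|`. -/
noncomputable def softmax (η : ℝ) (θ : Fin d → ℝ) : ℝ := η⁻¹ * Real.log (expSum η θ)

/-- The gradient of `softmax`. -/
noncomputable def softGrad (η : ℝ) (θ : Fin d → ℝ) (j : Fin d) : ℝ :=
  (Real.exp (η * θ j) - Real.exp (-(η * θ j))) / expSum η θ

lemma expSum_pos (hd : 0 < d) (θ : Fin d → ℝ) : 0 < expSum η θ := by
  have : Nonempty (Fin d) := ⟨⟨0, hd⟩⟩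
  exact Finset.sum_pos (fun j _ => by positivity) Finset.univ_nonempty

lemma abs_le_softmax (hη : 0 < η) (θ : Fin d → ℝ) (j : Fin d) : |θ j| ≤ softmax η θ := by
  have hZ := expSum_pos (η := η) (Fin.pos j) θ
  rw [softmax, le_inv_mul_iff₀ hη, Real.le_log_iff_exp_le hZ]
  have h1 : Real.exp (η * θ j) + Real.exp (-(η * θ j)) ≤ expSum η θ :=
    Finset.single_le_sum (f := fun j => Real.exp (η * θ j) + Real.exp (-(η * θ j)))
      (fun j _ => by positivity) (Finset.mem_univ j)
  refine le_trans ?_ h1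
  rcases abs_cases (θ j) with ⟨h, _⟩ | ⟨h, _⟩ <;> rw [h]
  · exact le_add_of_nonneg_right (Real.exp_pos _).le
  · rw [mul_neg]; exact le_add_of_nonneg_left (Real.exp_pos _).le

lemma dotProduct_le_softmax (hd : 0 < d) (hη : 0 < η) {w : Fin d → ℝ} (hw : ∑ j, |w j| ≤ 1)
    (θ : Fin d → ℝ) : w ⬝ᵥ θ ≤ softmax η θ := by
  have h0 : 0 ≤ softmax η θ := (abs_nonneg _).trans (abs_le_softmax hη θ ⟨0, hd⟩)
  calc w ⬝ᵥ θ ≤ ∑ j, |w j| * softmax η θ := Finset.sum_le_sum fun j _ => by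
        refine (le_abs_self _).trans ?_
        rw [abs_mul]
        exact mul_le_mul_of_nonneg_left (abs_le_softmax hη θ j) (abs_nonneg _)
    _ ≤ _ := by rw [← Finset.sum_mul]; exact mul_le_of_le_one_left h0 hw

lemma softmax_zero : softmax η (0 : Fin d → ℝ) = η⁻¹ * Real.log (2 * d) := by
  simp [softmax, expSum]; left; ring_nf

theorem softmax_add_le (hd : 0 < d) (hη : 0 < η) (hη1 : η ≤ 1) (θ x : Fin d → ℝ)
    (hx : ∀ j, |x j| ≤ 1) :
    softmax η (θ + x) ≤ softmax η θ + softGrad η θ ⬝ᵥ x + η := by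
  set Z := expSum η θ with hZ
  have hZ0 : 0 < Z := expSum_pos hd θ
  have hexp : ∀ t : ℝ, |t| ≤ 1 → Real.exp (η * t) ≤ 1 + η * t + η ^ 2 := by
    intro t ht
    have h1 : |η * t| ≤ η := by
      rw [abs_mul, abs_of_pos hη]; exact mul_le_of_le_one_right hη.le ht
    have h2 := (abs_le.1 (Real.abs_exp_sub_one_sub_id_le (h1.trans hη1))).2
    have h3 : (η * t) ^ 2 ≤ η ^ 2 := by rw [← sq_abs]; gcongr
    linarith
  have hsum : expSum η (θ + x) ≤ Z * (1 + η * (softGrad η θ ⬝ᵥ x) + η ^ 2) := by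
    have e : Z * (1 + η * (softGrad η θ ⬝ᵥ x) + η ^ 2) =
        ∑ j, ((1 + η ^ 2) * (Real.exp (η * θ j) + Real.exp (-(η * θ j))) +
          η * ((Real.exp (η * θ j) - Real.exp (-(η * θ j))) * x j)) := by
      rw [Finset.sum_add_distrib, ← Finset.mul_sum, ← Finset.mul_sum]
      have : softGrad η θ ⬝ᵥ x =
          (∑ j, (Real.exp (η * θ j) - Real.exp (-(η * θ j))) * x j) / Z := by
        rw [dotProduct, Finset.sum_div]
        exact Finset.sum_congr rfl fun j _ => by rw [softGrad]; ring
      rw [this]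
      change _ = (1 + η ^ 2) * Z + _
      field_simp; ring
    rw [e]
    refine Finset.sum_le_sum fun j _ => ?_
    have h1 := hexp (x j) (hx j)
    have h2 := hexp (-x j) (by rw [abs_neg]; exact hx j)
    rw [Pi.add_apply, mul_add, Real.exp_add, neg_add, Real.exp_add, ← mul_neg η (x j)]
    have p1 := mul_le_mul_of_nonneg_left h1 (Real.exp_pos (η * θ j)).le
    have p2 := mul_le_mul_of_nonneg_left h2 (Real.exp_pos (-(η * θ j))).le
    nlinarith
  have hpos := expSum_pos (η := η) hd (θ + x)
  have hfac : 0 < 1 + η * (softGrad η θ ⬝ᵥ x) + η ^ 2 := by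
    by_contra h
    have := mul_nonpos_of_nonneg_of_nonpos hZ0.le (not_lt.1 h)
    linarith
  have hlog : Real.log (expSum η (θ + x)) ≤
      Real.log Z + (η * (softGrad η θ ⬝ᵥ x) + η ^ 2) := by
    refine (Real.log_le_log hpos hsum).trans ?_
    rw [Real.log_mul hZ0.ne' hfac.ne']
    have := Real.log_le_sub_one_of_pos hfac
    linarith
  have := mul_le_mul_of_nonneg_left hlog (inv_pos.2 hη).le
  rw [softmax, softmax]
  refine this.trans (le_of_eq ?_)
  rw [← hZ]; field_simp; ring

end
end MarginLearning

/-! ### Approximate powers by arithmetic -/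

namespace MarginLearning
open RealRAM (iter iter_inv)

/-- After `K` rounds: the least power `b ^ n` with `n ≤ K` that is at least `x`, if there is one,
together with `n * s`. -/
noncomputable def climb (b x s : ℝ) (K : ℕ) : ℝ × ℝ :=
  iter (fun _ q => if q.1 < x then (q.1 * b, q.2 + s) else q) K (1, 0)

/-- After `K` rounds: the power `b ^ ⌈t⌉` together with the exponent, if the latter is at most
`K`. -/
noncomputable def raise (b t : ℝ) (K : ℕ) : ℝ × ℝ :=
  iter (fun _ q => if q.2 < t then (q.1 * b, q.2 + 1) else q) K (1, 0)

/-- An approximation from above of `x ^ s` for `x ≥ 1`: the exponent of `x` to the base `b` is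
rounded up, multiplied by `s` and rounded up again. -/
noncomputable def powA (b : ℝ) (K : ℕ) (x s : ℝ) : ℝ := (raise b (climb b x s K).2 K).1

lemma climb_spec (b x s : ℝ) (K : ℕ) :
    ∃ n ≤ K, climb b x s K = (b ^ n, n * s) ∧ (x ≤ b ^ n ∨ n = K) ∧
      (n = 0 ∨ ∃ l, n = l + 1 ∧ b ^ l < x) := by
  refine iter_inv (I := fun k (q : ℝ × ℝ) => ∃ n ≤ k, q = (b ^ n, n * s) ∧ (x ≤ b ^ n ∨ n = k) ∧
      (n = 0 ∨ ∃ l, n = l + 1 ∧ b ^ l < x)) K ⟨0, le_rfl, by simp, .inr rfl, .inl rfl⟩ ?_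
  rintro k q _ ⟨n, hn, rfl, h1, h2⟩
  by_cases h : b ^ n < x
  · refine ⟨n + 1, by omega, ?_, ?_, .inr ⟨n, rfl, h⟩⟩
    · simp [h, pow_succ, add_mul]
    · rcases h1 with h1 | rfl
      · exact absurd h (not_lt.2 h1)
      · exact .inr rfl
  · exact ⟨n, by omega, by simp [h], .inl (not_lt.1 h), h2⟩

lemma raise_eq {b t : ℝ} {K : ℕ} (ht : t ≤ K) : (raise b t K).1 = b ^ ⌈t⌉₊ := by
  have h : raise b t K = (b ^ (min K ⌈t⌉₊), ((min K ⌈t⌉₊ : ℕ) : ℝ)) := by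
    refine iter_inv (I := fun k (q : ℝ × ℝ) => q = (b ^ (min k ⌈t⌉₊), ((min k ⌈t⌉₊ : ℕ) : ℝ)))
      K (by simp) ?_
    rintro k q _ rfl
    by_cases h : k < ⌈t⌉₊
    · have h1 : (k : ℝ) < t := Nat.lt_ceil.1 h
      rw [min_eq_left h.le, min_eq_left (Nat.succ_le_of_lt h)]
      simp [h1, pow_succ]
    · rw [not_lt] at h
      rw [min_eq_right h, min_eq_right (h.trans (Nat.le_succ k))]
      simp [Nat.le_ceil t]
  rw [h, min_eq_right (Nat.ceil_le.2 ht)]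

section
variable {b x s : ℝ} {K K₁ : ℕ}

lemma powA_eq (hb : 1 < b) (hs : 0 ≤ s) (hx : x ≤ b ^ K₁) (h1 : K₁ ≤ K) (h2 : K₁ * s ≤ K) :
    ∃ n ≤ K₁, powA b K x s = b ^ ⌈n * s⌉₊ ∧ x ≤ b ^ n ∧ (n = 0 ∨ ∃ l, n = l + 1 ∧ b ^ l < x) := by
  obtain ⟨n, hn, he, h3, h4⟩ := climb_spec b x s K
  have hnK : n ≤ K₁ := by
    rcases h4 with rfl | ⟨l, rfl, hl⟩
    · exact Nat.zero_le _
    · exact (pow_lt_pow_iff_right₀ hb).1 (hl.trans_le hx)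
  have hns : n * s ≤ K := le_trans (by gcongr) h2
  refine ⟨n, hnK, ?_, ?_, h4⟩
  · rw [powA, he, raise_eq hns]
  · rcases h3 with h3 | rfl
    · exact h3
    · exact hx.trans (pow_le_pow_right₀ hb.le h1)

lemma rpow_le_powA (hb : 1 < b) (hs : 0 ≤ s) (hx0 : 0 ≤ x) (hx : x ≤ b ^ K₁) (h1 : K₁ ≤ K)
    (h2 : K₁ * s ≤ K) : x ^ s ≤ powA b K x s := by
  obtain ⟨n, _, he, h3, _⟩ := powA_eq hb hs hx h1 h2
  have hb0 : 0 < b := by linarith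
  calc x ^ s ≤ (b ^ n) ^ s := Real.rpow_le_rpow hx0 h3 hs
    _ = b ^ (n * s) := by rw [← Real.rpow_natCast, ← Real.rpow_mul hb0.le]
    _ ≤ b ^ ((⌈n * s⌉₊ : ℕ) : ℝ) := Real.rpow_le_rpow_of_exponent_le hb.le (Nat.le_ceil _)
    _ = _ := by rw [he, Real.rpow_natCast]

lemma powA_le (hb : 1 < b) (hs : 0 ≤ s) (hx1 : 1 ≤ x) (hx : x ≤ b ^ K₁) (h1 : K₁ ≤ K)
    (h2 : K₁ * s ≤ K) : powA b K x s ≤ b ^ (1 + s) * x ^ s := by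
  obtain ⟨n, _, he, _, h4⟩ := powA_eq hb hs hx h1 h2
  have hb0 : 0 < b := by linarith
  have hn : b ^ n ≤ b * x := by
    rcases h4 with rfl | ⟨l, rfl, hl⟩
    · rw [pow_zero]; nlinarith
    · rw [pow_succ, mul_comm]; gcongr
  calc powA b K x s = b ^ ((⌈n * s⌉₊ : ℕ) : ℝ) := by rw [he, Real.rpow_natCast]
    _ ≤ b ^ (1 + n * s) := by
        refine Real.rpow_le_rpow_of_exponent_le hb.le ?_
        have := Nat.ceil_lt_add_one (by positivity : 0 ≤ n * s)
        linarith
    _ = b * (b ^ n) ^ s := by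
        rw [Real.rpow_add hb0, Real.rpow_one, ← Real.rpow_natCast b n, ← Real.rpow_mul hb0.le]
    _ ≤ b * (b * x) ^ s := by gcongr
    _ = _ := by
        rw [Real.mul_rpow hb0.le (by linarith), Real.rpow_add hb0, Real.rpow_one, mul_assoc]

lemma powA_of_le_one (hb : 1 < b) (hs : 0 ≤ s) (hx1 : x ≤ 1) (h1 : K₁ ≤ K) (h2 : K₁ * s ≤ K) :
    powA b K x s = 1 := by
  obtain ⟨n, _, he, _, h4⟩ := powA_eq hb hs (hx1.trans (one_le_pow₀ hb.le)) h1 h2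
  rcases h4 with rfl | ⟨l, rfl, hl⟩
  · simp [he]
  · exact absurd (hl.trans_le hx1) (not_lt.2 (one_le_pow₀ hb.le))

lemma powA_le_pow (hb : 1 < b) (hs : 0 ≤ s) (hx : x ≤ b ^ K₁) (h1 : K₁ ≤ K)
    (h2 : K₁ * s ≤ K) : powA b K x s ≤ b ^ ⌈K₁ * s⌉₊ := by
  obtain ⟨n, hn, he, _, _⟩ := powA_eq hb hs hx h1 h2
  rw [he]
  refine pow_le_pow_right₀ hb.le (Nat.ceil_le_ceil ?_)
  gcongr

end

/-! ### Computable approximations of the gradients -/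

/-- The parameters of the approximate gradient for a finite exponent `p`: the cutoff `c`, the
additional coordinate `A` in units of `c`, the base `b` and the number of rounds `K` for approximate
powers, and the correction factor `ρ`. -/
structure LpParams where
  p : ℝ
  b : ℝ
  c : ℝ
  A : ℝ
  ρ : ℝ
  K : ℕ

/-- The approximation of `powSum`, in units of `c ^ p`. -/
noncomputable def LpParams.sum (P : LpParams) {d : ℕ} (θ : Fin d → ℝ) : ℝ :=
  powA P.b P.K P.A P.p + ∑ j, powA P.b P.K (|θ j| / P.c) P.p

/-- The approximation of `lpGrad`: coordinates below the cutoff are replaced by zero. -/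
noncomputable def LpParams.link (P : LpParams) {d : ℕ} (θ : Fin d → ℝ) (j : Fin d) : ℝ :=
  if |θ j| / P.c < 1 then 0 else
    (if θ j < 0 then -1 else 1) * (powA P.b P.K (|θ j| / P.c) (P.p - 1) /
      (P.ρ * powA P.b P.K (P.sum θ) (1 - 1 / P.p)))

section
variable {d : ℕ}

lemma ratio_approx {H Q u y τ : ℝ} (hτ : 0 < τ) (hτ1 : τ ≤ 1 / 4) (hH : 0 < H) (hQ1 : H ≤ Q)
    (hQ2 : Q ≤ (1 + τ) * ((1 + 2 * τ) * H)) (hy : 0 ≤ y) (hu1 : y ≤ u) (hu2 : u ≤ (1 + τ) * y) :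
    0 ≤ u / ((1 + τ) * Q) ∧ u / ((1 + τ) * Q) ≤ y / H ∧
      |u / ((1 + τ) * Q) - y / H| ≤ 4 * τ * (y / H) := by
  have hQ0 : 0 < Q := hH.trans_le hQ1
  have hu0 : 0 ≤ u := hy.trans hu1
  have w0 : 0 ≤ u / ((1 + τ) * Q) := by positivity
  have w1 : u / ((1 + τ) * Q) ≤ y / H := by
    rw [div_le_div_iff₀ (by positivity) hH]
    calc u * H ≤ ((1 + τ) * y) * Q := by gcongr
      _ = _ := by ring
  have w2 : y / H * (1 - 4 * τ) ≤ u / ((1 + τ) * Q) := by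
    rw [le_div_iff₀ (by positivity)]
    have h1 : 0 ≤ 1 - 4 * τ := by linarith
    have h2 : (1 - 4 * τ) * ((1 + τ) * ((1 + τ) * (1 + 2 * τ))) ≤ 1 := by
      have e : (1 - 4 * τ) * ((1 + τ) * ((1 + τ) * (1 + 2 * τ))) =
          1 - (11 * τ ^ 2 + 18 * τ ^ 3 + 8 * τ ^ 4) := by ring
      rw [e]
      have : 0 ≤ 11 * τ ^ 2 + 18 * τ ^ 3 + 8 * τ ^ 4 := by positivity
      linarith
    calc y / H * (1 - 4 * τ) * ((1 + τ) * Q)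
        ≤ y / H * (1 - 4 * τ) * ((1 + τ) * ((1 + τ) * ((1 + 2 * τ) * H))) := by gcongr
      _ = y * ((1 - 4 * τ) * ((1 + τ) * ((1 + τ) * (1 + 2 * τ)))) := by field_simp
      _ ≤ y * 1 := by gcongr
      _ ≤ u := by rw [mul_one]; exact hu1
  refine ⟨w0, w1, ?_⟩
  rw [abs_of_nonpos (by linarith)]; linarith

/-- The approximate gradient lies in the dual ball and, coordinate by coordinate, is close to the
gradient. -/
lemma lpLink_approx (P : LpParams) {a τ : ℝ} {K₁ : ℕ} (hd : 0 < d) (hp : 2 ≤ P.p) (ha : 0 < a)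
    (hτ : 0 < τ) (hτ1 : τ ≤ 1 / 4) (hA : P.A = d / τ) (hc : P.c = a / P.A) (hb : 1 < P.b)
    (hρ : P.ρ = 1 + τ) (hbρ : P.b ^ (1 + P.p) ≤ 1 + τ)
    (hK : K₁ + ⌈K₁ * P.p⌉₊ ≤ P.K) (hKA : P.A ≤ P.b ^ K₁) (hKd : (d : ℝ) + 1 ≤ P.b ^ K₁)
    (θ : Fin d → ℝ) (hθ : ∀ j, |θ j| / P.c ≤ P.b ^ K₁) :
    ∀ j, |P.link θ j| ≤ |lpGrad P.p a θ j| ∧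
      |P.link θ j - lpGrad P.p a θ j| ≤ 4 * τ * |lpGrad P.p a θ j| + τ / d := by
  obtain ⟨p, b, c, A, ρ, K⟩ := P
  simp only at *
  subst hρ
  have hd' : (1 : ℝ) ≤ d := Nat.one_le_cast.2 hd
  have hA1 : 1 ≤ A := by rw [hA, le_div_iff₀ hτ]; linarith
  have hA0 : 0 < A := by linarith
  have hc0 : 0 < c := by rw [hc]; positivity
  have hp0 : 0 < p := by linarith
  have hb0 : 0 < b := by linarith
  have hK1 : K₁ ≤ K := by omega
  have hKp : K₁ * p ≤ K := by
    refine (Nat.le_ceil _).trans ?_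
    exact_mod_cast (by omega : ⌈K₁ * p⌉₊ ≤ K)
  have hKs : ∀ s, s ≤ p → K₁ * s ≤ K := fun s hs => le_trans (by gcongr) hKp
  have hbs : ∀ s, s ≤ p → b ^ (1 + s) ≤ 1 + τ := fun s hs =>
    (Real.rpow_le_rpow_of_exponent_le hb.le (by linarith)).trans hbρ
  set x : Fin d → ℝ := fun j => |θ j| / c with hx
  have hx0 : ∀ j, 0 ≤ x j := fun j => by positivity
  -- the exact sum in units of `c ^ p`
  set h := A ^ p + ∑ j, x j ^ p with hh
  have hh0 : 0 < h := add_pos_of_pos_of_nonneg (by positivity)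
    (Finset.sum_nonneg fun j _ => Real.rpow_nonneg (hx0 j) _)
  have hAh : A ^ p ≤ h := le_add_of_nonneg_right
    (Finset.sum_nonneg fun j _ => Real.rpow_nonneg (hx0 j) _)
  have hpow : powSum p a θ = c ^ p * h := by
    rw [powSum, hh, mul_add, Finset.mul_sum]
    congr 1
    · rw [hc, Real.div_rpow ha.le hA0.le]; field_simp
    · refine Finset.sum_congr rfl fun j _ => ?_
      rw [hx, Real.div_rpow (abs_nonneg _) hc0.le]; field_simp
  set H := h ^ (1 - 1 / p) with hH
  have hH0 : 0 < H := Real.rpow_pos_of_pos hh0 _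
  have h1p : 0 ≤ 1 - 1 / p := by rw [sub_nonneg, div_le_one hp0]; linarith
  have h1p' : 1 - 1 / p ≤ 1 := by have : 0 < 1 / p := by positivity
                                  linarith
  have hG : ∀ j, |lpGrad p a θ j| = x j ^ (p - 1) / H := by
    intro j
    have e1 : (c ^ p * h) ^ (1 - 1 / p) = c ^ (p - 1) * H := by
      rw [Real.mul_rpow (by positivity) hh0.le, ← Real.rpow_mul hc0.le]
      congr 2; field_simp
    rw [lpGrad, abs_div, abs_signedPow hp, hpow, e1,
      abs_of_pos (show 0 < c ^ (p - 1) * H by positivity)]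
    change _ = (|θ j| / c) ^ (p - 1) / H
    rw [Real.div_rpow (abs_nonneg _) hc0.le]
    field_simp
  set S := powA b K A p + ∑ j, powA b K (x j) p with hS
  have hSh : h ≤ S := add_le_add (rpow_le_powA hb hp0.le hA0.le hKA hK1 hKp)
    (Finset.sum_le_sum fun j _ => rpow_le_powA hb hp0.le (hx0 j) (hθ j) hK1 hKp)
  have hdA : (d : ℝ) ≤ τ * h := by
    have e1 : (d : ℝ) = τ * A := by rw [hA]; field_simp
    rw [e1]
    have : A ≤ A ^ p := by
      conv_lhs => rw [← Real.rpow_one A]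
      exact Real.rpow_le_rpow_of_exponent_le hA1 (by linarith)
    gcongr; exact this.trans hAh
  have hSle : S ≤ (1 + 2 * τ) * h := by
    have e1 : powA b K A p ≤ (1 + τ) * A ^ p :=
      (powA_le hb hp0.le hA1 hKA hK1 hKp).trans (by gcongr)
    have e2 : ∀ j, powA b K (x j) p ≤ (1 + τ) * x j ^ p + 1 := fun j => by
      rcases le_total (x j) 1 with hj | hj
      · rw [powA_of_le_one hb hp0.le hj hK1 hKp]
        have := Real.rpow_nonneg (hx0 j) p
        nlinarith
      · refine (powA_le hb hp0.le hj (hθ j) hK1 hKp).trans ?_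
        have : b ^ (1 + p) * x j ^ p ≤ (1 + τ) * x j ^ p := by gcongr
        linarith
    have e3 := Finset.sum_le_sum fun j (_ : j ∈ Finset.univ) => e2 j
    rw [Finset.sum_add_distrib, ← Finset.mul_sum] at e3
    simp only [Finset.sum_const, Finset.card_univ, Fintype.card_fin, nsmul_eq_mul, mul_one] at e3
    have : S ≤ (1 + τ) * h + d := by rw [hS, hh]; linarith
    linarith
  have hS1 : 1 ≤ S := by
    have : (1 : ℝ) ≤ A ^ p := Real.one_le_rpow hA1 hp0.le
    linarith
  have hSK : S ≤ b ^ (K₁ + ⌈K₁ * p⌉₊) := by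
    have e1 := powA_le_pow hb hp0.le hKA hK1 hKp
    have e2 := Finset.sum_le_card_nsmul Finset.univ (fun j => powA b K (x j) p) _
      (fun j _ => powA_le_pow hb hp0.le (hθ j) hK1 hKp)
    simp only [Finset.card_univ, Fintype.card_fin, nsmul_eq_mul] at e2
    rw [pow_add]
    have : ((d : ℝ) + 1) * b ^ ⌈K₁ * p⌉₊ ≤ b ^ K₁ * b ^ ⌈K₁ * p⌉₊ := by gcongr
    linarith
  set Q := powA b K S (1 - 1 / p) with hQ
  have hKS : ((K₁ + ⌈K₁ * p⌉₊ : ℕ) : ℝ) * (1 - 1 / p) ≤ K := by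
    refine (mul_le_of_le_one_right (Nat.cast_nonneg _) h1p').trans ?_
    exact_mod_cast hK
  have hQ1 : H ≤ Q := (Real.rpow_le_rpow hh0.le hSh h1p).trans
    (rpow_le_powA hb h1p (by linarith) hSK hK hKS)
  have hQ2 : Q ≤ (1 + τ) * ((1 + 2 * τ) * H) := by
    refine (powA_le hb h1p hS1 hSK hK hKS).trans ?_
    have e1 : S ^ (1 - 1 / p) ≤ (1 + 2 * τ) * H := by
      calc S ^ (1 - 1 / p) ≤ ((1 + 2 * τ) * h) ^ (1 - 1 / p) :=
            Real.rpow_le_rpow (by linarith) hSle h1p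
        _ = (1 + 2 * τ) ^ (1 - 1 / p) * H := Real.mul_rpow (by linarith) hh0.le
        _ ≤ (1 + 2 * τ) ^ (1 : ℝ) * H := by
            gcongr
            linarith
        _ = _ := by rw [Real.rpow_one]
    have e2 := hbs (1 - 1 / p) (by linarith)
    have : 0 ≤ S ^ (1 - 1 / p) := Real.rpow_nonneg (by linarith) _
    gcongr
  intro j
  have hlink : LpParams.link ⟨p, b, c, A, 1 + τ, K⟩ θ j = if x j < 1 then 0 else
      (if θ j < 0 then -1 else 1) * (powA b K (x j) (p - 1) / ((1 + τ) * Q)) := rfl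
  rw [hlink]
  split_ifs with hj hneg
  · -- below the cutoff the gradient itself is tiny
    rw [abs_zero, zero_sub, abs_neg, hG]
    refine ⟨by positivity, ?_⟩
    have e1 : x j ^ (p - 1) ≤ 1 := Real.rpow_le_one (hx0 j) hj.le (by linarith)
    have e2 : A ≤ H := by
      calc A ≤ A ^ (p - 1) := by
            conv_lhs => rw [← Real.rpow_one A]
            exact Real.rpow_le_rpow_of_exponent_le hA1 (by linarith)
        _ = (A ^ p) ^ (1 - 1 / p) := by
            rw [← Real.rpow_mul hA0.le]; congr 1; field_simp
        _ ≤ H := Real.rpow_le_rpow (by positivity) hAh h1p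
    have e3 : x j ^ (p - 1) / H ≤ 1 / A := div_le_div₀ zero_le_one e1 hA0 e2
    have e4 : 1 / A = τ / d := by rw [hA]; field_simp
    have : 0 ≤ x j ^ (p - 1) / H := by positivity
    nlinarith
  all_goals
    rw [not_lt] at hj
    have u1 := rpow_le_powA hb (s := p - 1) (by linarith) (hx0 j) (hθ j) hK1 (hKs _ (by linarith))
    have u2 := (powA_le hb (s := p - 1) (by linarith) hj (hθ j) hK1 (hKs _ (by linarith))).trans
      (mul_le_mul_of_nonneg_right (hbs (p - 1) (by linarith)) (Real.rpow_nonneg (hx0 j) _))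
    set u := powA b K (x j) (p - 1) with hu
    set y := x j ^ (p - 1) with hy
    have hy0 : 0 ≤ y := Real.rpow_nonneg (hx0 j) _
    obtain ⟨w0, w1, w3⟩ := ratio_approx hτ hτ1 hH0 hQ1 hQ2 hy0 u1 u2
    have w4 : 0 ≤ τ / d := by positivity
    have hGj := hG j
  · have hs : lpGrad p a θ j ≤ 0 := div_nonpos_of_nonpos_of_nonneg
      (mul_nonpos_of_nonneg_of_nonpos (Real.rpow_nonneg (abs_nonneg _) _) hneg.le)
      (Real.rpow_nonneg (powSum_pos ha θ).le _)
    rw [abs_of_nonpos hs] at hGj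
    rw [neg_one_mul, abs_neg, abs_of_nonneg w0, abs_of_nonpos hs, hGj,
      show lpGrad p a θ j = -(y / H) by linarith,
      show -(u / ((1 + τ) * Q)) - -(y / H) = -(u / ((1 + τ) * Q) - y / H) by ring, abs_neg]
    exact ⟨w1, by linarith⟩
  · rw [not_lt] at hneg
    have hs : 0 ≤ lpGrad p a θ j := div_nonneg
      (mul_nonneg (Real.rpow_nonneg (abs_nonneg _) _) hneg)
      (Real.rpow_nonneg (powSum_pos ha θ).le _)
    rw [abs_of_nonneg hs] at hGj
    rw [one_mul, abs_of_nonneg w0, abs_of_nonneg hs, hGj]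
    exact ⟨w1, by linarith⟩

/-- The approximation of `softGrad` with rounded powers of `b`. -/
noncomputable def softLink (b : ℝ) (K : ℕ) (θ : Fin d → ℝ) (j : Fin d) : ℝ :=
  (if θ j < 0 then -1 else 1) * ((raise b |θ j| K).1 - 1 / (raise b |θ j| K).1) /
    ∑ i, ((raise b |θ i| K).1 + 1 / (raise b |θ i| K).1)

lemma softLink_approx {τ : ℝ} {K : ℕ} (hd : 0 < d) (hτ : 0 < τ) (hτ1 : τ ≤ 1) (θ : Fin d → ℝ)
    (hθ : ∀ j, |θ j| ≤ K) :
    ∑ j, |softLink (1 + τ) K θ j| ≤ 1 ∧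
      ∑ j, |softLink (1 + τ) K θ j - softGrad (Real.log (1 + τ)) θ j| ≤ 3 * τ := by
  set b := 1 + τ with hb
  have hb1 : 1 < b := by linarith
  have hb0 : 0 < b := by linarith
  have : Nonempty (Fin d) := ⟨⟨0, hd⟩⟩
  set η := Real.log b with hη
  set z : Fin d → ℝ := fun j => (raise b |θ j| K).1 with hz
  set E : Fin d → ℝ := fun j => Real.exp (η * |θ j|) with hE
  have hEb : ∀ j, E j = b ^ |θ j| := fun j => (Real.rpow_def_of_pos hb0 _).symm
  have hE0 : ∀ j, 0 < E j := fun j => Real.exp_pos _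
  have hz1 : ∀ j, E j ≤ z j := fun j => by
    simp only [hz]
    rw [hEb, raise_eq (hθ j), ← Real.rpow_natCast]
    exact Real.rpow_le_rpow_of_exponent_le hb1.le (Nat.le_ceil _)
  have hz2 : ∀ j, z j ≤ b * E j := fun j => by
    simp only [hz]
    rw [hEb, raise_eq (hθ j), ← Real.rpow_natCast, mul_comm, ← Real.rpow_add_one hb0.ne']
    exact Real.rpow_le_rpow_of_exponent_le hb1.le (Nat.ceil_lt_add_one (abs_nonneg _)).le
  have hz0 : ∀ j, 0 < z j := fun j => (hE0 j).trans_le (hz1 j)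
  set S := ∑ i, (z i + 1 / z i) with hS
  have hS0 : 0 < S := Finset.sum_pos (fun j _ => by have := hz0 j; positivity)
    Finset.univ_nonempty
  have hZe : expSum η θ = ∑ i, (E i + 1 / E i) := by
    refine Finset.sum_congr rfl fun j _ => ?_
    simp only [hE]
    rw [one_div, ← Real.exp_neg]
    rcases abs_cases (θ j) with ⟨h, _⟩ | ⟨h, _⟩ <;> rw [h]
    rw [mul_neg, neg_neg, add_comm]
  set Z := expSum η θ with hZ
  have hZ0 : 0 < Z := expSum_pos hd θ
  have hSZ : S ≤ b * Z := by
    rw [hZe, Finset.mul_sum]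
    refine Finset.sum_le_sum fun j _ => ?_
    have h1 : 1 / z j ≤ 1 / E j := one_div_le_one_div_of_le (hE0 j) (hz1 j)
    have h2 : 1 / E j ≤ b * (1 / E j) := le_mul_of_one_le_left (by have := hE0 j; positivity) hb1.le
    have := hz2 j
    linarith
  have hZS : Z ≤ b * S := by
    rw [hZe, Finset.mul_sum]
    refine Finset.sum_le_sum fun j _ => ?_
    have h1 : E j ≤ b * z j := (hz1 j).trans (le_mul_of_one_le_left (hz0 j).le hb1.le)
    have h2 : 1 / E j ≤ b * (1 / z j) := by
      rw [mul_one_div, div_le_div_iff₀ (hE0 j) (hz0 j)]; linarith [hz2 j]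
    linarith
  have hlink : ∀ j, softLink b K θ j = (if θ j < 0 then -1 else 1) * ((z j - 1 / z j) / S) :=
    fun j => mul_div_assoc _ _ _
  have hgrad : ∀ j, softGrad η θ j = (if θ j < 0 then -1 else 1) * ((E j - 1 / E j) / Z) := by
    intro j
    simp only [softGrad, ← hZ, hE]
    rw [one_div, ← Real.exp_neg]
    split_ifs with h
    · rw [abs_of_neg h, mul_neg, neg_neg]; ring
    · rw [abs_of_nonneg (not_lt.1 h), one_mul]
  have hsgn : ∀ j, |(if θ j < 0 then (-1 : ℝ) else 1)| = 1 := fun j => by split <;> simp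
  constructor
  · calc ∑ j, |softLink b K θ j| ≤ ∑ j, (z j + 1 / z j) / S := by
          refine Finset.sum_le_sum fun j _ => ?_
          rw [hlink, abs_mul, hsgn, one_mul, abs_div, abs_of_pos hS0]
          gcongr
          refine (abs_sub _ _).trans ?_
          have := hz0 j
          rw [abs_of_pos this, abs_of_pos (by positivity : 0 < 1 / z j)]
      _ = 1 := by rw [← Finset.sum_div]; exact div_self hS0.ne'
  · have close : ∀ {u v : ℝ}, 0 < v → u / S ≤ b ^ 2 * (v / Z) → v / Z ≤ b ^ 2 * (u / S) →
        |u / S - v / Z| ≤ (b ^ 2 - 1) * (v / Z) := by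
      intro u v hv h1 h2
      have hvZ : 0 < v / Z := by positivity
      rw [abs_le]
      refine ⟨?_, by linarith⟩
      have h3 : v / Z / b ^ 2 ≤ u / S := by rw [div_le_iff₀ (by positivity)]; linarith
      have h4 : v / Z * (2 - b ^ 2) ≤ v / Z / b ^ 2 := by
        rw [le_div_iff₀ (by positivity), mul_assoc]
        refine mul_le_of_le_one_right hvZ.le ?_
        nlinarith [sq_nonneg (b ^ 2 - 1)]
      linarith
    calc ∑ j, |softLink b K θ j - softGrad η θ j|
        ≤ ∑ j, (b ^ 2 - 1) * ((E j + 1 / E j) / Z) := by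
          refine Finset.sum_le_sum fun j _ => ?_
          have hEj := hE0 j
          have hzj := hz0 j
          have i0 : 0 < 1 / E j := by positivity
          rw [hlink, hgrad, ← mul_sub, abs_mul, hsgn, one_mul]
          have a1 := close (u := z j) (v := E j) hEj
            (by
              rw [mul_div_assoc', div_le_div_iff₀ hS0 hZ0]
              calc z j * Z ≤ (b * E j) * (b * S) := by gcongr; exact hz2 j
                _ = _ := by ring)
            (by
              rw [mul_div_assoc', div_le_div_iff₀ hZ0 hS0]
              calc E j * S ≤ z j * (b * Z) := by gcongr; exact hz1 j
                _ ≤ b * (z j * (b * Z)) := le_mul_of_one_le_left (by positivity) hb1.le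
                _ = _ := by ring)
          have t1 : 1 / z j ≤ 1 / E j := one_div_le_one_div_of_le hEj (hz1 j)
          have t2 : 1 / E j ≤ b * (1 / z j) := by
            rw [mul_one_div, div_le_div_iff₀ hEj hzj]; linarith [hz2 j]
          have a2 := close (u := 1 / z j) (v := 1 / E j) i0
            (by
              rw [mul_div_assoc', div_le_div_iff₀ hS0 hZ0]
              calc 1 / z j * Z ≤ (1 / E j) * (b * S) := by gcongr
                _ ≤ b * (1 / E j * (b * S)) := le_mul_of_one_le_left (by positivity) hb1.le
                _ = _ := by ring)
            (by
              rw [mul_div_assoc', div_le_div_iff₀ hZ0 hS0]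
              calc 1 / E j * S ≤ (b * (1 / z j)) * (b * Z) := by gcongr
                _ = _ := by ring)
          have a3 : (z j - 1 / z j) / S - (E j - 1 / E j) / Z =
              (z j / S - E j / Z) - (1 / z j / S - 1 / E j / Z) := by ring
          rw [a3]
          refine (abs_sub _ _).trans ((add_le_add a1 a2).trans (le_of_eq ?_))
          ring
      _ = b ^ 2 - 1 := by
          rw [← Finset.mul_sum, ← Finset.sum_div, ← hZe, div_self hZ0.ne', mul_one]
      _ ≤ _ := by rw [hb]; nlinarith

end
end MarginLearning

/-! ### The learning program -/

namespace RealRAM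
namespace Cmd

variable (S : ℕ → (ℕ → ℝ) × ℝ) (b : ℕ → Bool)

/-- Proof rule for loops: an invariant preserved by the body holds at the end. -/
lemma den_loop_ind {i n : ℕ} {A : Cmd} {s : Mem} (I : ℕ → Mem → Prop) (h0 : I 0 s)
    (hstep : ∀ k t, k < s.n n → I k t → I (k + 1) (den S b A (t.setN i k))) :
    ∃ t, I (s.n n) t ∧ den S b (loop i n A) s = t.setN i (s.n n) :=
  ⟨_, iter_inv _ h0 hstep, rfl⟩

end Cmd
end RealRAM

namespace MarginLearning
open RealRAM RealRAM.Cmd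

/-- Computes the margins of the halfspace in array `3` on all examples, stores them in array `1`,
and counts in real variable `11` those below the threshold in real variable `5`. -/
def marginsCmd : Cmd := block [
  rcopy 11 17,
  nconst 12 0,
  loop 10 1 (block [
    rcopy 8 17,
    loop 11 0 (block [nadd 13 12 11, load 9 0 13, load 10 3 11, rop .mul 9 9 10, rop .add 8 8 9]),
    store 1 10 8,
    ifLt 8 5 (rop .add 11 11 6) skip,
    nadd 12 12 0])]

/-- Records the halfspace in array `3` as the best one if its count is a new minimum. -/
def bestCmd : Cmd := ifLt 11 12 (block [
  rcopy 12 11,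
  loop 11 0 (block [load 9 3 11, store 4 11 9])]) skip

/-- Reads a block of random bits as a number `u < 2 ^ B` and computes `u * M / 2 ^ B`. -/
def bitsCmd : Cmd := block [
  nconst 14 0,
  nconst 16 1,
  loop 18 4 (block [nadd 14 14 14, flip 15, nadd 14 14 15, nadd 16 16 16]),
  rofNat 14 14,
  rofNat 16 16,
  rop .mul 14 14 11,
  rop .div 14 14 16]

/-- Finds the last mistake whose rank among the mistakes is at most real variable `14`. -/
def selectCmd : Cmd := block [
  rcopy 13 17,
  nconst 12 0,
  nconst 17 0,
  loop 10 1 (block [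
    load 8 1 10,
    ifLt 8 5 (block [ifLt 14 13 skip (nadd 17 12 6), rop .add 13 13 6]) skip,
    nadd 12 12 0])]

/-- Adds the selected example to the vector in array `2`. -/
def updateCmd : Cmd :=
  loop 11 0 (block [nadd 13 17 11, load 9 0 13, load 10 2 11, rop .add 10 10 9, store 2 11 10])

/-- One step of a trial; `lnk` computes the halfspace in array `3` from the vector in array `2`. -/
def stepCmd (lnk : Cmd) : Cmd :=
  block [lnk, marginsCmd, bestCmd, bitsCmd, selectCmd, updateCmd]

/-- All trials. -/
def trialsCmd (lnk : Cmd) : Cmd := loop 8 3 (block [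
  loop 11 0 (store 2 11 17),
  loop 9 2 (stepCmd lnk)])

/-- Draws the examples and stores their products with the labels in array `0`. -/
def sampleCmd : Cmd := block [
  nconst 12 0,
  loop 10 1 (block [
    draw,
    label 8,
    loop 11 0 (block [coord 9 11, rop .mul 9 9 8, nadd 13 12 11, store 0 13 9]),
    nadd 12 12 0])]

/-- The selection rule as a function: the state is the current rank and the selected index. -/
noncomputable def selectIdx (mk : ℕ → Prop) (v : ℝ) (m : ℕ) : ℝ × ℕ :=
  open Classical in
  iter (fun i q => if mk i then (q.1 + 1, if v < q.1 then q.2 else i) else q) m (0, 0)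

/-- The number of mistakes before a given index. -/
noncomputable def rank (mk : ℕ → Prop) (i : ℕ) : ℝ :=
  open Classical in ∑ k ∈ Finset.range i, if mk k then (1 : ℝ) else 0

lemma rank_mono (mk : ℕ → Prop) : Monotone (rank mk) := fun i j hij =>
  Finset.sum_le_sum_of_subset_of_nonneg (Finset.range_mono hij) fun k _ _ => by split <;> simp

lemma rank_succ (mk : ℕ → Prop) {i : ℕ} (h : mk i) : rank mk (i + 1) = rank mk i + 1 := by
  simp only [rank, Finset.sum_range_succ, if_pos h]

lemma rank_succ_of_not (mk : ℕ → Prop) {i : ℕ} (h : ¬ mk i) : rank mk (i + 1) = rank mk i := by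
  simp only [rank, Finset.sum_range_succ, if_neg h, add_zero]

lemma selectIdx_fst (mk : ℕ → Prop) (v : ℝ) (m : ℕ) : (selectIdx mk v m).1 = rank mk m := by
  induction m with
  | zero => simp [selectIdx, iter, rank]
  | succ m ih =>
    simp only [selectIdx, iter] at ih ⊢
    by_cases h : mk m
    · rw [if_pos h, rank_succ mk h, ← ih]
    · rw [if_neg h, rank_succ_of_not mk h, ← ih]

open Classical in
/-- The mistake whose rank is the integer part of `v` is selected. -/
lemma selectIdx_eq (mk : ℕ → Prop) {v : ℝ} {m i : ℕ} (him : i < m) (hi : mk i)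
    (h1 : rank mk i ≤ v) (h2 : v < rank mk i + 1) : (selectIdx mk v m).2 = i := by
  induction m with
  | zero => omega
  | succ m ih =>
    have hstep : (selectIdx mk v (m + 1)).2 =
        if mk m then (if v < rank mk m then (selectIdx mk v m).2 else m)
        else (selectIdx mk v m).2 := by
      rw [← selectIdx_fst mk v m]
      simp only [selectIdx, iter]
      split_ifs <;> simp [*]
    rw [hstep]
    rcases Nat.lt_succ_iff_lt_or_eq.1 him with h | rfl
    · rw [ih h]
      have : v < rank mk m := h2.trans_le (by
        rw [← rank_succ mk hi]; exact rank_mono mk h)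
      simp [this]
    · simp [hi, h1]

lemma selectIdx_lt (mk : ℕ → Prop) (v : ℝ) {m : ℕ} (hm : 0 < m) : (selectIdx mk v m).2 < m := by
  have : (selectIdx mk v m).2 < m ∨ (selectIdx mk v m).2 = 0 := by
    unfold selectIdx
    refine iter_inv (I := fun k (q : ℝ × ℕ) => q.2 < k ∨ q.2 = 0) m (.inr rfl) ?_
    rintro k q _ h
    split_ifs <;> simp <;> omega
  omega

section Specs
variable (S : ℕ → (ℕ → ℝ) × ℝ) (b : ℕ → Bool) {d m B T K : ℕ} {e : ℕ → ℝ}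

/-- The memory during the trials: dimension, sample size, length of a trial, number of bits,
threshold, the constants `0` and `1`, the signed examples `z`, and the parameters `K` and `e` of
the link function. -/
structure Ready (d m B T K : ℕ) (e : ℕ → ℝ) (γ₁ : ℝ) (z : ℕ → Fin d → ℝ) (s : Mem) : Prop where
  n0 : s.n 0 = d
  n1 : s.n 1 = m
  n2 : s.n 2 = T
  n5 : s.n 5 = K
  env : ∀ v ∈ [20, 21, 22, 23, 24, 25], s.r v = e v
  n4 : s.n 4 = B
  n6 : s.n 6 = 0
  r5 : s.r 5 = γ₁
  r6 : s.r 6 = 1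
  r17 : s.r 17 = 0
  ex : ∀ i < m, ∀ j : Fin d, s.a 0 (d * i + j) = z i j

lemma Ready.of_frame {γ₁ : ℝ} {z : ℕ → Fin d → ℝ} {s : Mem} (h : Ready d m B T K e γ₁ z s) (c : Cmd)
    (hn : ∀ v ∈ [0, 1, 2, 4, 5, 6], v ∉ c.wn)
    (hr : ∀ v ∈ [5, 6, 17, 20, 21, 22, 23, 24, 25], v ∉ c.wr) (ha : 0 ∉ c.wa) :
    Ready d m B T K e γ₁ z (den S b c s) where
  n0 := by rw [den_n_of_notMem S b c s (hn 0 (by simp)), h.n0]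
  n1 := by rw [den_n_of_notMem S b c s (hn 1 (by simp)), h.n1]
  n2 := by rw [den_n_of_notMem S b c s (hn 2 (by simp)), h.n2]
  n5 := by rw [den_n_of_notMem S b c s (hn 5 (by simp)), h.n5]
  env v hv := by rw [den_r_of_notMem S b c s (hr v (by simp at hv ⊢; tauto)), h.env v hv]
  n4 := by rw [den_n_of_notMem S b c s (hn 4 (by simp)), h.n4]
  n6 := by rw [den_n_of_notMem S b c s (hn 6 (by simp)), h.n6]
  r5 := by rw [den_r_of_notMem S b c s (hr 5 (by simp)), h.r5]
  r6 := by rw [den_r_of_notMem S b c s (hr 6 (by simp)), h.r6]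
  r17 := by rw [den_r_of_notMem S b c s (hr 17 (by simp)), h.r17]
  ex := by rw [den_a_of_notMem S b c s ha]; exact h.ex

lemma Ready.setN {γ₁ : ℝ} {z : ℕ → Fin d → ℝ} {s : Mem} (h : Ready d m B T K e γ₁ z s)
    {v : ℕ} (k : ℕ)
    (hv : v ∉ [0, 1, 2, 4, 5, 6]) : Ready d m B T K e γ₁ z (s.setN v k) := by
  simp only [List.mem_cons, List.not_mem_nil, or_false, not_or] at hv
  obtain ⟨h0, h1, h2, h4, h5, h6⟩ := hv
  exact ⟨by simp [h.n0, Ne.symm h0], by simp [h.n1, Ne.symm h1], by simp [h.n2, Ne.symm h2],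
    by simp [h.n5, Ne.symm h5], h.env, by simp [h.n4, Ne.symm h4],
    by simp [h.n6, Ne.symm h6], h.r5, h.r6, h.r17, h.ex⟩

/-- The inner loop of `marginsCmd`: a dot product. -/
lemma den_dot (s : Mem) :
    (den S b (loop 11 0 (block [nadd 13 12 11, load 9 0 13, load 10 3 11, rop .mul 9 9 10,
      rop .add 8 8 9])) s).r 8 =
      s.r 8 + ∑ j ∈ Finset.range (s.n 0), s.a 0 (s.n 12 + j) * s.a 3 j := by
  obtain ⟨t, ⟨h1, _, _⟩, h2⟩ := den_loop_ind S b (i := 11) (n := 0)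
    (A := block [nadd 13 12 11, load 9 0 13, load 10 3 11, rop .mul 9 9 10, rop .add 8 8 9])
    (s := s)
    (fun k t => t.r 8 = s.r 8 + ∑ j ∈ Finset.range k, s.a 0 (s.n 12 + j) * s.a 3 j ∧
      t.a = s.a ∧ t.n 12 = s.n 12) (by simp) (by
        rintro k t _ ⟨h1, h2, h3⟩
        simp [block, den, ROp.fn, h1, h2, h3, Finset.sum_range_succ, add_assoc])
  rw [h2, Mem.setN_r, h1]

lemma den_margins {γ₁ : ℝ} {z : ℕ → Fin d → ℝ} {s : Mem} (h : Ready d m B T K e γ₁ z s)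
    {w : Fin d → ℝ} (hw : ∀ j : Fin d, s.a 3 j = w j) :
    (den S b marginsCmd s).r 11 = rank (fun i => w ⬝ᵥ z i < γ₁) m ∧
      ∀ i < m, (den S b marginsCmd s).a 1 i = w ⬝ᵥ z i := by
  set A := block [
    rcopy 8 17,
    loop 11 0 (block [nadd 13 12 11, load 9 0 13, load 10 3 11, rop .mul 9 9 10, rop .add 8 8 9]),
    store 1 10 8,
    ifLt 8 5 (rop .add 11 11 6) skip,
    nadd 12 12 0] with hA
  set s1 := (s.setR 11 (s.r 17)).setN 12 0 with hs1
  have hden : den S b marginsCmd s = den S b (loop 10 1 A) s1 := rfl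
  have e1 : s1.n 1 = m := by simp [hs1, h.n1]
  obtain ⟨t, ⟨h1, h2, _⟩, h3⟩ := den_loop_ind S b (i := 10) (n := 1) (s := s1) (A := A)
    (fun k t => t.r 11 = rank (fun i => w ⬝ᵥ z i < γ₁) k ∧ (∀ i < k, t.a 1 i = w ⬝ᵥ z i) ∧
      (Ready d m B T K e γ₁ z t ∧ (∀ j : Fin d, t.a 3 j = w j) ∧ t.n 12 = d * k))
    ⟨by simp [hs1, h.r17, rank], by simp,
      (h.of_frame S b (rcopy 11 17) (by decide) (by decide) (by decide)).setN 0 (by decide), hw,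
      by simp [hs1]⟩
    (by
      rintro k t hk ⟨g1, g2, g3, g4, g5⟩
      rw [e1] at hk
      set t1 := (t.setN 10 k).setR 8 (t.r 17) with ht1
      set t2 := den S b (loop 11 0 (block [nadd 13 12 11, load 9 0 13, load 10 3 11,
        rop .mul 9 9 10, rop .add 8 8 9])) t1 with ht2
      have dot : t2.r 8 = w ⬝ᵥ z k := by
        rw [ht2, den_dot]
        have q0 : t1.n 0 = d := by simp [ht1, g3.n0]
        have q12 : t1.n 12 = d * k := by simp [ht1, g5]
        have q8 : t1.r 8 = 0 := by simp [ht1, g3.r17]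
        have qa : t1.a = t.a := rfl
        rw [q0, q12, q8, qa, zero_add, Finset.sum_range, dotProduct]
        refine Finset.sum_congr rfl fun j _ => ?_
        rw [g3.ex k hk j, g4 j, mul_comm]
      have r1 : Ready d m B T K e γ₁ z t1 := (g3.of_frame S b (rcopy 8 17) (by decide) (by decide)
        (by decide)).setN k (v := 10) (by decide)
      have r2 : Ready d m B T K e γ₁ z t2 := r1.of_frame S b _ (by decide) (by decide) (by decide)
      have a2 : t2.a = t.a := by
        funext c; exact den_a_of_notMem S b _ t1 (v := c) (by simp [wa, block])
      have n10 : t2.n 10 = k := by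
        rw [ht2, den_n_of_notMem S b _ t1 (by decide)]; simp [ht1]
      have n12 : t2.n 12 = d * k := by
        rw [ht2, den_n_of_notMem S b _ t1 (by decide)]; simp [ht1, g5]
      have r11 : t2.r 11 = rank (fun i => w ⬝ᵥ z i < γ₁) k := by
        rw [ht2, den_r_of_notMem S b _ t1 (by decide)]; simp [ht1, g1]
      have key : den S b A (t.setN 10 k) =
          (if w ⬝ᵥ z k < γ₁ then (t2.setA 1 k (w ⬝ᵥ z k)).setR 11 (t2.r 11 + 1)
            else t2.setA 1 k (w ⬝ᵥ z k)).setN 12 (d * k + d) := by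
        have : den S b A (t.setN 10 k) = den S b (block [
          store 1 10 8,
          ifLt 8 5 (rop .add 11 11 6) skip,
          nadd 12 12 0]) t2 := rfl
        rw [this]
        simp only [block, den, n10, dot, Mem.setA_r, r2.r5, r2.r6, ROp.fn]
        split_ifs <;> simp [n12, r2.n0]
      refine ⟨?_, ?_, (g3.setN k (v := 10) (by decide)).of_frame S b A (by decide) (by decide)
        (by decide), ?_, ?_⟩ <;> rw [key]
      · split_ifs with hlt
        · rw [rank_succ _ hlt]; simp [r11]
        · rw [rank_succ_of_not _ hlt]; simp [r11]
      · intro i hi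
        rcases Nat.lt_succ_iff_lt_or_eq.1 hi with hi | rfl
        · split_ifs <;> simp [a2, hi.ne, g2 i hi]
        · split_ifs <;> simp
      · split_ifs <;> simpa [a2] using g4
      · simp [mul_add])
  rw [hden, h3, e1]
  rw [e1] at h1 h2
  exact ⟨by simpa using h1, by simpa using h2⟩

lemma den_best (s : Mem) :
    (s.r 11 < s.r 12 → (den S b bestCmd s).r 12 = s.r 11 ∧
      ∀ j < s.n 0, (den S b bestCmd s).a 4 j = s.a 3 j) ∧
    (¬ s.r 11 < s.r 12 → den S b bestCmd s = s) := by
  refine ⟨fun h => ?_, fun h => by simp [bestCmd, den, h]⟩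
  simp only [bestCmd, den, block, if_pos h]
  obtain ⟨t, ⟨h1, h2, h3⟩, h4⟩ := den_loop_ind S b (i := 11) (n := 0) (s := s.setR 12 (s.r 11))
    (A := block [load 9 3 11, store 4 11 9])
    (fun k t => t.r 12 = s.r 11 ∧ t.a 3 = s.a 3 ∧ ∀ j < k, t.a 4 j = s.a 3 j) (by simp) (by
      rintro k t _ ⟨g1, g2, g3⟩
      refine ⟨by simp [block, den, g1], by simp [block, den, g2], fun j hj => ?_⟩
      rcases Nat.lt_succ_iff_lt_or_eq.1 hj with hj | rfl
      · simp [block, den, hj.ne, g3 j hj]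
      · simp [block, den, g2])
  change (den S b (loop 11 0 (block [load 9 3 11, store 4 11 9])) (s.setR 12 (s.r 11))).r 12 = _ ∧
    ∀ j < s.n 0, (den S b (loop 11 0 (block [load 9 3 11, store 4 11 9]))
      (s.setR 12 (s.r 11))).a 4 j = _
  rw [h4]
  exact ⟨by simpa using h1, by simpa using h3⟩

lemma den_bits {s : Mem} (hB : s.n 4 = B) :
    (den S b bitsCmd s).r 14 = readBits (dropBits s.flips b) 0 B * s.r 11 / 2 ^ B ∧
      (den S b bitsCmd s).flips = s.flips + B := by
  obtain ⟨t, ⟨h1, h2, h3, h5⟩, h4⟩ := den_loop_ind S b (i := 18) (n := 4)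
    (s := (s.setN 14 0).setN 16 1)
    (A := block [nadd 14 14 14, flip 15, nadd 14 14 15, nadd 16 16 16])
    (fun k t => t.n 14 = readBits (dropBits s.flips b) 0 k ∧ t.n 16 = 2 ^ k ∧
      t.flips = s.flips + k ∧ t.r 11 = s.r 11) (by simp [readBits]) (by
      rintro k t _ ⟨g1, g2, g3, g4⟩
      refine ⟨?_, ?_, ?_, ?_⟩
      · have hb : b t.flips = dropBits s.flips b k := by rw [g3, dropBits, add_comm]
        simp [block, den, g1, readBits, hb, two_mul]
      · simp [block, den, g2, pow_succ, mul_two]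
      · simp [block, den, g3, add_assoc]
      · simp [block, den, g4])
  have e : ((s.setN 14 0).setN 16 1).n 4 = B := by simp [hB]
  rw [e] at h1 h2 h3 h4
  have : den S b bitsCmd s = den S b (block [rofNat 14 14, rofNat 16 16, rop .mul 14 14 11,
      rop .div 14 14 16]) (den S b (loop 18 4 (block [nadd 14 14 14, flip 15, nadd 14 14 15,
        nadd 16 16 16])) ((s.setN 14 0).setN 16 1)) := rfl
  rw [this, h4]
  simp [block, den, ROp.fn, h1, h2, h3, h5]

lemma den_select {γ₁ : ℝ} {z : ℕ → Fin d → ℝ} {s : Mem} (h : Ready d m B T K e γ₁ z s) {f : ℕ → ℝ}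
    (hf : ∀ i < m, s.a 1 i = f i) :
    (den S b selectCmd s).n 17 = d * (selectIdx (fun i => f i < γ₁) (s.r 14) m).2 := by
  set A := block [
    load 8 1 10,
    ifLt 8 5 (block [ifLt 14 13 skip (nadd 17 12 6), rop .add 13 13 6]) skip,
    nadd 12 12 0] with hA
  set s1 := ((s.setR 13 (s.r 17)).setN 12 0).setN 17 0 with hs1
  have hden : den S b selectCmd s = den S b (loop 10 1 A) s1 := rfl
  have e1 : s1.n 1 = m := by simp [hs1, h.n1]
  obtain ⟨t, ⟨h1, h2⟩, h3⟩ := den_loop_ind S b (i := 10) (n := 1) (s := s1) (A := A)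
    (fun k t => t.n 17 = d * (selectIdx (fun i => f i < γ₁) (s.r 14) k).2 ∧
      t.r 13 = (selectIdx (fun i => f i < γ₁) (s.r 14) k).1 ∧ t.a 1 = s.a 1 ∧ t.n 12 = d * k ∧
      t.n 0 = d ∧ t.n 6 = 0 ∧ t.r 5 = γ₁ ∧ t.r 6 = 1 ∧ t.r 14 = s.r 14)
    (by simp [hs1, selectIdx, iter, h.n0, h.n6, h.r5, h.r6, h.r17]) (by
      rintro k t hk ⟨g1, g2, g3, g4, g5, g6, g7, g8, g9⟩
      rw [e1] at hk
      have hfk := hf k hk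
      rw [selectIdx] at g1 g2 ⊢
      simp only [iter]
      simp only [hA, block, den, ROp.fn]
      simp only [Mem.setR_r, Mem.setN_r, Mem.setN_n, Function.update_self, Mem.setN_a, g3, hfk,
        Mem.setR_n]
      by_cases h1 : f k < γ₁
      · by_cases h2 : s.r 14 < t.r 13
        · have h2' := h2
          rw [g2] at h2'
          simp [g1, g2, g3, g4, g5, g6, g7, g8, g9, h1, h2', mul_add]
        · have h2' := h2
          rw [g2] at h2'
          simp [g2, g3, g4, g5, g6, g7, g8, g9, h1, h2', mul_add]
      · simp [g1, g2, g3, g4, g5, g6, g7, g8, g9, h1, mul_add])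
  rw [hden, h3, e1]
  rw [e1] at h1
  simpa using h1

lemma den_update (s : Mem) : ∀ j < s.n 0,
    (den S b updateCmd s).a 2 j = s.a 2 j + s.a 0 (s.n 17 + j) := by
  obtain ⟨t, ⟨h1, _⟩, h3⟩ := den_loop_ind S b (i := 11) (n := 0) (s := s)
    (A := block [nadd 13 17 11, load 9 0 13, load 10 2 11, rop .add 10 10 9, store 2 11 10])
    (fun k t => (∀ j < k, t.a 2 j = s.a 2 j + s.a 0 (s.n 17 + j)) ∧
      (∀ j, k ≤ j → t.a 2 j = s.a 2 j) ∧ t.a 0 = s.a 0 ∧ t.n 17 = s.n 17) (by simp) (by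
      rintro k t _ ⟨g1, g2, g3, g4⟩
      refine ⟨fun j hj => ?_, fun j hj => ?_, by simp [block, den, g3], by simp [block, den, g4]⟩
      · rcases Nat.lt_succ_iff_lt_or_eq.1 hj with hj | rfl
        · simp [block, den, ROp.fn, hj.ne, g1 j hj]
        · simp [block, den, ROp.fn, g2 j le_rfl, g3, g4]
      · have : j ≠ k := by omega
        simp [block, den, ROp.fn, this, g2 j (by omega)])
  intro j hj
  have : den S b updateCmd s = t.setN 11 (s.n 0) := h3
  rw [this]
  exact h1 j hj

lemma den_zero {s : Mem} (h : s.r 17 = 0) : ∀ j < s.n 0,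
    (den S b (loop 11 0 (store 2 11 17)) s).a 2 j = 0 := by
  obtain ⟨t, ⟨h1, _⟩, h3⟩ := den_loop_ind S b (i := 11) (n := 0) (s := s) (A := store 2 11 17)
    (fun k t => (∀ j < k, t.a 2 j = 0) ∧ t.r 17 = 0) (by simp [h]) (by
      rintro k t _ ⟨g1, g2⟩
      refine ⟨fun j hj => ?_, by simp [den, g2]⟩
      rcases Nat.lt_succ_iff_lt_or_eq.1 hj with hj | rfl
      · simp [den, hj.ne, g1 j hj]
      · simp [den, g2])
  rw [h3]
  exact fun j hj => h1 j hj

/-- After sampling, array `0` holds the products of the labels and the examples. -/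
lemma den_sample {s : Mem} (h0 : s.n 0 = d) (h1 : s.n 1 = m) (hdr : s.draws = 0) :
    (∀ i < m, ∀ j < d, (den S b sampleCmd s).a 0 (d * i + j) = (S i).1 j * (S i).2) ∧
      (den S b sampleCmd s).draws = m := by
  set A := block [
    draw,
    label 8,
    loop 11 0 (block [coord 9 11, rop .mul 9 9 8, nadd 13 12 11, store 0 13 9]),
    nadd 12 12 0] with hA
  have hden : den S b sampleCmd s = den S b (loop 10 1 A) (s.setN 12 0) := rfl
  have e1 : (s.setN 12 0).n 1 = m := by simp [h1]
  obtain ⟨t, ⟨g1, g2, _⟩, g3⟩ := den_loop_ind S b (i := 10) (n := 1) (s := s.setN 12 0) (A := A)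
    (fun k t => (∀ i < k, ∀ j < d, t.a 0 (d * i + j) = (S i).1 j * (S i).2) ∧ t.draws = k ∧
      t.n 12 = d * k ∧ t.n 0 = d) (by simp [hdr, h0]) (by
      rintro k t _ ⟨f1, f2, f3, f4⟩
      set t1 := ((den S b draw (t.setN 10 k)).setR 8 (S k).2) with ht1
      have ht1n : t1.n = (t.setN 10 k).n := rfl
      have ht1X : t1.exX = (S k).1 := by
        change (S (t.setN 10 k).draws).1 = _; rw [Mem.setN_draws, f2]
      have ht1d : t1.draws = k + 1 := by
        change (t.setN 10 k).draws + 1 = _; rw [Mem.setN_draws, f2]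
      have hden2 : den S b A (t.setN 10 k) = den S b (nadd 12 12 0) (den S b (loop 11 0
          (block [coord 9 11, rop .mul 9 9 8, nadd 13 12 11, store 0 13 9])) t1) := by
        have : (den S b draw (t.setN 10 k)).exY = (S k).2 := by
          change (S (t.setN 10 k).draws).2 = _; rw [Mem.setN_draws, f2]
        rw [ht1, ← this]; rfl
      have n0 : t1.n 0 = d := by simp [ht1n, f4]
      obtain ⟨t2, ⟨p1, p2, p3, p4, p5, p6, p7⟩, p8⟩ := den_loop_ind S b (i := 11) (n := 0) (s := t1)
        (A := block [coord 9 11, rop .mul 9 9 8, nadd 13 12 11, store 0 13 9])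
        (fun l u => (∀ i < k, ∀ j < d, u.a 0 (d * i + j) = (S i).1 j * (S i).2) ∧
          (∀ j < l, u.a 0 (d * k + j) = (S k).1 j * (S k).2) ∧ u.exX = (S k).1 ∧
          u.r 8 = (S k).2 ∧ u.n 12 = d * k ∧ u.n 0 = d ∧ u.draws = k + 1)
        ⟨f1, by simp, ht1X, by simp [ht1], by simp [ht1n, f3], n0, ht1d⟩ (by
          rintro l u hl ⟨q1, q2, q3, q4, q5, q6, q7⟩
          rw [n0] at hl
          refine ⟨fun i hi j hj => ?_, fun j hj => ?_, by simp [block, den, q3],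
            by simp [block, den, q4], by simp [block, den, q5], by simp [block, den, q6],
            by simp [block, den, q7]⟩
          · have hne : d * i + j ≠ d * k + l := by
              have : d * (i + 1) ≤ d * k := Nat.mul_le_mul_left d hi
              rw [mul_add] at this; omega
            simp [block, den, ROp.fn, q5, hne, q1 i hi j hj]
          · rcases Nat.lt_succ_iff_lt_or_eq.1 hj with hj | rfl
            · simp [block, den, ROp.fn, q5, hj.ne, q2 j hj]
            · simp [block, den, ROp.fn, q3, q4, q5])
      rw [hden2, p8, n0]
      rw [n0] at p2
      refine ⟨fun i hi j hj => ?_, by simp [den, p7], by simp [den, p5, p6, mul_add],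
        by simp [den, p6]⟩
      rcases Nat.lt_succ_iff_lt_or_eq.1 hi with hi | rfl
      · simpa [den] using p1 i hi j hj
      · simpa [den] using p2 j hj)
  rw [e1] at g1 g2 g3
  rw [hden, g3]
  exact ⟨g1, g2⟩

/-- `lnk` computes the function `L` of the vector in array `2` into array `3`, using only memory
reserved for it. -/
structure IsLink (lnk : Cmd) (K : ℕ) (e : ℕ → ℝ) (L : (Fin d → ℝ) → Fin d → ℝ) : Prop where
  wn : ∀ v ∈ lnk.wn, v = 19 ∨ v = 20
  wr : ∀ v ∈ lnk.wr, 26 ≤ v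
  wa : ∀ c ∈ lnk.wa, c = 3
  noFlip : lnk.noFlip = true
  spec : ∀ (S : ℕ → (ℕ → ℝ) × ℝ) (b : ℕ → Bool) (s : Mem) (θ : Fin d → ℝ), s.n 0 = d → s.n 5 = K →
    s.r 6 = 1 → s.r 17 = 0 → (∀ v ∈ [20, 21, 22, 23, 24, 25], s.r v = e v) →
    (∀ j : Fin d, s.a 2 j = θ j) → ∀ j : Fin d, (den S b lnk s).a 3 j = L θ j

variable {γ₁ : ℝ} {z : ℕ → Fin d → ℝ} {lnk : Cmd} {L : (Fin d → ℝ) → Fin d → ℝ}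

/-- The number of examples on which `w` has margin below `γ₁`. -/
noncomputable def mistakes (γ₁ : ℝ) (z : ℕ → Fin d → ℝ) (m : ℕ) (w : Fin d → ℝ) : ℝ :=
  rank (fun i => w ⬝ᵥ z i < γ₁) m

/-- The update of a trial with random number `u`. -/
noncomputable def update (γ₁ : ℝ) (z : ℕ → Fin d → ℝ) (m B : ℕ) (L : (Fin d → ℝ) → Fin d → ℝ)
    (θ : Fin d → ℝ) (u : ℕ) : Fin d → ℝ :=
  θ + z (selectIdx (fun i => L θ ⬝ᵥ z i < γ₁) (u * mistakes γ₁ z m (L θ) / 2 ^ B) m).2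

lemma den_step (hl : IsLink lnk K e L) (hm : 0 < m) {s : Mem}
    (h : Ready d m B T K e γ₁ z s) {θ : Fin d → ℝ} (hθ : ∀ j : Fin d, s.a 2 j = θ j) :
    Ready d m B T K e γ₁ z (den S b (stepCmd lnk) s) ∧
    (∀ j : Fin d, (den S b (stepCmd lnk) s).a 2 j =
      update γ₁ z m B L θ (readBits (dropBits s.flips b) 0 B) j) ∧
    (den S b (stepCmd lnk) s).flips = s.flips + B ∧
    (mistakes γ₁ z m (L θ) < s.r 12 →
      (den S b (stepCmd lnk) s).r 12 = mistakes γ₁ z m (L θ) ∧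
      ∀ j : Fin d, (den S b (stepCmd lnk) s).a 4 j = L θ j) ∧
    (¬ mistakes γ₁ z m (L θ) < s.r 12 →
      (den S b (stepCmd lnk) s).r 12 = s.r 12 ∧ (den S b (stepCmd lnk) s).a 4 = s.a 4) := by
  set s1 := den S b lnk s with hs1
  set s2 := den S b marginsCmd s1 with hs2
  set s3 := den S b bestCmd s2 with hs3
  set s4 := den S b bitsCmd s3 with hs4
  set s5 := den S b selectCmd s4 with hs5
  have hs6 : den S b (stepCmd lnk) s = den S b updateCmd s5 := rfl
  have wn : ∀ v, v ≠ 19 → v ≠ 20 → v ∉ lnk.wn := fun v h1 h2 h3 => by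
    rcases hl.wn v h3 with h | h <;> contradiction
  have wr : ∀ v < 26, v ∉ lnk.wr := fun v h1 h2 => by have := hl.wr v h2; omega
  have wa : ∀ c ≠ 3, c ∉ lnk.wa := fun c h1 h2 => h1 (hl.wa c h2)
  have r1 : Ready d m B T K e γ₁ z s1 := h.of_frame S b lnk
    (fun v hv => wn v (by rintro rfl; simp at hv) (by rintro rfl; simp at hv))
    (fun v hv => wr v (by simp at hv; omega)) (wa _ (by decide))
  have r2 : Ready d m B T K e γ₁ z s2 := r1.of_frame S b _ (by decide) (by decide) (by decide)
  have r3 : Ready d m B T K e γ₁ z s3 := r2.of_frame S b _ (by decide) (by decide) (by decide)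
  have r4 : Ready d m B T K e γ₁ z s4 := r3.of_frame S b _ (by decide) (by decide) (by decide)
  have r5 : Ready d m B T K e γ₁ z s5 := r4.of_frame S b _ (by decide) (by decide) (by decide)
  have l1 := hl.spec S b s θ h.n0 h.n5 h.r6 h.r17 h.env hθ
  obtain ⟨m1, m2⟩ := den_margins S b r1 l1
  have f3 : s3.flips = s.flips := by
    rw [hs3, den_flips_of_noFlip _ _ _ _ (by decide), hs2, den_flips_of_noFlip _ _ _ _ (by decide),
      hs1, den_flips_of_noFlip _ _ _ _ hl.noFlip]
  obtain ⟨b1, b2⟩ := den_bits S b r3.n4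
  have sel := den_select S b r4 (f := fun i => L θ ⬝ᵥ z i) (by
    rw [hs4, den_a_of_notMem _ _ _ _ (by decide), hs3, den_a_of_notMem _ _ _ _ (by decide)]
    exact m2)
  have m3 : s3.r 11 = mistakes γ₁ z m (L θ) := by
    rw [hs3, den_r_of_notMem _ _ _ _ (by decide)]; exact m1
  have a2 : s5.a 2 = s.a 2 := by
    rw [hs5, den_a_of_notMem _ _ _ _ (by decide), hs4, den_a_of_notMem _ _ _ _ (by decide),
      hs3, den_a_of_notMem _ _ _ _ (by decide), hs2, den_a_of_notMem _ _ _ _ (by decide),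
      hs1, den_a_of_notMem _ _ _ _ (wa _ (by decide))]
  have r12 : (den S b (stepCmd lnk) s).r 12 = s3.r 12 := by
    rw [hs6, den_r_of_notMem _ _ _ _ (by decide), hs5, den_r_of_notMem _ _ _ _ (by decide),
      hs4, den_r_of_notMem _ _ _ _ (by decide)]
  have a4 : (den S b (stepCmd lnk) s).a 4 = s3.a 4 := by
    rw [hs6, den_a_of_notMem _ _ _ _ (by decide), hs5, den_a_of_notMem _ _ _ _ (by decide),
      hs4, den_a_of_notMem _ _ _ _ (by decide)]
  have e2 : s2.r 12 = s.r 12 := by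
    rw [hs2, den_r_of_notMem _ _ _ _ (by decide), hs1, den_r_of_notMem _ _ _ _ (wr _ (by decide))]
  have e4 : s2.a 4 = s.a 4 := by
    rw [hs2, den_a_of_notMem _ _ _ _ (by decide), hs1,
      den_a_of_notMem _ _ _ _ (wa _ (by decide))]
  have e3 : s2.a 3 = s1.a 3 := by rw [hs2, den_a_of_notMem _ _ _ _ (by decide)]
  obtain ⟨c1, c2⟩ := den_best S b s2
  rw [← hs3] at c1 c2
  rw [← hs4, f3] at b1 b2
  rw [← hs5] at sel
  rw [← hs2] at m1
  rw [m1, e2] at c1 c2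
  refine ⟨hs6 ▸ r5.of_frame S b _ (by decide) (by decide) (by decide), fun j => ?_, ?_,
    fun hlt => ?_, fun hlt => ?_⟩
  · rw [hs6, den_update S b s5 j (by rw [r5.n0]; exact j.2), a2, hθ, sel, r5.ex _
      (selectIdx_lt _ _ hm), b1, m3]
    rfl
  · rw [hs6, den_flips_of_noFlip _ _ _ _ (by decide), hs5, den_flips_of_noFlip _ _ _ _ (by decide),
      b2]
  · obtain ⟨c3, c4⟩ := c1 hlt
    rw [r12, a4, c3]
    exact ⟨rfl, fun j => by rw [c4 j (by rw [r2.n0]; exact j.2), e3, l1]⟩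
  · rw [r12, a4, c2 hlt]
    exact ⟨e2, e4⟩

/-- The recorded halfspace makes at most the recorded number of mistakes, and it is zero or the
link of a vector with coordinates at most `T`. -/
def BestOK (γ₁ : ℝ) (z : ℕ → Fin d → ℝ) (m T : ℕ) (L : (Fin d → ℝ) → Fin d → ℝ) (s : Mem) : Prop :=
  ∃ w : Fin d → ℝ, (∀ j : Fin d, s.a 4 j = w j) ∧ mistakes γ₁ z m w ≤ s.r 12 ∧
    (w = 0 ∨ ∃ θ : Fin d → ℝ, (∀ j, |θ j| ≤ T) ∧ w = L θ)

/-- One trial: afterwards the recorded number of mistakes is at most any given threshold unless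
all vectors of the trial exceed it. -/
lemma den_trial (hl : IsLink lnk K e L) (hm : 0 < m) (hz : ∀ i < m, ∀ j, |z i j| ≤ 1) {s : Mem}
    (h : Ready d m B T K e γ₁ z s) (h2 : ∀ j : Fin d, s.a 2 j = 0) (hb : BestOK γ₁ z m T L s) :
    Ready d m B T K e γ₁ z (den S b (loop 9 2 (stepCmd lnk)) s) ∧
    BestOK γ₁ z m T L (den S b (loop 9 2 (stepCmd lnk)) s) ∧
    (den S b (loop 9 2 (stepCmd lnk)) s).r 12 ≤ s.r 12 ∧
    ∀ thr, (den S b (loop 9 2 (stepCmd lnk)) s).r 12 ≤ thr ∨ ∀ A,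
      dropBits (den S b (loop 9 2 (stepCmd lnk)) s).flips b ∈ A →
      dropBits s.flips b ∈ badRun (update γ₁ z m B L) (fun θ => thr < mistakes γ₁ z m (L θ)) B A T
        0 := by
  obtain ⟨t, ⟨h1, h2, h3, θ, h4, h5, h6⟩, h7⟩ := den_loop_ind S b (i := 9) (n := 2) (s := s)
    (A := stepCmd lnk)
    (fun k t => Ready d m B T K e γ₁ z t ∧ BestOK γ₁ z m T L t ∧ t.r 12 ≤ s.r 12 ∧
      ∃ θ : Fin d → ℝ, (∀ j : Fin d, t.a 2 j = θ j) ∧ (∀ j, |θ j| ≤ k) ∧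
      ∀ thr, t.r 12 ≤ thr ∨ ∀ A, dropBits t.flips b ∈ badRun (update γ₁ z m B L)
          (fun θ => thr < mistakes γ₁ z m (L θ)) B A (T - k) θ →
        dropBits s.flips b ∈ badRun (update γ₁ z m B L)
          (fun θ => thr < mistakes γ₁ z m (L θ)) B A T 0)
    ⟨h, hb, le_rfl, 0, by simpa using h2, by simp, fun thr => .inr fun A hA => by simpa using hA⟩
    (by
      rintro k t hk ⟨g1, ⟨w, g2, g3, g4⟩, g5, θ, g6, g7, g8⟩
      rw [h.n2] at hk
      have kT : ∀ j, |θ j| ≤ T := fun j => (g7 j).trans (by exact_mod_cast hk.le)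
      obtain ⟨p1, p2, p3, p4, p5⟩ := den_step S b hl hm (g1.setN k (v := 9) (by decide)) (θ := θ) g6
      set t' := den S b (stepCmd lnk) (t.setN 9 k)
      simp only [Mem.setN_r, Mem.setN_flips, Mem.setN_a] at p2 p3 p4 p5
      refine ⟨p1, ?_, ?_, _, p2, fun j => ?_, fun thr => ?_⟩
      · by_cases hlt : mistakes γ₁ z m (L θ) < t.r 12
        · exact ⟨L θ, (p4 hlt).2, (p4 hlt).1.ge, .inr ⟨θ, kT, rfl⟩⟩
        · exact ⟨w, by rw [(p5 hlt).2]; exact g2, by rw [(p5 hlt).1]; exact g3, g4⟩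
      · by_cases hlt : mistakes γ₁ z m (L θ) < t.r 12
        · rw [(p4 hlt).1]; exact hlt.le.trans g5
        · rw [(p5 hlt).1]; exact g5
      · rw [update, Pi.add_apply]
        push_cast
        exact (abs_add_le _ _).trans (add_le_add (g7 j) (hz _ (selectIdx_lt _ _ hm) j))
      · have hle : t'.r 12 ≤ t.r 12 ∧ t'.r 12 ≤ mistakes γ₁ z m (L θ) := by
          by_cases hlt : mistakes γ₁ z m (L θ) < t.r 12
          · rw [(p4 hlt).1]; exact ⟨hlt.le, le_rfl⟩
          · rw [(p5 hlt).1]; exact ⟨le_rfl, not_lt.1 hlt⟩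
        rcases le_or_gt (t'.r 12) thr with ht | ht
        · exact .inl ht
        rcases g8 thr with h | h
        · exact absurd (hle.1.trans h) (not_le.2 ht)
        refine .inr fun A hA => h A ?_
        rw [show T - k = (T - (k + 1)) + 1 by omega, badRun]
        refine ⟨ht.trans_le hle.2, ?_⟩
        rw [dropBits_dropBits, ← p3]
        exact hA)
  rw [h7]
  rw [h.n2, Nat.sub_self] at h6
  exact ⟨h1.setN _ (by decide), h2, h3, h6⟩

lemma den_trials (hl : IsLink lnk K e L) (hm : 0 < m) (hz : ∀ i < m, ∀ j, |z i j| ≤ 1) {s : Mem}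
    (h : Ready d m B T K e γ₁ z s) (h0 : ∀ j : Fin d, s.a 4 j = 0) (hr : s.r 12 = m)
    (hf : s.flips = 0) :
    BestOK γ₁ z m T L (den S b (trialsCmd lnk) s) ∧
    ∀ thr, (den S b (trialsCmd lnk) s).r 12 ≤ thr ∨
      b ∈ badRuns (update γ₁ z m B L) (fun θ => thr < mistakes γ₁ z m (L θ)) B T 0 (s.n 3) := by
  have hb : BestOK γ₁ z m T L s := by
    refine ⟨0, h0, ?_, .inl rfl⟩
    rw [hr, mistakes, rank]
    exact (Finset.sum_le_card_nsmul _ _ 1 fun i _ => by split <;> simp).trans (by simp)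
  obtain ⟨t, ⟨h1, h2, h3⟩, h4⟩ := den_loop_ind S b (i := 8) (n := 3) (s := s)
    (A := block [loop 11 0 (store 2 11 17), loop 9 2 (stepCmd lnk)])
    (fun k t => Ready d m B T K e γ₁ z t ∧ BestOK γ₁ z m T L t ∧
      ∀ thr, t.r 12 ≤ thr ∨ (dropBits t.flips b ∈ badRuns (update γ₁ z m B L)
          (fun θ => thr < mistakes γ₁ z m (L θ)) B T 0 (s.n 3 - k) →
        b ∈ badRuns (update γ₁ z m B L)
          (fun θ => thr < mistakes γ₁ z m (L θ)) B T 0 (s.n 3)))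
    ⟨h, hb, fun thr => .inr fun hA => by simpa [hf, show dropBits 0 b = b from rfl] using hA⟩ (by
      rintro k t hk ⟨g1, g2, g3⟩
      set t1 := den S b (loop 11 0 (store 2 11 17)) (t.setN 8 k) with ht1
      have hden : den S b (block [loop 11 0 (store 2 11 17), loop 9 2 (stepCmd lnk)]) (t.setN 8 k) =
        den S b (loop 9 2 (stepCmd lnk)) t1 := rfl
      have r0 : Ready d m B T K e γ₁ z (t.setN 8 k) := g1.setN k (by decide)
      have r1 : Ready d m B T K e γ₁ z t1 := r0.of_frame S b _ (by decide) (by decide) (by decide)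
      have z1 : ∀ j : Fin d, t1.a 2 j = 0 := fun j =>
        den_zero S b r0.r17 j (by rw [r0.n0]; exact j.2)
      have a4 : t1.a 4 = t.a 4 := by rw [ht1, den_a_of_notMem _ _ _ _ (by decide)]; rfl
      have r12 : t1.r 12 = t.r 12 := by rw [ht1, den_r_of_notMem _ _ _ _ (by decide)]; rfl
      have fl : t1.flips = t.flips := by rw [ht1, den_flips_of_noFlip _ _ _ _ (by decide)]; rfl
      have b1 : BestOK γ₁ z m T L t1 := by
        obtain ⟨w, q1, q2, q3⟩ := g2
        exact ⟨w, by rw [a4]; exact q1, by rw [r12]; exact q2, q3⟩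
      obtain ⟨p1, p2, p3, p4⟩ := den_trial S b hl hm hz r1 z1 b1
      rw [hden]
      refine ⟨p1, p2, fun thr => ?_⟩
      rcases p4 thr with p4 | p4
      · exact .inl p4
      rcases g3 thr with q | q
      · exact .inl (p3.trans (r12.trans_le q))
      refine .inr fun hA => q ?_
      rw [show s.n 3 - k = (s.n 3 - (k + 1)) + 1 by omega, badRuns, ← fl]
      exact p4 _ hA)
  have : den S b (trialsCmd lnk) s = t.setN 8 (s.n 3) := h4
  rw [this]
  refine ⟨h2, fun thr => (h3 thr).imp id fun h => h ?_⟩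
  rw [Nat.sub_self]; trivial

end Specs
end MarginLearning

/-! ### Programs for the link functions -/

namespace MarginLearning
open RealRAM RealRAM.Cmd

/-- Stores a power of real variable `20` that is at least `20 ^ t` in real variable `28`. -/
def raiseCmd (t : ℕ) : Cmd := block [
  rcopy 28 6,
  rcopy 29 17,
  loop 20 5 (ifLt 29 t (block [rop .mul 28 28 20, rop .add 29 29 6]) skip)]

/-- Stores an approximation of the power `x ^ s` in real variable `28`. -/
def powCmd (x s : ℕ) : Cmd := block [
  rcopy 26 6,
  rcopy 27 17,
  loop 20 5 (ifLt 26 x (block [rop .mul 26 26 20, rop .add 27 27 s]) skip),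
  raiseCmd 27]

/-- Loads a coordinate of the vector in array `2` and stores its absolute value in real variable
`31` and its sign in real variable `37`. -/
def absCmd : Cmd := block [
  load 33 2 19,
  ifLt 33 17 (block [rop .sub 31 17 33, rop .sub 37 17 6]) (block [rcopy 31 33, rcopy 37 6])]

/-- Computes `LpParams.link`. -/
def lpLinkCmd : Cmd := block [
  rop .add 36 24 6,
  powCmd 22 36,
  rcopy 30 28,
  loop 19 0 (block [absCmd, rop .div 31 31 21, powCmd 31 36, rop .add 30 30 28]),
  powCmd 30 25,
  rop .mul 32 23 28,
  loop 19 0 (block [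
    absCmd,
    rop .div 31 31 21,
    ifLt 31 6 (rcopy 28 17) (block [powCmd 31 24, rop .div 28 28 32, rop .mul 28 37 28]),
    store 3 19 28])]

/-- Computes `softLink`. -/
def softLinkCmd : Cmd := block [
  rcopy 30 17,
  loop 19 0 (block [absCmd, raiseCmd 31, rop .div 29 6 28, rop .add 28 28 29, rop .add 30 30 28]),
  loop 19 0 (block [absCmd, raiseCmd 31, rop .div 29 6 28, rop .sub 28 28 29, rop .mul 28 37 28,
    rop .div 28 28 30, store 3 19 28])]

section
variable (S : ℕ → (ℕ → ℝ) × ℝ) (b : ℕ → Bool) {d K : ℕ} {e : ℕ → ℝ} {θ : Fin d → ℝ}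

/-- The memory on which the link programs operate. -/
structure LinkEnv (d K : ℕ) (e : ℕ → ℝ) (θ : Fin d → ℝ) (s : Mem) : Prop where
  n0 : s.n 0 = d
  n5 : s.n 5 = K
  r6 : s.r 6 = 1
  r17 : s.r 17 = 0
  env : ∀ v ∈ [20, 21, 22, 23, 24, 25], s.r v = e v
  arg : ∀ j : Fin d, s.a 2 j = θ j

lemma LinkEnv.of_frame {s : Mem} (h : LinkEnv d K e θ s) (c : Cmd)
    (hn : ∀ v ∈ [0, 5], v ∉ c.wn) (hr : ∀ v ∈ [6, 17, 20, 21, 22, 23, 24, 25], v ∉ c.wr)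
    (ha : 2 ∉ c.wa) : LinkEnv d K e θ (den S b c s) where
  n0 := by rw [den_n_of_notMem S b c s (hn 0 (by simp)), h.n0]
  n5 := by rw [den_n_of_notMem S b c s (hn 5 (by simp)), h.n5]
  r6 := by rw [den_r_of_notMem S b c s (hr 6 (by simp)), h.r6]
  r17 := by rw [den_r_of_notMem S b c s (hr 17 (by simp)), h.r17]
  env v hv := by rw [den_r_of_notMem S b c s (hr v (by simp at hv ⊢; tauto)), h.env v hv]
  arg := by rw [den_a_of_notMem S b c s ha]; exact h.arg

lemma LinkEnv.setN {s : Mem} (h : LinkEnv d K e θ s) (k : ℕ) : LinkEnv d K e θ (s.setN 19 k) :=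
  ⟨by simp [h.n0], by simp [h.n5], h.r6, h.r17, h.env, h.arg⟩

lemma den_raise {s : Mem} (h : LinkEnv d K e θ s) {t : ℕ} (h1 : t ≠ 28) (h2 : t ≠ 29) :
    (den S b (raiseCmd t) s).r 28 = (raise (e 20) (s.r t) K).1 := by
  obtain ⟨u, ⟨g1, _⟩, g3⟩ := den_loop_ind S b (i := 20) (n := 5)
    (s := (s.setR 28 (s.r 6)).setR 29 (s.r 17))
    (A := ifLt 29 t (block [rop .mul 28 28 20, rop .add 29 29 6]) skip)
    (fun k u => u.r 28 = (raise (e 20) (s.r t) k).1 ∧ u.r 29 = (raise (e 20) (s.r t) k).2 ∧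
      u.r t = s.r t ∧ u.r 20 = e 20 ∧ u.r 6 = 1)
    (by simp [raise, iter, h.r6, h.r17, h.env 20, h1, h2]) (by
      rintro k u _ ⟨f1, f2, f3, f4, f5⟩
      rw [raise] at f1 f2 ⊢
      simp only [iter, den, Mem.setN_r, f3]
      rw [← f2]
      by_cases hlt : u.r 29 < s.r t
      · simp [hlt, block, den, ROp.fn, f1, f3, f4, f5, h1, h2]
      · simp only [if_neg hlt]
        exact ⟨f1, f2, f3, f4, f5⟩)
  have : den S b (raiseCmd t) s = u.setN 20 ((s.setR 28 (s.r 6)).setR 29 (s.r 17)|>.n 5) := g3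
  rw [this, Mem.setN_r, g1]
  simp [h.n5]

lemma den_pow {s : Mem} (h : LinkEnv d K e θ s) {x y : ℕ} (h1 : x ≠ 26) (h2 : x ≠ 27)
    (h3 : y ≠ 26) (h4 : y ≠ 27) :
    (den S b (powCmd x y) s).r 28 = powA (e 20) K (s.r x) (s.r y) := by
  set l := loop 20 5 (ifLt 26 x (block [rop .mul 26 26 20, rop .add 27 27 y]) skip) with hl
  have e0 : LinkEnv d K e θ ((s.setR 26 (s.r 6)).setR 27 (s.r 17)) :=
    h.of_frame S b (block [rcopy 26 6, rcopy 27 17]) (by decide) (by decide) (by decide)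
  obtain ⟨u, ⟨_, g1, _⟩, g3⟩ := den_loop_ind S b (i := 20) (n := 5)
    (s := (s.setR 26 (s.r 6)).setR 27 (s.r 17))
    (A := ifLt 26 x (block [rop .mul 26 26 20, rop .add 27 27 y]) skip)
    (fun k u => u.r 26 = (climb (e 20) (s.r x) (s.r y) k).1 ∧
      u.r 27 = (climb (e 20) (s.r x) (s.r y) k).2 ∧
      u.r x = s.r x ∧ u.r y = s.r y ∧ u.r 20 = e 20)
    (by simp [climb, iter, h.r6, h.r17, h.env 20, h1, h2, h3, h4]) (by
      rintro k u _ ⟨f1, f2, f3, f4, f5⟩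
      rw [climb] at f1 f2 ⊢
      simp only [iter, den, Mem.setN_r, f3]
      rw [← f1]
      by_cases hlt : u.r 26 < s.r x
      · simp [hlt, block, den, ROp.fn, f2, f3, f4, f5, h1, h2, h3, h4]
      · simp only [if_neg hlt]
        exact ⟨f1, f2, f3, f4, f5⟩)
  have hden : den S b (powCmd x y) s = den S b (raiseCmd 27)
      (den S b l ((s.setR 26 (s.r 6)).setR 27 (s.r 17))) := rfl
  have e1 : LinkEnv d K e θ (den S b l ((s.setR 26 (s.r 6)).setR 27 (s.r 17))) :=
    e0.of_frame S b l (by simp [hl, Cmd.wn, block]) (by simp [hl, Cmd.wr, block])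
      (by simp [hl, Cmd.wa, block])
  rw [hden, den_raise S b e1 (by decide) (by decide), g3, Mem.setN_r, g1, e0.n5, powA]

lemma den_abs {s : Mem} (h : LinkEnv d K e θ s) {j : Fin d} (hj : s.n 19 = j) :
    (den S b absCmd s).r 31 = |θ j| ∧
      (den S b absCmd s).r 37 = if θ j < 0 then -1 else 1 := by
  simp only [absCmd, block, den, Mem.setR_r, Function.update_self, hj, h.arg j]
  rw [Function.update_of_ne (by decide), h.r17]
  by_cases hlt : θ j < 0
  · simp [hlt, ROp.fn, h.r6, h.r17, abs_of_neg]
  · simp [hlt, h.r6, abs_of_nonneg (not_lt.1 hlt)]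

lemma den_lpLink (P : LpParams) {s : Mem} (h : LinkEnv d P.K e θ s) (hb : e 20 = P.b)
    (hc : e 21 = P.c) (hA : e 22 = P.A) (hρ : e 23 = P.ρ) (hp : e 24 = P.p - 1)
    (hp' : e 25 = 1 - 1 / P.p) (j : Fin d) :
    (den S b lpLinkCmd s).a 3 j = P.link θ j := by
  set s1 := den S b (rop .add 36 24 6) s with hs1
  set s2 := den S b (block [powCmd 22 36, rcopy 30 28]) s1 with hs2
  set l1 := block [absCmd, rop .div 31 31 21, powCmd 31 36, rop .add 30 30 28] with hl1
  set s3 := den S b (loop 19 0 l1) s2 with hs3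
  set s4 := den S b (block [powCmd 30 25, rop .mul 32 23 28]) s3 with hs4
  set l2 := block [
    absCmd,
    rop .div 31 31 21,
    ifLt 31 6 (rcopy 28 17) (block [powCmd 31 24, rop .div 28 28 32, rop .mul 28 37 28]),
    store 3 19 28] with hl2
  have hden : den S b lpLinkCmd s = den S b (loop 19 0 l2) s4 := rfl
  have e1 : LinkEnv d P.K e θ s1 := h.of_frame S b _ (by decide) (by decide) (by decide)
  have e2 : LinkEnv d P.K e θ s2 := e1.of_frame S b _ (by decide) (by decide) (by decide)
  have e3 : LinkEnv d P.K e θ s3 := e2.of_frame S b _ (by decide) (by decide) (by decide)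
  have e4 : LinkEnv d P.K e θ s4 := e3.of_frame S b _ (by decide) (by decide) (by decide)
  have p1 : s1.r 36 = P.p := by simp [hs1, den, ROp.fn, h.env 24, h.r6, hp]
  have p2 : s2.r 36 = P.p := by rw [hs2, den_r_of_notMem _ _ _ _ (by decide), p1]
  have q2 : s2.r 30 = powA P.b P.K P.A P.p := by
    have : s2.r 30 = (den S b (powCmd 22 36) s1).r 28 := by
      change ((den S b (powCmd 22 36) s1).setR 30 _).r 30 = _
      simp
    rw [this, den_pow S b e1 (by decide) (by decide) (by decide) (by decide), p1,
      e1.env 22 (by simp),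
      hb, hA]
  have q3 : s3.r 30 = P.sum θ := by
    obtain ⟨u, ⟨_, _, g1⟩, g2⟩ := den_loop_ind S b (i := 19) (n := 0) (s := s2) (A := l1)
      (fun k u => LinkEnv d P.K e θ u ∧ u.r 36 = P.p ∧ u.r 30 = powA P.b P.K P.A P.p +
        ∑ j ∈ Finset.range k, if h : j < d then powA P.b P.K (|θ ⟨j, h⟩| / P.c) P.p else 0)
      ⟨e2, p2, by simp [q2]⟩ (by
        rintro k u hk ⟨f1, f2, f3⟩
        rw [e2.n0] at hk
        have i0 := f1.setN k
        obtain ⟨a1, a2⟩ := den_abs S b i0 (j := ⟨k, hk⟩) (by simp)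
        set u1 := den S b absCmd (u.setN 19 k) with hu1
        have i1 : LinkEnv d P.K e θ u1 := i0.of_frame S b _ (by decide) (by decide) (by decide)
        set u2 := u1.setR 31 (u1.r 31 / u1.r 21) with hu2
        have i2 : LinkEnv d P.K e θ u2 :=
          i1.of_frame S b (rop .div 31 31 21) (by decide) (by decide) (by decide)
        refine ⟨i0.of_frame S b _ (by decide) (by decide) (by decide), ?_, ?_⟩
        · rw [den_r_of_notMem _ _ _ _ (by decide), Mem.setN_r, f2]
        · have hd : den S b l1 (u.setN 19 k) =
            den S b (rop .add 30 30 28) (den S b (powCmd 31 36) u2) := rfl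
          have h36 : u2.r 36 = P.p := by
            rw [hu2, hu1, Mem.setR_r, Function.update_of_ne (by decide),
              den_r_of_notMem _ _ _ _ (by decide), Mem.setN_r, f2]
          have h31 : u2.r 31 = |θ ⟨k, hk⟩| / P.c := by
            rw [hu2, Mem.setR_r, Function.update_self, a1, i1.env 21 (by simp), hc]
          have h30 : (den S b (powCmd 31 36) u2).r 30 = u.r 30 := by
            rw [den_r_of_notMem _ _ _ _ (by decide), hu2, hu1, Mem.setR_r,
              Function.update_of_ne (by decide), den_r_of_notMem _ _ _ _ (by decide), Mem.setN_r]
          rw [hd, den, Mem.setR_r, Function.update_self, ROp.fn, h30,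
            den_pow S b i2 (by decide) (by decide) (by decide) (by decide), h31, h36, f3, hb,
            Finset.sum_range_succ, dif_pos hk]
          exact add_assoc _ _ _)
    rw [hs3, g2, Mem.setN_r, g1, e2.n0, Finset.sum_range, LpParams.sum]
    simp
  have q4 : s4.r 32 = P.ρ * powA P.b P.K (P.sum θ) (1 - 1 / P.p) := by
    have i3 : LinkEnv d P.K e θ (den S b (powCmd 30 25) s3) :=
      e3.of_frame S b _ (by decide) (by decide) (by decide)
    have : s4.r 32 = (den S b (powCmd 30 25) s3).r 23 * (den S b (powCmd 30 25) s3).r 28 := by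
      change ((den S b (powCmd 30 25) s3).setR 32 _).r 32 = _
      simp [ROp.fn]
    rw [this, den_pow S b e3 (by decide) (by decide) (by decide) (by decide), i3.env 23 (by simp),
      e3.env 25 (by simp), q3, hb, hρ, hp']
  obtain ⟨u, ⟨_, _, g1⟩, g2⟩ := den_loop_ind S b (i := 19) (n := 0) (s := s4) (A := l2)
    (fun k u => LinkEnv d P.K e θ u ∧ u.r 32 = P.ρ * powA P.b P.K (P.sum θ) (1 - 1 / P.p) ∧
      ∀ j : Fin d, (j : ℕ) < k → u.a 3 j = P.link θ j) ⟨e4, q4, by simp⟩ (by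
      rintro k u hk ⟨f1, f2, f3⟩
      rw [e4.n0] at hk
      have i0 := f1.setN k
      obtain ⟨a1, a2⟩ := den_abs S b i0 (j := ⟨k, hk⟩) (by simp)
      set u1 := den S b absCmd (u.setN 19 k) with hu1
      have i1 : LinkEnv d P.K e θ u1 := i0.of_frame S b _ (by decide) (by decide) (by decide)
      set u2 := u1.setR 31 (u1.r 31 / u1.r 21) with hu2
      have i2 : LinkEnv d P.K e θ u2 :=
        i1.of_frame S b (rop .div 31 31 21) (by decide) (by decide) (by decide)
      have h31 : u2.r 31 = |θ ⟨k, hk⟩| / P.c := by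
        rw [hu2, Mem.setR_r, Function.update_self, a1, i1.env 21 (by simp), hc]
      set c3 := ifLt 31 6 (rcopy 28 17) (block [powCmd 31 24, rop .div 28 28 32, rop .mul 28 37 28])
        with hc3
      set u3 := den S b c3 u2 with hu3
      have hd : den S b l2 (u.setN 19 k) = u3.setA 3 (u3.n 19) (u3.r 28) := rfl
      have h19 : u3.n 19 = k := by
        rw [hu3, den_n_of_notMem _ _ _ _ (by decide), hu2, hu1, Mem.setR_n,
          den_n_of_notMem _ _ _ _ (by decide), Mem.setN_n, Function.update_self]
      have h3 : u3.a = u.a := by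
        funext c
        rw [hu3, den_a_of_notMem _ _ _ _ (by simp [hc3, wa, block, powCmd, raiseCmd]), hu2, hu1,
          Mem.setR_a, den_a_of_notMem _ _ _ _ (by simp [absCmd, wa, block]), Mem.setN_a]
      have h28 : u3.r 28 = P.link θ ⟨k, hk⟩ := by
        rw [hu3, hc3, den, LpParams.link, h31, i2.r6]
        by_cases hlt : |θ ⟨k, hk⟩| / P.c < 1
        · rw [if_pos hlt, if_pos hlt, den, Mem.setR_r, Function.update_self, i2.r17]
        · rw [if_neg hlt, if_neg hlt]
          set u4 := den S b (powCmd 31 24) u2 with hu4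
          have : (den S b (block [powCmd 31 24, rop .div 28 28 32, rop .mul 28 37 28]) u2).r 28 =
              u4.r 37 * (u4.r 28 / u4.r 32) := by
            have aux : ∀ v : Mem, (den S b (block [rop .div 28 28 32, rop .mul 28 37 28]) v).r 28 =
                v.r 37 * (v.r 28 / v.r 32) := fun v => by simp [block, den, ROp.fn]
            exact aux u4
          rw [this, den_pow S b i2 (by decide) (by decide) (by decide) (by decide), h31,
            i2.env 24 (by simp), hp, hb, hu4, den_r_of_notMem _ _ _ _ (by decide),
            den_r_of_notMem _ _ _ _ (by decide), hu2, Mem.setR_r,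
            Function.update_of_ne (by decide), Function.update_of_ne (by decide), a2, hu1,
            den_r_of_notMem _ _ _ _ (by decide), Mem.setN_r, f2]
      refine ⟨i0.of_frame S b _ (by decide) (by decide) (by decide), ?_, fun j hj => ?_⟩
      · rw [den_r_of_notMem _ _ _ _ (by decide), Mem.setN_r, f2]
      · rw [hd, h19, h28, Mem.setA_a, Function.update_self, h3]
        rcases Nat.lt_succ_iff_lt_or_eq.1 hj with hj | hj
        · rw [Function.update_of_ne hj.ne, f3 j hj]
        · rw [hj, Function.update_self]
          congr 1; ext; exact hj.symm)
  rw [hden, g2, Mem.setN_a]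
  exact g1 j (by rw [e4.n0]; exact j.2)

lemma den_softLink {s : Mem} (h : LinkEnv d K e θ s) (j : Fin d) :
    (den S b softLinkCmd s).a 3 j = softLink (e 20) K θ j := by
  set l1 := block [absCmd, raiseCmd 31, rop .div 29 6 28, rop .add 28 28 29, rop .add 30 30 28]
    with hl1
  set s2 := s.setR 30 (s.r 17) with hs2
  set s4 := den S b (loop 19 0 l1) s2 with hs4
  set l2 := block [absCmd, raiseCmd 31, rop .div 29 6 28, rop .sub 28 28 29, rop .mul 28 37 28,
    rop .div 28 28 30, store 3 19 28] with hl2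
  have hden : den S b softLinkCmd s = den S b (loop 19 0 l2) s4 := rfl
  have e2 : LinkEnv d K e θ s2 := h.of_frame S b (rcopy 30 17) (by decide) (by decide) (by decide)
  have e4 : LinkEnv d K e θ s4 := e2.of_frame S b _ (by decide) (by decide) (by decide)
  have q4 : s4.r 30 = ∑ i, ((raise (e 20) |θ i| K).1 + 1 / (raise (e 20) |θ i| K).1) := by
    obtain ⟨u, ⟨_, g1⟩, g2⟩ := den_loop_ind S b (i := 19) (n := 0) (s := s2) (A := l1)
      (fun k u => LinkEnv d K e θ u ∧ u.r 30 = ∑ j ∈ Finset.range k, if h : j < d then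
        ((raise (e 20) |θ ⟨j, h⟩| K).1 + 1 / (raise (e 20) |θ ⟨j, h⟩| K).1) else 0)
      ⟨e2, by simp [hs2, h.r17]⟩ (by
        rintro k u hk ⟨f1, f3⟩
        rw [e2.n0] at hk
        have i0 := f1.setN k
        obtain ⟨a1, a2⟩ := den_abs S b i0 (j := ⟨k, hk⟩) (by simp)
        set u1 := den S b absCmd (u.setN 19 k) with hu1
        have i1 : LinkEnv d K e θ u1 := i0.of_frame S b _ (by decide) (by decide) (by decide)
        set u2 := den S b (raiseCmd 31) u1 with hu2
        have i2 : LinkEnv d K e θ u2 := i1.of_frame S b _ (by decide) (by decide) (by decide)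
        have hd : (den S b l1 (u.setN 19 k)).r 30 = u2.r 30 + (u2.r 28 + u2.r 6 / u2.r 28) := by
          have aux : ∀ v : Mem, (den S b (block [rop .div 29 6 28, rop .add 28 28 29,
              rop .add 30 30 28]) v).r 30 = v.r 30 + (v.r 28 + v.r 6 / v.r 28) :=
            fun v => by simp [block, den, ROp.fn]
          exact aux u2
        refine ⟨i0.of_frame S b _ (by decide) (by decide) (by decide), ?_⟩
        rw [hd, hu2, den_raise S b i1 (by decide) (by decide), ← hu2, i2.r6, a1, hu2,
          den_r_of_notMem _ _ _ _ (by decide), hu1, den_r_of_notMem _ _ _ _ (by decide), Mem.setN_r,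
          f3, Finset.sum_range_succ, dif_pos hk])
    rw [hs4, g2, Mem.setN_r, g1, e2.n0, Finset.sum_range]
    simp
  obtain ⟨u, ⟨_, _, g1⟩, g2⟩ := den_loop_ind S b (i := 19) (n := 0) (s := s4) (A := l2)
    (fun k u => LinkEnv d K e θ u ∧
      u.r 30 = ∑ i, ((raise (e 20) |θ i| K).1 + 1 / (raise (e 20) |θ i| K).1) ∧
      ∀ j : Fin d, (j : ℕ) < k → u.a 3 j = softLink (e 20) K θ j) ⟨e4, q4, by simp⟩ (by
      rintro k u hk ⟨f1, f2, f3⟩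
      rw [e4.n0] at hk
      have i0 := f1.setN k
      obtain ⟨a1, a2⟩ := den_abs S b i0 (j := ⟨k, hk⟩) (by simp)
      set u1 := den S b absCmd (u.setN 19 k) with hu1
      have i1 : LinkEnv d K e θ u1 := i0.of_frame S b _ (by decide) (by decide) (by decide)
      set u2 := den S b (raiseCmd 31) u1 with hu2
      have i2 : LinkEnv d K e θ u2 := i1.of_frame S b _ (by decide) (by decide) (by decide)
      have h19 : u2.n 19 = k := by
        rw [hu2, den_n_of_notMem _ _ _ _ (by decide), hu1,
          den_n_of_notMem _ _ _ _ (by decide), Mem.setN_n, Function.update_self]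
      have h3 : u2.a = u.a := by
        funext c
        rw [hu2, den_a_of_notMem _ _ _ _ (by simp [wa, block, raiseCmd]), hu1,
          den_a_of_notMem _ _ _ _ (by simp [absCmd, wa, block]), Mem.setN_a]
      have hd : (den S b l2 (u.setN 19 k)).a 3 = Function.update (u2.a 3) (u2.n 19)
          (u2.r 37 * (u2.r 28 - u2.r 6 / u2.r 28) / u2.r 30) := by
        have aux : ∀ v : Mem, (den S b (block [rop .div 29 6 28, rop .sub 28 28 29,
            rop .mul 28 37 28, rop .div 28 28 30, store 3 19 28]) v).a 3 =
            Function.update (v.a 3) (v.n 19)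
              (v.r 37 * (v.r 28 - v.r 6 / v.r 28) / v.r 30) :=
          fun v => by simp [block, den, ROp.fn]
        exact aux u2
      refine ⟨i0.of_frame S b _ (by decide) (by decide) (by decide), ?_, fun j hj => ?_⟩
      · rw [den_r_of_notMem _ _ _ _ (by decide), Mem.setN_r, f2]
      · have h37 : u2.r 37 = if θ ⟨k, hk⟩ < 0 then -1 else 1 := by
          rw [hu2, den_r_of_notMem _ _ _ _ (by decide), a2]
        have h30 : u2.r 30 = u.r 30 := by
          rw [hu2, den_r_of_notMem _ _ _ _ (by decide), hu1, den_r_of_notMem _ _ _ _ (by decide),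
            Mem.setN_r]
        have h28 : u2.r 28 = (raise (e 20) |θ ⟨k, hk⟩| K).1 := by
          rw [hu2, den_raise S b i1 (by decide) (by decide), a1]
        rw [hd, h19, h37, h30, h28, h3, i2.r6, f2]
        rcases Nat.lt_succ_iff_lt_or_eq.1 hj with hj | hj
        · rw [Function.update_of_ne hj.ne, f3 j hj]
        · have : j = ⟨k, hk⟩ := by ext; exact hj
          rw [hj, Function.update_self, softLink, this])
  rw [hden, g2, Mem.setN_a]
  exact g1 j (by rw [e4.n0]; exact j.2)

lemma isLink_lp (P : LpParams) (hb : e 20 = P.b) (hc : e 21 = P.c) (hA : e 22 = P.A)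
    (hρ : e 23 = P.ρ) (hp : e 24 = P.p - 1) (hp' : e 25 = 1 - 1 / P.p) :
    IsLink lpLinkCmd P.K e (P.link : (Fin d → ℝ) → Fin d → ℝ) where
  wn := by decide
  wr := by decide
  wa := by decide
  noFlip := by decide
  spec S b _ _ h0 h5 h6 h17 he ha :=
    den_lpLink S b P ⟨h0, h5, h6, h17, he, ha⟩ hb hc hA hρ hp hp'

lemma isLink_soft (K : ℕ) (e : ℕ → ℝ) :
    IsLink softLinkCmd K e (softLink (e 20) K : (Fin d → ℝ) → Fin d → ℝ) where
  wn := by decide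
  wr := by decide
  wa := by decide
  noFlip := by decide
  spec S b _ _ h0 h5 h6 h17 he ha := den_softLink S b ⟨h0, h5, h6, h17, he, ha⟩

end
end MarginLearning

/-! ### Probability of success of the trials -/

namespace MarginLearning
open RealRAM RealRAM.Cmd

variable {d : ℕ}

/-- A potential function for the update rule with link `L`: a function `g` that dominates the
functionals in `W` and grows in a step `x ∈ X` at most by `L θ ⬝ᵥ x + κ`, as long as the
coordinates of `θ` are at most `T`. -/
structure StepPotential (W X : Set (Fin d → ℝ)) (L : (Fin d → ℝ) → Fin d → ℝ) (T : ℕ) (κ g₀ : ℝ)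
    (g : (Fin d → ℝ) → ℝ) : Prop where
  zero : g 0 ≤ g₀
  dual : ∀ w ∈ W, ∀ θ, w ⬝ᵥ θ ≤ g θ
  step : ∀ θ : Fin d → ℝ, (∀ j, |θ j| ≤ T) → ∀ x ∈ X, g (θ + x) ≤ g θ + L θ ⬝ᵥ x + κ
  mem : ∀ θ : Fin d → ℝ, (∀ j, |θ j| ≤ T) → L θ ∈ W

lemma rank_eq_card (mk : ℕ → Prop) [DecidablePred mk] (m : ℕ) :
    rank mk m = ((Finset.range m).filter mk).card := by
  rw [rank, Finset.card_filter, Nat.cast_sum]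
  refine Finset.sum_congr rfl fun i _ => ?_
  split_ifs <;> simp

lemma rank_nonneg (mk : ℕ → Prop) (m : ℕ) : 0 ≤ rank mk m := by
  classical
  rw [rank_eq_card]; positivity

lemma rank_le (mk : ℕ → Prop) (m : ℕ) : rank mk m ≤ m := by
  classical
  rw [rank_eq_card]
  exact_mod_cast (Finset.card_filter_le _ _).trans (by simp)

/-- Each mistake is selected by a proportion about `1 / M` of the random numbers below `N`. -/
lemma card_select_ge (mk : ℕ → Prop) {m i N : ℕ} (him : i < m) (hi : mk i) (hN : 2 * m ≤ N) :
    (N : ℝ) / (2 * rank mk m) ≤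
      ((Finset.range N).filter fun u : ℕ =>
        (selectIdx mk (u * rank mk m / N) m).2 = i).card := by
  set M := rank mk m with hM
  set ρ := rank mk i with hρ
  have hρ0 : 0 ≤ ρ := rank_nonneg mk i
  have h1 : ρ + 1 ≤ M := by rw [hρ, ← rank_succ mk hi]; exact rank_mono mk him
  have hM0 : 0 < M := by linarith
  have hMm : M ≤ m := rank_le mk m
  have hN' : (2 : ℝ) * m ≤ N := by exact_mod_cast hN
  have hN0 : (0 : ℝ) < N := by linarith
  have hsub : Finset.Ico ⌈ρ * N / M⌉₊ ⌈(ρ + 1) * N / M⌉₊ ⊆ (Finset.range N).filter fun u : ℕ =>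
        (selectIdx mk (u * M / N) m).2 = i := by
    intro u hu
    rw [Finset.mem_Ico, Nat.ceil_le, Nat.lt_ceil, div_le_iff₀ hM0, lt_div_iff₀ hM0] at hu
    rw [Finset.mem_filter, Finset.mem_range]
    constructor
    · have : (u : ℝ) * M < M * N := hu.2.trans_le (by gcongr)
      rw [mul_comm M] at this
      exact_mod_cast lt_of_mul_lt_mul_right this hM0.le
    · refine selectIdx_eq mk him hi ?_ ?_
      · rw [le_div_iff₀ hN0]; exact hu.1
      · rw [div_lt_iff₀ hN0]; exact hu.2
  refine le_trans ?_ (Nat.cast_le.2 (Finset.card_le_card hsub))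
  rw [Nat.card_Ico]
  have h2 : ⌈ρ * N / M⌉₊ ≤ ⌈(ρ + 1) * N / M⌉₊ := Nat.ceil_mono (by gcongr; linarith)
  rw [Nat.cast_sub h2]
  have h3 := Nat.le_ceil ((ρ + 1) * N / M)
  have h4 := (Nat.ceil_lt_add_one (a := ρ * N / M) (by positivity)).le
  have h5 : (ρ + 1) * N / M = ρ * N / M + N / M := by ring
  have h6 : (N : ℝ) / M = 2 * (N / (2 * M)) := by field_simp
  have h7 : 1 ≤ (N : ℝ) / (2 * M) := by rw [le_div_iff₀ (by positivity)]; linarith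
  linarith

/-- If the number of mistakes is larger than `1 + δ` times the number of examples without the
margin `γ` for `w`, then the selected mistake has margin `γ` for `w` with probability at least
`δ / 4`. -/
lemma card_good_ge (mk bad : ℕ → Prop) {m N : ℕ} {δ : ℝ} (hδ : 0 < δ) (hδ1 : δ ≤ 1)
    (hN : 2 * m ≤ N) (h : (1 + δ) * rank bad m < rank mk m) :
    ∃ G ⊆ Finset.range N, δ / 4 * N ≤ G.card ∧ ∀ u ∈ G,
      (selectIdx mk (u * rank mk m / N) m).2 < m ∧ mk (selectIdx mk (u * rank mk m / N) m).2 ∧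
        ¬ bad (selectIdx mk (u * rank mk m / N) m).2 := by
  classical
  set M := rank mk m with hM
  have hb0 : 0 ≤ rank bad m := rank_nonneg bad m
  have hM0 : 0 < M := lt_of_le_of_lt (by positivity) h
  set I := (Finset.range m).filter fun i => mk i ∧ ¬ bad i with hI
  refine ⟨(Finset.range N).filter fun u : ℕ => (selectIdx mk (u * M / N) m).2 ∈ I,
    Finset.filter_subset _ _, ?_, fun u hu => ?_⟩
  swap
  · have := (Finset.mem_filter.1 hu).2
    simpa [hI] using this
  have hcard : M - rank bad m ≤ I.card := by
    have h1 : (Finset.range m).filter mk ⊆ I ∪ (Finset.range m).filter bad := by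
      intro i hi
      simp only [hI, Finset.mem_union, Finset.mem_filter] at hi ⊢
      tauto
    have h2 := (Finset.card_le_card h1).trans (Finset.card_union_le _ _)
    rw [hM, rank_eq_card, rank_eq_card, sub_le_iff_le_add]
    exact_mod_cast h2
  have hsum : (((Finset.range N).filter fun u : ℕ => (selectIdx mk (u * M / N) m).2 ∈ I).card : ℝ) =
      ∑ i ∈ I, (((Finset.range N).filter fun u : ℕ =>
        (selectIdx mk (u * M / N) m).2 = i).card : ℝ) := by
    rw [Finset.card_eq_sum_card_fiberwise
      (f := fun u : ℕ => (selectIdx mk (u * M / N) m).2) (t := I)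
      (fun u hu => by simpa using (Finset.mem_filter.1 hu).2), Nat.cast_sum]
    refine Finset.sum_congr rfl fun i hi => ?_
    congr 2
    ext u
    simp only [Finset.mem_filter]
    constructor
    · rintro ⟨⟨a, _⟩, b⟩; exact ⟨a, b⟩
    · rintro ⟨a, b⟩; exact ⟨⟨a, b ▸ hi⟩, b⟩
  rw [hsum]
  calc δ / 4 * N ≤ (M - rank bad m) * (N / (2 * M)) := by
        have h1 : rank bad m ≤ (1 - δ / 2) * M := by
          have : (1 + δ) * rank bad m ≤ (1 + δ) * ((1 - δ / 2) * M) := by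
            have e : (1 + δ) * ((1 - δ / 2) * M) = M + δ / 2 * (1 - δ) * M := by ring
            have : 0 ≤ δ / 2 * (1 - δ) * M :=
              mul_nonneg (mul_nonneg (by positivity) (by linarith)) hM0.le
            linarith
          exact le_of_mul_le_mul_left this (by linarith)
        calc δ / 4 * N = δ / 2 * M * (N / (2 * M)) := by field_simp; ring
          _ ≤ _ := by gcongr; linarith
    _ ≤ I.card * (N / (2 * M)) := by gcongr
    _ = ∑ i ∈ I, (N : ℝ) / (2 * M) := by rw [Finset.sum_const, nsmul_eq_mul]
    _ ≤ _ := Finset.sum_le_sum fun i hi => by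
        simp only [hI, Finset.mem_filter, Finset.mem_range] at hi
        exact card_select_ge mk hi.1 hi.2.1 hN

/-- The probability that in none of the `R` trials a halfspace makes at most `1 + δ` times as many
mistakes at margin `γ₁` as `w` makes at margin `γ`. -/
theorem coinMeasure_fail_le {W X : Set (Fin d → ℝ)} {L : (Fin d → ℝ) → Fin d → ℝ} {T : ℕ}
    {κ g₀ γ γ₁ δ : ℝ} {g : (Fin d → ℝ) → ℝ} (hg : StepPotential W X L T κ g₀ g)
    (hX : ∀ x ∈ X, ∀ j, |x j| ≤ 1) {z : ℕ → Fin d → ℝ} (hz : ∀ i, z i ∈ X) {m B : ℕ}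
    (hB : 2 * m ≤ 2 ^ B) (hδ : 0 < δ) (hδ1 : δ ≤ 1) {w : Fin d → ℝ} (hw : w ∈ W)
    (hT : g₀ + T * (γ₁ + κ) < T * γ) (R : ℕ) :
    coinMeasure.real (badRuns (update γ₁ z m B L)
      (fun θ => (1 + δ) * mistakes γ z m w < mistakes γ₁ z m (L θ)) B T 0 R) ≤
      (1 - (δ / 4) ^ T) ^ R := by
  have hfin : ∀ θ : Fin d → ℝ, ¬ (T ≤ T ∧ g θ ≤ g₀ + T * (γ₁ + κ) ∧ T * γ ≤ w ⬝ᵥ θ ∧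
      ∀ j, |θ j| ≤ T) := by
    rintro θ ⟨_, h1, h2, _⟩
    linarith [hg.dual w hw θ]
  refine coinMeasure_badRuns_le (by positivity) (by linarith)
    (fun k θ => k ≤ T ∧ g θ ≤ g₀ + k * (γ₁ + κ) ∧ k * γ ≤ w ⬝ᵥ θ ∧ ∀ j, |θ j| ≤ k) hfin
    ⟨Nat.zero_le _, by simpa using hg.zero, by simp, by simp⟩ ?_ R
  rintro k θ ⟨hk, h1, h2, h3⟩ hbad
  have hkT : k < T := by
    rcases hk.lt_or_eq with h | rfl
    · exact h
    · exact absurd ⟨hk, h1, h2, h3⟩ (hfin θ)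
  obtain ⟨G, hG, hG1, hG2⟩ := card_good_ge (fun i => L θ ⬝ᵥ z i < γ₁) (fun i => w ⬝ᵥ z i < γ) hδ hδ1
    hB hbad
  refine ⟨G, hG, by exact_mod_cast hG1, fun u hu => ?_⟩
  obtain ⟨-, g2, g3⟩ := hG2 u hu
  push_cast at g2 g3
  have hup : update γ₁ z m B L θ u = θ + z (selectIdx (fun i => L θ ⬝ᵥ z i < γ₁)
    (u * rank (fun i => L θ ⬝ᵥ z i < γ₁) m / 2 ^ B) m).2 := rfl
  set i := (selectIdx (fun i => L θ ⬝ᵥ z i < γ₁)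
    (u * rank (fun i => L θ ⬝ᵥ z i < γ₁) m / 2 ^ B) m).2
  rw [hup]
  push_cast
  refine ⟨hkT, ?_, ?_, fun j => ?_⟩
  · have := hg.step θ (fun j => (h3 j).trans (by exact_mod_cast hk)) (z i) (hz i)
    linarith
  · rw [dotProduct_add]; linarith [not_lt.1 g3]
  · exact (abs_add_le _ _).trans (add_le_add (h3 j) (hX _ (hz i) j))

end MarginLearning

/-! ### Generalization and the probability of success -/

namespace MarginLearning
open RealRAM RealRAM.Cmd

variable {p : ℝ≥0∞} {d : ℕ}

/-- The product of the point and the label of an example. -/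
def signed (z : Example p d) : Fin d → ℝ := z.2.1 • z.1.1

lemma zero_mem_lpBall [Fact (1 ≤ p)] : (0 : Fin d → ℝ) ∈ lpBall p d := by
  simp [lpBall]

lemma neg_mem_lpBall [Fact (1 ≤ p)] {x : Fin d → ℝ} (hx : x ∈ lpBall p d) : -x ∈ lpBall p d := by
  simpa [lpBall] using hx

lemma signed_mem_lpBall [Fact (1 ≤ p)] (z : Example p d) : signed z ∈ lpBall p d := by
  obtain ⟨⟨x, hx⟩, ⟨y, hy⟩⟩ := z
  rcases hy with rfl | rfl
  · simpa [signed] using hx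
  · simpa [signed] using neg_mem_lpBall hx

lemma abs_le_of_mem_lpBall [Fact (1 ≤ p)] {x : Fin d → ℝ} (hx : x ∈ lpBall p d) (j : Fin d) :
    |x j| ≤ 1 :=
  (PiLp.norm_apply_le (WithLp.toLp p x) j).trans hx

lemma measurable_signed : Measurable (signed : Example p d → Fin d → ℝ) :=
  (measurable_subtype_coe.comp measurable_snd).smul (measurable_subtype_coe.comp measurable_fst)

lemma measurable_dotProduct_signed (w : Fin d → ℝ) :
    Measurable fun z : Example p d => w ⬝ᵥ signed z := by
  simp only [dotProduct]
  exact Finset.measurable_sum _ fun j _ =>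
    ((measurable_pi_apply j).comp measurable_signed).const_mul _

lemma err_le_measure (D : Measure (Example p d)) [IsProbabilityMeasure D] (γ : ℝ) (w : Fin d → ℝ) :
    err D γ w ≤ D.real {z | w ⬝ᵥ signed z ≤ γ} := by
  refine measureReal_mono ?_
  rintro ⟨⟨x, hx⟩, ⟨y, hy⟩⟩ h
  simp only [Set.mem_ofPred_eq, signed, dotProduct_smul, smul_eq_mul, sgn] at h ⊢
  rcases hy with rfl | rfl
  · split_ifs at h with h0
    · exact absurd rfl h
    · linarith
  · split_ifs at h with h0
    · linarith
    · exact absurd rfl h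

lemma measure_le_err (D : Measure (Example p d)) [IsProbabilityMeasure D] (γ : ℝ) (w : Fin d → ℝ) :
    D.real {z | w ⬝ᵥ signed z < γ} ≤ err D γ w := by
  refine measureReal_mono ?_
  rintro ⟨⟨x, hx⟩, ⟨y, hy⟩⟩ h
  simp only [Set.mem_ofPred_eq, signed, dotProduct_smul, smul_eq_mul, sgn] at h ⊢
  rcases hy with rfl | rfl
  · rw [if_neg (by linarith)]; norm_num
  · rw [if_pos (by linarith)]; norm_num

lemma mistakes_eq (γ₁ : ℝ) (S : ℕ → Example p d) (m : ℕ) (w : Fin d → ℝ) :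
    mistakes γ₁ (fun i => signed (S i)) m w =
      ∑ k ∈ Finset.range m, if w ⬝ᵥ signed (S k) < γ₁ then (1 : ℝ) else 0 := by
  rw [mistakes, rank]

lemma measurable_mistakes (γ₁ : ℝ) (m : ℕ) (w : Fin d → ℝ) :
    Measurable fun S : ℕ → Example p d => mistakes γ₁ (fun i => signed (S i)) m w := by
  simp only [mistakes_eq]
  exact Finset.measurable_sum _ fun k _ => Measurable.ite
    (measurableSet_lt ((measurable_dotProduct_signed w).comp (measurable_pi_apply k))
      measurable_const) measurable_const measurable_const

/-- Success of the trials on a sample of the stated size.  The potentials in `hpot` give the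
uniform convergence of the margin errors, the potential `g` gives the success of a trial. -/
theorem measure_fail_le [Fact (1 ≤ p)] [Fact (1 ≤ p.conjExponent)] {γ ν δ ε H : ℝ} (hγ : 0 < γ)
    (hν : 0 < ν) (hν1 : ν < 1) (hγ1 : γ < 1) (hδ : 0 < δ) (hδ1 : δ < 1) (hε : 0 < ε) (hε1 : ε < 1)
    (hH : 1 ≤ H)
    (hdual : ∀ w ∈ lpBall p.conjExponent d, ∀ x ∈ lpBall p d, |w ⬝ᵥ x| ≤ 1)
    (hpot : ∀ κ : ℝ, 0 < κ → κ ≤ 1 → ∃ g : (Fin d → ℝ) → ℝ, g 0 ≤ H / κ ∧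
      (∀ w ∈ lpBall p.conjExponent d, ∀ θ, w ⬝ᵥ θ ≤ g θ) ∧
      ∀ θ, ∀ x ∈ lpBall p d, 2⁻¹ * (g (θ + x) + g (θ - x)) ≤ g θ + κ)
    {m T B R : ℕ} (hm : 57600 * (H / (ε ^ 2 * ν ^ 2 * γ ^ 2)) ≤ m) (hB : 2 * m ≤ 2 ^ B)
    (hR : 3 ≤ R * (δ / 4) ^ T)
    {L : (Fin d → ℝ) → Fin d → ℝ} {g : (Fin d → ℝ) → ℝ} {κ g₀ : ℝ}
    (hg : StepPotential (lpBall p.conjExponent d) (lpBall p d) L T κ g₀ g)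
    (hT : g₀ + T * ((1 - ν / 2) * γ + κ) < T * γ)
    (D : Measure (Example p d)) [IsProbabilityMeasure D]
    {best : (ℕ → Example p d) × (ℕ → Bool) → ℝ} (hbest : Measurable best)
    {out : (ℕ → Example p d) × (ℕ → Bool) → Fin d → ℝ}
    (hout : ∀ ω, out ω ∈ lpBall p.conjExponent d)
    (hmis : ∀ ω, mistakes ((1 - ν / 2) * γ) (fun i => signed (ω.1 i)) m (out ω) ≤ best ω)
    (hfail : ∀ ω thr, best ω ≤ thr ∨
      ω.2 ∈ badRuns (update ((1 - ν / 2) * γ) (fun i => signed (ω.1 i)) m B L)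
        (fun θ => thr < mistakes ((1 - ν / 2) * γ) (fun i => signed (ω.1 i)) m (L θ)) B T 0 R) :
    ((Measure.infinitePi fun _ : ℕ => D).prod coinMeasure)
      {ω | ¬ err D ((1 - ν) * γ) (out ω) ≤ (1 + δ) * opt D γ + ε} ≤ ENNReal.ofReal (1 / 3) := by
  set γ₁ := (1 - ν / 2) * γ with hγ₁
  set π := Measure.infinitePi fun _ : ℕ => D with hπ
  have hden : 0 < ε ^ 2 * ν ^ 2 * γ ^ 2 := by positivity
  have hden1 : ε ^ 2 * ν ^ 2 * γ ^ 2 ≤ ε ^ 2 := by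
    have : ν ^ 2 * γ ^ 2 ≤ 1 := by
      rw [← mul_pow]; exact pow_le_one₀ (by positivity) (mul_le_one₀ hν1.le hγ.le hγ1.le)
    calc ε ^ 2 * ν ^ 2 * γ ^ 2 = ε ^ 2 * (ν ^ 2 * γ ^ 2) := by ring
      _ ≤ ε ^ 2 * 1 := by gcongr
      _ = _ := mul_one _
  have hmε : 57600 * (H / ε ^ 2) ≤ m := le_trans (by gcongr) hm
  have hmH : 57600 * H ≤ m := le_trans (by
    gcongr; rw [le_div_iff₀ (by positivity)]
    have : ε ^ 2 ≤ 1 := pow_le_one₀ hε.le hε1.le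
    nlinarith) hmε
  have hm0 : (0 : ℝ) < m := by linarith
  have hm0' : 0 < m := Nat.cast_pos.1 hm0
  -- a nearly optimal halfspace
  obtain ⟨w, hw, hwopt⟩ : ∃ w ∈ lpBall p.conjExponent d, err D γ w < opt D γ + ε / 20 := by
    have : Nonempty ↥(lpBall p.conjExponent d) := ⟨⟨0, zero_mem_lpBall⟩⟩
    obtain ⟨w, hw⟩ := exists_lt_of_ciInf_lt (show (⨅ w : ↥(lpBall p.conjExponent d), err D γ w.1) <
      opt D γ + ε / 20 from lt_add_of_pos_right _ (by positivity))
    exact ⟨w.1, w.2, hw⟩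
  -- its empirical error
  set E₁ : Set (ℕ → Example p d) :=
    {S | D.real {z | w ⬝ᵥ signed z < γ} + ε / 10 ≤
      mistakes γ (fun i => signed (S i)) m w / m} with hE₁
  have p1 : π E₁ ≤ ENNReal.ofReal (1 / 10) := by
    have h := measure_frequency_le D (A := {z : Example p d | w ⬝ᵥ signed z < γ})
      (measurableSet_lt (measurable_dotProduct_signed w) measurable_const) hm0'
      (η := ε / 10) (by positivity)
    have : E₁ = {S : ℕ → Example p d | D.real {z | w ⬝ᵥ signed z < γ} + ε / 10 ≤
        (∑ k ∈ Finset.range m, if S k ∈ {z : Example p d | w ⬝ᵥ signed z < γ} then (1 : ℝ)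
          else 0) / m} := by
      simp only [hE₁, mistakes_eq, Set.mem_ofPred_eq]
    rw [this]
    refine h.trans (ENNReal.ofReal_le_ofReal ?_)
    rw [div_le_div_iff₀ (by positivity) (by norm_num)]
    have : 57600 * H ≤ m * ε ^ 2 := by
      have h2 := mul_le_mul_of_nonneg_right hmε (sq_nonneg ε)
      calc 57600 * H = 57600 * (H / ε ^ 2) * ε ^ 2 := by field_simp
        _ ≤ _ := h2
    nlinarith
  -- uniform convergence of the margin errors
  set E₂ : Set (ℕ → Example p d) :=
    {S | ∃ w ∈ lpBall p.conjExponent d, mistakes γ₁ (fun i => signed (S i)) m w / m + ε / 3 <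
      D.real {z | w ⬝ᵥ signed z ≤ (1 - ν) * γ}} with hE₂
  have p2 : π E₂ ≤ ENNReal.ofReal (1 / 10) := by
    set κ' := √(H / m) with hκ'
    have hκ0 : 0 < κ' := Real.sqrt_pos.2 (by positivity)
    have hκsq : κ' ^ 2 = H / m := Real.sq_sqrt (by positivity)
    have hκ1 : κ' ≤ 1 := by
      refine Real.sqrt_le_one.2 ?_
      rw [div_le_one hm0]; linarith
    obtain ⟨g', g1, g2, g3⟩ := hpot κ' hκ0 hκ1
    have h := measure_exists_margin_error_le D (v := signed) measurable_signed
      (W := lpBall p.conjExponent d) zero_mem_lpBall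
      (fun w hw z => hdual w hw _ (signed_mem_lpBall z)) (s₁ := (1 - ν) * γ) (s₂ := γ₁)
      (by rw [hγ₁]; nlinarith) g2 (fun θ z => g3 θ _ (signed_mem_lpBall z)) hm0'
      (η := ε / 3) (by positivity)
    have : E₂ = {S : ℕ → Example p d | ∃ w ∈ lpBall p.conjExponent d,
        (∑ k ∈ Finset.range m, if w ⬝ᵥ signed (S k) < γ₁ then (1 : ℝ) else 0) / m + ε / 3 <
          D.real {z | w ⬝ᵥ signed z ≤ (1 - ν) * γ}} := by
      simp only [hE₂, mistakes_eq]
    rw [this]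
    refine h.trans (ENNReal.ofReal_le_ofReal ?_)
    have e1 : γ₁ - (1 - ν) * γ = ν * γ / 2 := by rw [hγ₁]; ring
    have e2 : m * κ' = H / κ' := by
      rw [eq_div_iff hκ0.ne', mul_assoc, ← sq, hκsq]; field_simp
    rw [e1, div_le_iff₀ (by positivity)]
    calc 2 * (ν * γ / 2)⁻¹ * (g' 0 + m * κ') ≤ 2 * (ν * γ / 2)⁻¹ * (m * κ' + m * κ') := by
          gcongr; rw [e2]; exact g1
      _ = 8 * m * (κ' / (ν * γ)) := by field_simp; ring
      _ ≤ 8 * m * (ε / 240) := by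
          refine mul_le_mul_of_nonneg_left ?_ (by positivity)
          rw [div_le_iff₀ (by positivity)]
          refine abs_le_of_sq_le_sq' ?_ (by positivity) |>.2
          rw [hκsq, div_le_iff₀ hm0]
          have := mul_le_mul_of_nonneg_right hm hden.le
          have e : 57600 * (H / (ε ^ 2 * ν ^ 2 * γ ^ 2)) * (ε ^ 2 * ν ^ 2 * γ ^ 2) = 57600 * H := by
            field_simp
          rw [e] at this
          have e3 : (ε / 240 * (ν * γ)) ^ 2 * m = m * (ε ^ 2 * ν ^ 2 * γ ^ 2) / 57600 := by ring
          rw [e3, le_div_iff₀ (by norm_num)]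
          linarith
      _ = _ := by ring
  -- success of the trials
  set E₃ : Set ((ℕ → Example p d) × (ℕ → Bool)) :=
    {ω | (1 + δ) * mistakes γ (fun i => signed (ω.1 i)) m w < best ω} with hE₃
  have mE₃ : MeasurableSet E₃ :=
    measurableSet_lt (((measurable_mistakes γ m w).comp measurable_fst).const_mul _) hbest
  have p3 : (π.prod coinMeasure) E₃ ≤ ENNReal.ofReal (1 / 10) := by
    rw [Measure.prod_apply mE₃]
    have hS : ∀ S, coinMeasure (Prod.mk S ⁻¹' E₃) ≤ ENNReal.ofReal (1 / 10) := by
      intro S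
      set z : ℕ → Fin d → ℝ := fun i => signed (S i) with hz
      have hsub : Prod.mk S ⁻¹' E₃ ⊆ badRuns (update γ₁ z m B L)
          (fun θ => (1 + δ) * mistakes γ z m w < mistakes γ₁ z m (L θ)) B T 0 R := by
        intro r hr
        rcases hfail (S, r) ((1 + δ) * mistakes γ z m w) with h | h
        · exact absurd hr (not_lt.2 h)
        · exact h
      have hle := coinMeasure_fail_le hg (fun x hx => abs_le_of_mem_lpBall hx)
        (z := z) (fun i => signed_mem_lpBall (S i)) hB hδ hδ1.le hw hT R
      refine (measure_mono hsub).trans ?_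
      rw [← ENNReal.ofReal_toReal (measure_ne_top coinMeasure _)]
      refine ENNReal.ofReal_le_ofReal (hle.trans ?_)
      have hβ1 : (δ / 4) ^ T ≤ 1 := pow_le_one₀ (by positivity) (by linarith)
      calc (1 - (δ / 4) ^ T) ^ R ≤ (Real.exp (-(δ / 4) ^ T)) ^ R := by
            refine pow_le_pow_left₀ (by linarith) ?_ _
            have := Real.add_one_le_exp (-(δ / 4) ^ T); linarith
        _ = Real.exp (-(R * (δ / 4) ^ T)) := by rw [← Real.exp_nat_mul]; ring_nf
        _ ≤ Real.exp (-3) := by gcongr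
        _ ≤ 1 / 10 := by
            rw [Real.exp_neg, ← one_div]
            apply one_div_le_one_div_of_le (by norm_num)
            have h1 := Real.exp_one_gt_d9
            have : Real.exp 3 = Real.exp 1 ^ 3 := by rw [← Real.exp_nat_mul]; norm_num
            rw [this]
            calc (10 : ℝ) ≤ 2.7 ^ 3 := by norm_num
              _ ≤ _ := by gcongr; linarith
    calc ∫⁻ S, coinMeasure (Prod.mk S ⁻¹' E₃) ∂π ≤ ∫⁻ _, ENNReal.ofReal (1 / 10) ∂π :=
          lintegral_mono hS
      _ = _ := by simp
  have hfst : ∀ E : Set (ℕ → Example p d),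
      (π.prod coinMeasure) {ω | ω.1 ∈ E} = π E := fun E => by
    have : {ω : (ℕ → Example p d) × (ℕ → Bool) | ω.1 ∈ E} = E ×ˢ Set.univ := by ext; simp
    rw [this, Measure.prod_prod, measure_univ, mul_one]
  have hsub : {ω | ¬ err D ((1 - ν) * γ) (out ω) ≤ (1 + δ) * opt D γ + ε} ⊆
      {ω | ω.1 ∈ E₁} ∪ {ω | ω.1 ∈ E₂} ∪ E₃ := by
    intro ω hω
    by_contra hn
    simp only [Set.mem_union, Set.mem_ofPred_eq, not_or, hE₁, hE₂, hE₃, not_exists, not_and, not_lt,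
      not_le] at hn
    obtain ⟨⟨n1, n2⟩, n3⟩ := hn
    refine hω ?_
    have a1 := err_le_measure D ((1 - ν) * γ) (out ω)
    have a2 := n2 _ (hout ω)
    have a3 := measure_le_err D γ w
    have a4 : mistakes γ₁ (fun i => signed (ω.1 i)) m (out ω) / m ≤
        (1 + δ) * (mistakes γ (fun i => signed (ω.1 i)) m w / m) := by
      rw [← mul_div_assoc]; gcongr; exact (hmis ω).trans n3
    have a5 : (1 + δ) * (mistakes γ (fun i => signed (ω.1 i)) m w / m) ≤
        (1 + δ) * (opt D γ + 3 * ε / 20) := by gcongr; linarith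
    have a6 : (1 + δ) * (3 * ε / 20) ≤ 2 * (3 * ε / 20) := by gcongr; linarith
    linarith
  calc _ ≤ (π.prod coinMeasure) ({ω | ω.1 ∈ E₁} ∪ {ω | ω.1 ∈ E₂} ∪ E₃) := measure_mono hsub
    _ ≤ π E₁ + π E₂ + (π.prod coinMeasure) E₃ := by
        refine (measure_union_le _ _).trans (add_le_add ((measure_union_le _ _).trans ?_) le_rfl)
        rw [hfst, hfst]
    _ ≤ ENNReal.ofReal (1 / 10) + ENNReal.ofReal (1 / 10) + ENNReal.ofReal (1 / 10) := by gcongr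
    _ ≤ ENNReal.ofReal (1 / 3) := by
        rw [← ENNReal.ofReal_add (by norm_num) (by norm_num),
          ← ENNReal.ofReal_add (by norm_num) (by norm_num)]
        exact ENNReal.ofReal_le_ofReal (by norm_num)

end MarginLearning

/-! ### The two potentials as step potentials -/

namespace MarginLearning

variable {d : ℕ}

lemma mem_lpBall_ofReal {p : ℝ} (hp : 0 < p) {x : Fin d → ℝ} :
    x ∈ lpBall (ENNReal.ofReal p) d ↔ ∑ j, |x j| ^ p ≤ 1 := by
  have ht : (ENNReal.ofReal p).toReal = p := ENNReal.toReal_ofReal hp.le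
  have h0 : 0 ≤ ∑ j, |x j| ^ p := Finset.sum_nonneg fun j _ => Real.rpow_nonneg (abs_nonneg _) _
  rw [lpBall, Set.mem_ofPred_eq, PiLp.norm_eq_sum (by rw [ht]; exact hp), ht]
  simp only [Real.norm_eq_abs]
  refine ⟨fun h => ?_, fun h => Real.rpow_le_one h0 h (by positivity)⟩
  have := Real.rpow_le_one (Real.rpow_nonneg h0 _) h hp.le
  rwa [← Real.rpow_mul h0, one_div_mul_cancel hp.ne', Real.rpow_one] at this

lemma conjExponent_ofReal {p : ℝ} (hp : 1 < p) :
    (ENNReal.ofReal p).conjExponent = ENNReal.ofReal p.conjExponent := by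
  have h : p.conjExponent = 1 + (p - 1)⁻¹ := by
    have : p - 1 ≠ 0 := by linarith
    rw [Real.conjExponent]; field_simp; ring
  rw [h, ENNReal.ofReal_add (by norm_num) (by rw [inv_nonneg]; linarith),
    ENNReal.ofReal_inv_of_pos (by linarith), ENNReal.ofReal_sub _ (by norm_num), ENNReal.ofReal_one,
    ENNReal.conjExponent]

lemma mem_lpBall_top {x : Fin d → ℝ} : x ∈ lpBall ⊤ d ↔ ∀ j, |x j| ≤ 1 := by
  rw [lpBall, Set.mem_ofPred_eq, PiLp.norm_toLp, pi_norm_le_iff_of_nonneg zero_le_one]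
  simp only [Real.norm_eq_abs]

lemma mem_lpBall_conjExponent_top {x : Fin d → ℝ} :
    x ∈ lpBall (⊤ : ℝ≥0∞).conjExponent d ↔ ∑ j, |x j| ≤ 1 := by
  have : (⊤ : ℝ≥0∞).conjExponent = ENNReal.ofReal 1 := by simp [ENNReal.conjExponent]
  rw [this, mem_lpBall_ofReal one_pos]
  simp only [Real.rpow_one]

lemma abs_dotProduct_le_sum (u x : Fin d → ℝ) : |u ⬝ᵥ x| ≤ ∑ j, |u j| * |x j| := by
  refine (Finset.abs_sum_le_sum_abs _ _).trans (le_of_eq ?_)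
  simp only [abs_mul]

section Finite
variable {p : ℝ}

lemma sum_mul_le_of_rpow (hp : 1 < p) {w x : Fin d → ℝ} (hw : ∑ j, |w j| ^ p.conjExponent ≤ 1)
    (hx : ∑ j, |x j| ^ p ≤ 1) : ∑ j, |w j| * |x j| ≤ 1 := by
  have hc : p.HolderConjugate p.conjExponent := .conjExponent hp
  have h := Real.inner_le_Lp_mul_Lq Finset.univ (fun j => |w j|) (fun j => |x j|) hc.symm
  simp only [abs_abs] at h
  refine h.trans (mul_le_one₀ (Real.rpow_le_one ?_ hw ?_) (Real.rpow_nonneg ?_ _)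
    (Real.rpow_le_one ?_ hx ?_))
  any_goals exact Finset.sum_nonneg fun j _ => Real.rpow_nonneg (abs_nonneg _) _
  · have := hc.symm.pos; positivity
  · have := hc.pos; positivity

/-- The parameters of the approximate link for the scale `κ` and vectors with coordinates at most
`T`. -/
noncomputable def lpParams (p κ : ℝ) (d T : ℕ) : LpParams where
  p := p
  b := 1 + κ / 8 / ((1 + p) * 4)
  c := 3 * p / κ / (d / (κ / 8))
  A := d / (κ / 8)
  ρ := 1 + κ / 8
  K := ⌈T * (d / (κ / 8)) / (κ / 8 / ((1 + p) * 4))⌉₊ +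
    ⌈(⌈T * (d / (κ / 8)) / (κ / 8 / ((1 + p) * 4))⌉₊ : ℝ) * p⌉₊

lemma lpParams_approx (hp : 2 ≤ p) {κ : ℝ} (hκ : 0 < κ) (hκ1 : κ ≤ 1) (hd : 0 < d) {T : ℕ}
    (hT : 0 < T) (θ : Fin d → ℝ) (hθ : ∀ j, |θ j| ≤ T) (j : Fin d) :
    |(lpParams p κ d T).link θ j| ≤ |lpGrad p (3 * p / κ) θ j| ∧
      |(lpParams p κ d T).link θ j - lpGrad p (3 * p / κ) θ j| ≤
        4 * (κ / 8) * |lpGrad p (3 * p / κ) θ j| + κ / 8 / d := by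
  set τ := κ / 8 with hτ
  set η := τ / ((1 + p) * 4) with hη
  set a := 3 * p / κ with ha
  set K₁ := ⌈T * (d / τ) / η⌉₊ with hK₁
  have hτ0 : 0 < τ := by positivity
  have hτ1 : τ ≤ 1 / 8 := by rw [hτ]; linarith
  have hp0 : 0 < p := by linarith
  have hη0 : 0 < η := by positivity
  have ha1 : 1 ≤ a := by rw [ha, le_div_iff₀ hκ]; linarith
  have hd1 : (1 : ℝ) ≤ d := Nat.one_le_cast.2 hd
  have hT1 : (1 : ℝ) ≤ T := Nat.one_le_cast.2 hT
  have hA : 2 * (d : ℝ) ≤ d / τ := by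
    rw [le_div_iff₀ hτ0]
    nlinarith
  have hpow : T * (d / τ) ≤ (1 + η) ^ K₁ := by
    have h1 := one_add_mul_le_pow (by linarith : -2 ≤ η) K₁
    have h2 := Nat.le_ceil (T * (d / τ) / η)
    rw [← hK₁, div_le_iff₀ hη0] at h2
    linarith
  have hTA : d / τ ≤ T * (d / τ) := le_mul_of_one_le_left (by positivity) hT1
  refine lpLink_approx (lpParams p κ d T) (a := a) (τ := τ) (K₁ := K₁) hd hp (by positivity) hτ0
    (by linarith) rfl rfl (lt_add_of_pos_right 1 hη0) rfl ?_ le_rfl (hTA.trans hpow) ?_ θ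
    (fun j => ?_) j
  · change (1 + η) ^ (1 + p) ≤ 1 + τ
    calc (1 + η) ^ (1 + p) ≤ Real.exp η ^ (1 + p) := by
          gcongr
          have := Real.add_one_le_exp η; linarith
      _ = Real.exp (τ / 4) := by
          rw [← Real.exp_mul]; congr 1; rw [hη]; field_simp
      _ ≤ 1 + τ := by
          have := Real.abs_exp_sub_one_le (x := τ / 4)
            (by rw [abs_of_pos (by positivity)]; linarith)
          rw [abs_of_pos (by positivity : (0 : ℝ) < τ / 4)] at this
          have := (abs_le.1 this).2
          linarith
  · refine le_trans ?_ (hTA.trans hpow); linarith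
  · refine le_trans ?_ hpow
    change |θ j| / (a / (d / τ)) ≤ T * (d / τ)
    rw [div_div_eq_mul_div]
    refine (div_le_self (by positivity) ha1).trans ?_
    gcongr; exact hθ j

lemma stepPotential_lp (hp : 2 ≤ p) {κ : ℝ} (hκ : 0 < κ) (hκ1 : κ ≤ 1) (hd : 0 < d) {T : ℕ}
    (hT : 0 < T) :
    StepPotential (lpBall (ENNReal.ofReal p).conjExponent d) (lpBall (ENNReal.ofReal p) d)
      (lpParams p κ d T).link T (2 * κ) (3 * p / κ) (lpPot p (3 * p / κ)) := by
  have hp0 : 0 < p := by linarith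
  have ha : p ≤ 3 * p / κ := by
    rw [le_div_iff₀ hκ]; nlinarith
  have ha0 : 0 < 3 * p / κ := hp0.trans_le ha
  have hc : p.HolderConjugate p.conjExponent := .conjExponent (by linarith)
  have hd1 : (0 : ℝ) < d := Nat.cast_pos.2 hd
  rw [conjExponent_ofReal (by linarith)]
  refine ⟨(lpPot_zero hp ha0).le, fun w hw θ => ?_, fun θ hθ x hx => ?_, fun θ hθ => ?_⟩
  · exact dotProduct_le_lpPot hp ha0 ((mem_lpBall_ofReal hc.symm.pos).1 hw) θ
  · have hx' := (mem_lpBall_ofReal hp0).1 hx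
    have : Fact (1 ≤ ENNReal.ofReal p) := ⟨by rw [ENNReal.one_le_ofReal]; linarith⟩
    have hxj := abs_le_of_mem_lpBall hx
    have h1 := lpPot_add_le hp ha θ x hx'
    have h2 : lpGrad p (3 * p / κ) θ ⬝ᵥ x - (lpParams p κ d T).link θ ⬝ᵥ x ≤ κ := by
      rw [← sub_dotProduct]
      refine (le_abs_self _).trans ((abs_dotProduct_le_sum _ _).trans ?_)
      calc ∑ j, |(lpGrad p (3 * p / κ) θ - (lpParams p κ d T).link θ) j| * |x j|
          ≤ ∑ j, (4 * (κ / 8) * (|lpGrad p (3 * p / κ) θ j| * |x j|) + κ / 8 / d) := by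
            refine Finset.sum_le_sum fun j _ => ?_
            rw [Pi.sub_apply, abs_sub_comm]
            calc _ ≤ (4 * (κ / 8) * |lpGrad p (3 * p / κ) θ j| + κ / 8 / d) * |x j| := by
                  gcongr; exact (lpParams_approx hp hκ hκ1 hd hT θ hθ j).2
              _ = 4 * (κ / 8) * (|lpGrad p (3 * p / κ) θ j| * |x j|) + κ / 8 / d * |x j| := by ring
              _ ≤ 4 * (κ / 8) * (|lpGrad p (3 * p / κ) θ j| * |x j|) + κ / 8 / d * 1 := by
                  gcongr; exact hxj j
              _ = _ := by rw [mul_one]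
        _ = 4 * (κ / 8) * ∑ j, |lpGrad p (3 * p / κ) θ j| * |x j| + κ / 8 := by
            rw [Finset.sum_add_distrib, ← Finset.mul_sum, Finset.sum_const, Finset.card_univ,
              Fintype.card_fin, nsmul_eq_mul]
            congr 1; field_simp
        _ ≤ 4 * (κ / 8) * 1 + κ / 8 := by
            gcongr
            exact sum_mul_le_of_rpow (by linarith) (sum_abs_lpGrad_rpow_le hp ha0 θ) hx'
        _ ≤ κ := by linarith
    have h3 : 3 * p / (3 * p / κ) = κ := by field_simp
    rw [h3] at h1
    linarith
  · rw [mem_lpBall_ofReal hc.symm.pos]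
    refine le_trans (Finset.sum_le_sum fun j _ => ?_) (sum_abs_lpGrad_rpow_le hp ha0 θ)
    exact Real.rpow_le_rpow (abs_nonneg _) (lpParams_approx hp hκ hκ1 hd hT θ hθ j).1
      hc.symm.nonneg

lemma exists_potential_lp (hp : 2 ≤ p) {κ : ℝ} (hκ : 0 < κ) (hκ1 : κ ≤ 1) :
    ∃ g : (Fin d → ℝ) → ℝ, g 0 ≤ 3 * p / κ ∧
      (∀ w ∈ lpBall (ENNReal.ofReal p).conjExponent d, ∀ θ, w ⬝ᵥ θ ≤ g θ) ∧
      ∀ θ, ∀ x ∈ lpBall (ENNReal.ofReal p) d, 2⁻¹ * (g (θ + x) + g (θ - x)) ≤ g θ + κ := by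
  have hp0 : 0 < p := by linarith
  have ha : p ≤ 3 * p / κ := by
    rw [le_div_iff₀ hκ]; nlinarith
  have ha0 : 0 < 3 * p / κ := hp0.trans_le ha
  have hc : p.HolderConjugate p.conjExponent := .conjExponent (by linarith)
  rw [conjExponent_ofReal (by linarith)]
  refine ⟨lpPot p (3 * p / κ), (lpPot_zero hp ha0).le, fun w hw θ =>
    dotProduct_le_lpPot hp ha0 ((mem_lpBall_ofReal hc.symm.pos).1 hw) θ, fun θ x hx => ?_⟩
  have hx' := (mem_lpBall_ofReal hp0).1 hx
  have h1 := lpPot_add_le hp ha θ x hx'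
  have h2 := lpPot_add_le hp ha θ (-x) (by simpa using hx')
  have h3 : 3 * p / (3 * p / κ) = κ := by field_simp
  rw [h3] at h1 h2
  rw [dotProduct_neg, ← sub_eq_add_neg] at h2
  linarith

lemma abs_dotProduct_le_one_lp (hp : 2 ≤ p) {w x : Fin d → ℝ}
    (hw : w ∈ lpBall (ENNReal.ofReal p).conjExponent d) (hx : x ∈ lpBall (ENNReal.ofReal p) d) :
    |w ⬝ᵥ x| ≤ 1 := by
  have hc : p.HolderConjugate p.conjExponent := .conjExponent (by linarith)
  rw [conjExponent_ofReal (by linarith)] at hw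
  exact (abs_dotProduct_le_sum w x).trans (sum_mul_le_of_rpow (by linarith)
    ((mem_lpBall_ofReal hc.symm.pos).1 hw) ((mem_lpBall_ofReal (by linarith)).1 hx))

end Finite

section Top

lemma sum_mul_le_of_sum_le {w x : Fin d → ℝ} {c : ℝ} (hw : ∑ j, |w j| ≤ c) (hx : ∀ j, |x j| ≤ 1) :
    ∑ j, |w j| * |x j| ≤ c :=
  (Finset.sum_le_sum fun j _ => mul_le_of_le_one_right (abs_nonneg _) (hx j)).trans hw

lemma half_le_log {τ : ℝ} (hτ : 0 < τ) (hτ1 : τ ≤ 1) : τ / 2 ≤ Real.log (1 + τ) := by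
  have h := Real.one_sub_inv_le_log_of_pos (by linarith : (0 : ℝ) < 1 + τ)
  refine le_trans ?_ h
  have : 1 - (1 + τ)⁻¹ = τ / (1 + τ) := by field_simp; ring
  rw [this]
  exact div_le_div_of_nonneg_left hτ.le (by linarith) (by linarith)

lemma stepPotential_soft {κ ℓ : ℝ} (hκ : 0 < κ) (hκ1 : κ ≤ 1) (hd : 0 < d) {T : ℕ}
    (hℓ : Real.log (2 * d) ≤ ℓ) :
    StepPotential (lpBall (⊤ : ℝ≥0∞).conjExponent d) (lpBall ⊤ d)
      (softLink (1 + κ / 3) T) T (2 * κ) (6 * ℓ / κ) (softmax (Real.log (1 + κ / 3))) := by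
  set τ := κ / 3 with hτ
  have hτ0 : 0 < τ := by positivity
  have hτ1 : τ ≤ 1 := by rw [hτ]; linarith
  have hη0 : 0 < Real.log (1 + τ) := Real.log_pos (by linarith)
  have hητ : Real.log (1 + τ) ≤ τ := by
    have := Real.log_le_sub_one_of_pos (by linarith : (0 : ℝ) < 1 + τ); linarith
  have hd1 : (1 : ℝ) ≤ d := Nat.one_le_cast.2 hd
  have hℓ0 : 0 ≤ Real.log (2 * d) := Real.log_nonneg (by linarith)
  refine ⟨?_, fun w hw θ => ?_, fun θ hθ x hx => ?_, fun θ hθ => ?_⟩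
  · rw [softmax_zero, inv_mul_eq_div]
    calc Real.log (2 * d) / Real.log (1 + τ) ≤ ℓ / (τ / 2) := by
          gcongr
          · exact hℓ0.trans hℓ
          · exact half_le_log hτ0 hτ1
      _ = 6 * ℓ / κ := by rw [hτ]; field_simp; ring
  · exact dotProduct_le_softmax hd hη0 (mem_lpBall_conjExponent_top.1 hw) θ
  · have hx' := mem_lpBall_top.1 hx
    have h1 := softmax_add_le hd hη0 (hητ.trans hτ1) θ x hx'
    have h2 : softGrad (Real.log (1 + τ)) θ ⬝ᵥ x - softLink (1 + τ) T θ ⬝ᵥ x ≤ 3 * τ := by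
      rw [← sub_dotProduct]
      refine (le_abs_self _).trans ((abs_dotProduct_le_sum _ _).trans
        (sum_mul_le_of_sum_le ?_ hx'))
      simp only [Pi.sub_apply, abs_sub_comm (softGrad _ _ _)]
      exact (softLink_approx hd hτ0 hτ1 θ hθ).2
    linarith
  · exact mem_lpBall_conjExponent_top.2 (softLink_approx hd hτ0 hτ1 θ hθ).1

lemma exists_potential_top {κ ℓ : ℝ} (hκ : 0 < κ) (hκ1 : κ ≤ 1) (hd : 0 < d)
    (hℓ : Real.log (2 * d) ≤ ℓ) :
    ∃ g : (Fin d → ℝ) → ℝ, g 0 ≤ ℓ / κ ∧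
      (∀ w ∈ lpBall (⊤ : ℝ≥0∞).conjExponent d, ∀ θ, w ⬝ᵥ θ ≤ g θ) ∧
      ∀ θ, ∀ x ∈ lpBall ⊤ d, 2⁻¹ * (g (θ + x) + g (θ - x)) ≤ g θ + κ := by
  refine ⟨softmax κ, ?_, fun w hw θ =>
    dotProduct_le_softmax hd hκ (mem_lpBall_conjExponent_top.1 hw) θ, fun θ x hx => ?_⟩
  · rw [softmax_zero, inv_mul_eq_div]; gcongr
  · have hx' := mem_lpBall_top.1 hx
    have h1 := softmax_add_le hd hκ hκ1 θ x hx'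
    have h2 := softmax_add_le hd hκ hκ1 θ (-x) (by simpa using hx')
    rw [dotProduct_neg, ← sub_eq_add_neg] at h2
    linarith

lemma abs_dotProduct_le_one_top {w x : Fin d → ℝ}
    (hw : w ∈ lpBall (⊤ : ℝ≥0∞).conjExponent d) (hx : x ∈ lpBall ⊤ d) : |w ⬝ᵥ x| ≤ 1 :=
  (abs_dotProduct_le_sum w x).trans
    (sum_mul_le_of_sum_le (mem_lpBall_conjExponent_top.1 hw) (mem_lpBall_top.1 hx))

end Top
end MarginLearning

/-! ### The learner -/

namespace RealRAM
namespace Cmd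

/-- The number of elementary steps of one pass through all loop bodies. -/
def size : Cmd → ℕ
  | seq A B => 1 + size A + size B
  | ifLt _ _ A B => 1 + (size A + size B)
  | loop _ _ A => 9 + size A
  | load _ _ _ => 14
  | store _ _ _ => 14
  | _ => 1

/-- The nesting depth of loops. -/
def depth : Cmd → ℕ
  | seq A B => max (depth A) (depth B)
  | ifLt _ _ A B => max (depth A) (depth B)
  | loop _ _ A => depth A + 1
  | _ => 0

lemma costB_le {e : ℕ → ℕ} {N : ℕ} (hN : 1 ≤ N) (c : Cmd) (h : ∀ v ∈ c.bounds, e v ≤ N) :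
    c.costB e ≤ c.size * N ^ c.depth := by
  have mono : ∀ {a x y : ℕ}, x ≤ y → a * N ^ x ≤ a * N ^ y := fun h =>
    Nat.mul_le_mul_left _ (Nat.pow_le_pow_right hN h)
  have one : ∀ k, 1 ≤ N ^ k := fun k => Nat.one_le_pow _ _ hN
  induction c with
  | seq A B ihA ihB =>
    simp only [bounds, List.mem_append] at h
    have h1 := (ihA fun v hv => h v (.inl hv)).trans (mono (le_max_left A.depth B.depth))
    have h2 := (ihB fun v hv => h v (.inr hv)).trans (mono (le_max_right A.depth B.depth))
    simp only [costB, size, depth, add_mul, one_mul]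
    have := one (max A.depth B.depth)
    omega
  | ifLt x y A B ihA ihB =>
    simp only [bounds, List.mem_append] at h
    have h1 := (ihA fun v hv => h v (.inl hv)).trans (mono (le_max_left A.depth B.depth))
    have h2 := (ihB fun v hv => h v (.inr hv)).trans (mono (le_max_right A.depth B.depth))
    simp only [costB, size, depth, add_mul, one_mul]
    have := one (max A.depth B.depth)
    omega
  | loop i n A ih =>
    simp only [bounds, List.mem_cons] at h
    have h1 := ih fun v hv => h v (.inr hv)
    have h2 := h n (.inl rfl)
    simp only [costB, size, depth, add_mul]
    have h3 : e n * (A.costB e + 6) ≤ N * (A.size * N ^ A.depth + 6) := by gcongr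
    have h4 : N * (A.size * N ^ A.depth + 6) = A.size * N ^ (A.depth + 1) + 6 * N := by ring
    have h5 : N ≤ N ^ (A.depth + 1) := Nat.le_self_pow (by omega) N
    have := one (A.depth + 1)
    omega
  | _ => simp [costB, size, depth]

end Cmd
end RealRAM

namespace MarginLearning
open RealRAM RealRAM.Cmd

/-- The program: `init` computes the parameters, `lnk` computes the link function. -/
def learnCmd (init lnk : Cmd) : Cmd := block [init, sampleCmd, trialsCmd lnk]

/-- The memory after the computation of the parameters. -/
structure Initialized (d m T R B K : ℕ) (e : ℕ → ℝ) (γ₁ : ℝ) (s : Mem) : Prop where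
  n0 : s.n 0 = d
  n1 : s.n 1 = m
  n2 : s.n 2 = T
  n3 : s.n 3 = R
  n4 : s.n 4 = B
  n5 : s.n 5 = K
  n6 : s.n 6 = 0
  r5 : s.r 5 = γ₁
  r6 : s.r 6 = 1
  r12 : s.r 12 = m
  r17 : s.r 17 = 0
  env : ∀ v ∈ [20, 21, 22, 23, 24, 25], s.r v = e v
  a4 : ∀ j, s.a 4 j = 0
  draws : s.draws = 0
  flips : s.flips = 0

/-- The syntactic conditions on a link program. -/
structure LinkSyntax (lnk : Cmd) : Prop where
  wf : lnk.WF
  noDraw : lnk.noDraw = true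
  noCeil : lnk.noCeil = true
  bounds : ∀ v ∈ lnk.bounds, v ∈ [0, 5]

variable {p : ℝ≥0∞} {d m T R B K : ℕ} {e : ℕ → ℝ} {γ₁ : ℝ} {init lnk : Cmd} {params : List ℝ}
  {L : (Fin d → ℝ) → Fin d → ℝ}

lemma trialsCmd_wn (hl : IsLink lnk K e L) {v : ℕ} (hv : v < 8) : v ∉ (trialsCmd lnk).wn := by
  have h : ∀ w ∈ lnk.wn, w ≠ v := fun w hw => by rcases hl.wn w hw with rfl | rfl <;> omega
  have h' : v ∉ lnk.wn := fun h1 => h v h1 rfl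
  simp only [trialsCmd, stepCmd, block, Cmd.wn, marginsCmd, bestCmd, bitsCmd, selectCmd, updateCmd,
    List.mem_append, List.mem_cons, List.not_mem_nil, h', or_false, false_or, not_or]
  omega

lemma trialsCmd_wf (hl : IsLink lnk K e L) (hs : LinkSyntax lnk) : (trialsCmd lnk).WF := by
  have h : ∀ v, v ≠ 19 → v ≠ 20 → v ∉ lnk.wn := fun v h1 h2 hv => by
    rcases hl.wn v hv with h | h <;> contradiction
  simp [trialsCmd, stepCmd, block, Cmd.wn, marginsCmd, bestCmd, bitsCmd, selectCmd, updateCmd, WF,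
    hs.wf, h]

lemma trialsCmd_noDraw (hs : LinkSyntax lnk) : (trialsCmd lnk).noDraw = true := by
  simp [trialsCmd, stepCmd, block, marginsCmd, bestCmd, bitsCmd, selectCmd, updateCmd, Cmd.noDraw,
    hs.noDraw]

lemma trialsCmd_noCeil (hs : LinkSyntax lnk) : (trialsCmd lnk).noCeil = true := by
  simp [trialsCmd, stepCmd, block, marginsCmd, bestCmd, bitsCmd, selectCmd, updateCmd, Cmd.noCeil,
    hs.noCeil]

lemma trialsCmd_bounds (hs : LinkSyntax lnk) :
    ∀ v ∈ (trialsCmd lnk).bounds, v ∈ [0, 1, 2, 3, 4, 5] := by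
  intro v hv
  simp only [trialsCmd, stepCmd, block, marginsCmd, bestCmd, bitsCmd, selectCmd, updateCmd,
    Cmd.bounds, List.mem_append, List.mem_cons, List.not_mem_nil, or_false, false_or] at hv
  have := hs.bounds v
  simp only [List.mem_cons, List.not_mem_nil, or_false] at this ⊢
  tauto

section
variable (S : ℕ → Example p d) (r : ℕ → Bool)

/-- The sampling and the trials, started on an initialized memory. -/
lemma den_learn [Fact (1 ≤ p)] (hl : IsLink lnk K e L) (hs : LinkSyntax lnk) (hm : 0 < m)
    (hi : Initialized d m T R B K e γ₁ (den (fun n => encode (S n)) r init (initMem d params))) :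
    let s := den (fun n => encode (S n)) r (learnCmd init lnk) (initMem d params)
    BestOK γ₁ (fun i => signed (S i)) m T L s ∧
    (∀ thr, s.r 12 ≤ thr ∨ r ∈ badRuns (update γ₁ (fun i => signed (S i)) m B L)
      (fun θ => thr < mistakes γ₁ (fun i => signed (S i)) m (L θ)) B T 0 R) ∧
    s.draws = m := by
  intro s
  set S' := fun n => encode (S n)
  set s0 := den S' r init (initMem d params)
  set s1 := den S' r sampleCmd s0 with hs1
  have hs2 : s = den S' r (trialsCmd lnk) s1 := rfl
  obtain ⟨e1, e2⟩ := den_sample S' r hi.n0 hi.n1 hi.draws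
  have fn : ∀ {v}, v ∉ sampleCmd.wn → s1.n v = s0.n v := fun h => den_n_of_notMem _ _ _ _ h
  have fr : ∀ {v}, v ∉ sampleCmd.wr → s1.r v = s0.r v := fun h => den_r_of_notMem _ _ _ _ h
  have hready : Ready d m B T K e γ₁ (fun i => signed (S i)) s1 := by
    refine ⟨?_, ?_, ?_, ?_, fun v hv => ?_, ?_, ?_, ?_, ?_, ?_, fun i hi j => ?_⟩
    · rw [fn (by decide), hi.n0]
    · rw [fn (by decide), hi.n1]
    · rw [fn (by decide), hi.n2]
    · rw [fn (by decide), hi.n5]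
    · rw [fr, hi.env v hv]
      revert hv; revert v; decide
    · rw [fn (by decide), hi.n4]
    · rw [fn (by decide), hi.n6]
    · rw [fr (by decide), hi.r5]
    · rw [fr (by decide), hi.r6]
    · rw [fr (by decide), hi.r17]
    · rw [hs1, e1 i hi j j.2]
      simp [S', encode, signed, mul_comm]
  have a4 : s1.a 4 = s0.a 4 := den_a_of_notMem _ _ _ _ (by decide)
  have hR : s1.n 3 = R := by rw [fn (by decide), hi.n3]
  obtain ⟨b1, b2⟩ := den_trials S' r hl hm
    (fun i _ j => abs_le_of_mem_lpBall (signed_mem_lpBall (S i)) j) hready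
    (fun j => by rw [a4, hi.a4]) (by rw [fr (by decide), hi.r12])
    (by rw [hs1, den_flips_of_noFlip _ _ _ _ (by decide), hi.flips])
  rw [hR] at b2
  refine ⟨b1, b2, ?_⟩
  rw [hs2, den_draws_of_noDraw _ _ _ _ (trialsCmd_noDraw hs)]
  exact e2

/-- The running time of the sampling and the trials is polynomial in the sizes of the loops. -/
lemma cost_learn (hl : IsLink lnk K e L) (hs : LinkSyntax lnk)
    (hi : Initialized d m T R B K e γ₁ (den (fun n => encode (S n)) r init (initMem d params)))
    {N : ℕ} (hN : 1 ≤ N) (hd : d ≤ N) (hm : m ≤ N) (hT : T ≤ N) (hR : R ≤ N) (hB : B ≤ N)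
    (hK : K ≤ N) :
    cost (fun n => encode (S n)) r (learnCmd init lnk) (initMem d params) ≤
      cost (fun n => encode (S n)) r init (initMem d params) + 5 +
        sampleCmd.size * N ^ 2 + (trialsCmd lnk).size * N ^ (trialsCmd lnk).depth := by
  set S' := fun n => encode (S n)
  set s0 := den S' r init (initMem d params) with hs0
  set s1 := den S' r sampleCmd s0 with hs1
  have fn : ∀ {v}, v ∉ sampleCmd.wn → s1.n v = s0.n v := fun h => den_n_of_notMem _ _ _ _ h
  have h6 : ∀ v ∈ [0, 1, 2, 3, 4, 5], s0.n v ≤ N := by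
    simp [hi.n0, hi.n1, hi.n2, hi.n3, hi.n4, hi.n5, hd, hm, hT, hR, hB, hK]
  have c1 : cost S' r sampleCmd s0 ≤ sampleCmd.size * N ^ 2 :=
    (cost_le_costB S' r s0.n (B := [0, 1]) sampleCmd s0 (by decide) (by decide) (by decide)
      (fun _ _ => rfl)).trans (costB_le hN sampleCmd fun v hv => h6 v (by
        revert hv; revert v; decide))
  have c2 : cost S' r (trialsCmd lnk) s1 ≤
      (trialsCmd lnk).size * N ^ (trialsCmd lnk).depth :=
    (cost_le_costB S' r s0.n (B := [0, 1, 2, 3, 4, 5]) (trialsCmd lnk) s1 (trialsCmd_noCeil hs)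
      (trialsCmd_bounds hs) (fun v hv => trialsCmd_wn hl (by simp at hv; omega))
      (fun v hv => fn (by revert hv; revert v; decide))).trans
      (costB_le hN _ fun v hv => h6 v (trialsCmd_bounds hs v hv))
  simp only [learnCmd, block, cost]
  rw [← hs0, ← hs1]
  omega

end

/-- Correctness of the learner, given the correctness of the computation of its parameters. -/
theorem isProperRobustLearner_learnCmd [Fact (1 ≤ p)] [Fact (1 ≤ p.conjExponent)]
    {γ ν δ ε H M t κ g₀ : ℝ} (hγ : 0 < γ) (hν : 0 < ν) (hν1 : ν < 1) (hγ1 : γ < 1) (hδ : 0 < δ)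
    (hδ1 : δ < 1) (hε : 0 < ε) (hε1 : ε < 1) (hH : 1 ≤ H)
    (hdual : ∀ w ∈ lpBall p.conjExponent d, ∀ x ∈ lpBall p d, |w ⬝ᵥ x| ≤ 1)
    (hpot : ∀ κ : ℝ, 0 < κ → κ ≤ 1 → ∃ g : (Fin d → ℝ) → ℝ, g 0 ≤ H / κ ∧
      (∀ w ∈ lpBall p.conjExponent d, ∀ θ, w ⬝ᵥ θ ≤ g θ) ∧
      ∀ θ, ∀ x ∈ lpBall p d, 2⁻¹ * (g (θ + x) + g (θ - x)) ≤ g θ + κ)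
    (hm0 : 0 < m) (hm : 57600 * (H / (ε ^ 2 * ν ^ 2 * γ ^ 2)) ≤ m) (hmM : (m : ℝ) ≤ M)
    (hB : 2 * m ≤ 2 ^ B)
    (hR : 3 ≤ R * (δ / 4) ^ T) {g : (Fin d → ℝ) → ℝ}
    (hg : StepPotential (lpBall p.conjExponent d) (lpBall p d) L T κ g₀ g)
    (hT : g₀ + T * ((1 - ν / 2) * γ + κ) < T * γ)
    (hl : IsLink lnk K e L) (hs : LinkSyntax lnk) (hinit : init.WF) (hinit0 : 0 ∉ init.wn)
    (hi : ∀ (S : ℕ → Example p d) (r : ℕ → Bool), Initialized d m T R B K e ((1 - ν / 2) * γ)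
      (den (fun n => encode (S n)) r init (initMem d params)))
    (hcost : ∀ (S : ℕ → Example p d) (r : ℕ → Bool),
      ((cost (fun n => encode (S n)) r (learnCmd init lnk) (initMem d params) + 18 * d + 7 : ℕ) : ℝ)
        ≤ t) :
    IsProperRobustLearner (learnCmd init lnk).toProg params p d γ ν (1 + δ) ε (1 / 3) M t := by
  have hwf : (learnCmd init lnk).WF :=
    ⟨hinit, by simp [sampleCmd, WF, block, Cmd.wn], trialsCmd_wf hl hs, trivial⟩
  have h0 : 0 ∉ (learnCmd init lnk).wn := by
    have h1 := trialsCmd_wn hl (v := 0) (by norm_num)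
    have h2 : 0 ∉ sampleCmd.wn := by decide
    simp only [learnCmd, block, Cmd.wn, List.mem_append, hinit0, h1, h2, List.not_mem_nil, or_self,
      not_false_iff]
  have hrun : ∀ (S : ℕ → Example p d) (r : ℕ → Bool), _ := fun S r =>
    Cmd.run_toProg (fun n => encode (S n)) r (learnCmd init lnk) hwf h0 d params ⌊t⌋₊
      (Nat.le_floor (hcost S r))
  have hden := fun (S : ℕ → Example p d) (r : ℕ → Bool) =>
    den_learn (params := params) S r hl hs hm0 (hi S r)
  have hout : ∀ (S : ℕ → Example p d) (r : ℕ → Bool),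
      (outcome (learnCmd init lnk).toProg params ⌊t⌋₊ S r).mem.output d ∈ lpBall p.conjExponent d ∧
      mistakes ((1 - ν / 2) * γ) (fun i => signed (S i)) m
        ((outcome (learnCmd init lnk).toProg params ⌊t⌋₊ S r).mem.output d) ≤
        (den (fun n => encode (S n)) r (learnCmd init lnk) (initMem d params)).r 12 := by
    intro S r
    obtain ⟨w, h1, h2, h3⟩ := (hden S r).1
    have hw : (outcome (learnCmd init lnk).toProg params ⌊t⌋₊ S r).mem.output d = w := by
      rw [outcome, (hrun S r).2.2]; exact funext h1
    rw [hw]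
    refine ⟨?_, h2⟩
    rcases h3 with rfl | ⟨θ, hθ, rfl⟩
    · exact zero_mem_lpBall
    · exact hg.mem θ hθ
  refine ⟨fun S r => (hrun S r).1, fun S r => ?_, fun S r => (hout S r).1, fun D _ => ?_⟩
  · rw [outcome, (hrun S r).2.1, (hden S r).2.2]; exact hmM
  · have hmeas : Measurable fun ω : (ℕ → Example p d) × (ℕ → Bool) =>
        (den (fun n => encode (ω.1 n)) ω.2 (learnCmd init lnk) (initMem d params)).r 12 := by
      have henc : Measurable (encode : Example p d → (ℕ → ℝ) × ℝ) := by
        refine Measurable.prodMk (measurable_pi_lambda _ fun j => ?_)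
          (measurable_subtype_coe.comp measurable_snd)
        by_cases h : j < d
        · simp only [h, dif_pos]
          exact (measurable_pi_apply _).comp (measurable_subtype_coe.comp measurable_fst)
        · simp only [h, dif_neg, not_false_iff]; exact measurable_const
      have hS : Measurable fun ω : (ℕ → Example p d) × (ℕ → Bool) => fun n => encode (ω.1 n) :=
        measurable_pi_lambda _ fun n => henc.comp ((measurable_pi_apply n).comp measurable_fst)
      exact (Cmd.meas_den hS measurable_snd (learnCmd init lnk) (f := fun _ => initMem d params)
        ⟨fun _ => measurable_const, fun _ => measurable_const, fun _ _ => measurable_const,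
          fun _ => measurable_const, measurable_const, measurable_const, measurable_const⟩).r 12
    exact measure_fail_le hγ hν hν1 hγ1 hδ hδ1 hε hε1 hH hdual hpot hm hB hR hg hT D hmeas
      (fun ω => (hout ω.1 ω.2).1) (fun ω => (hout ω.1 ω.2).2) (fun ω => (hden ω.1 ω.2).2.1)

end MarginLearning

/-! ### Computation of the parameters -/

namespace MarginLearning
open RealRAM RealRAM.Cmd

/-- Reads the parameters `ν`, `δ`, `ε`, `p` into real variables `1`, …, `4` (`γ` is in `0`), and
stores `1` in `6` and `ν * γ` in `40`. -/
def readCmd : Cmd := block [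
  nconst 7 1, rofNat 6 7, load 1 0 6, load 2 1 6, load 3 2 6, load 4 3 6, rop .mul 40 1 0]

/-- Prepares the length of a trial. -/
def lengthCmd : Cmd := block [
  nconst 7 32, rofNat 8 7, rop .mul 8 8 18, rop .mul 9 40 40, rop .div 8 8 9]

/-- Prepares the sample size. -/
def sampleSizeCmd : Cmd := block [
  nconst 7 1, nadd 2 2 7, nconst 7 57600, rofNat 8 7, rop .mul 8 8 18, rop .mul 10 3 3,
  rop .mul 10 10 9, rop .div 8 8 10]

/-- Computes the number of bits, the initial record, the threshold and the scale `ν * γ / 8`. -/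
def thresholdCmd : Cmd := block [
  nconst 7 1, nadd 4 1 7, rofNat 12 1, nconst 7 2, rofNat 8 7, rop .div 8 40 8, rop .sub 5 0 8,
  nconst 7 8, rofNat 8 7, rop .div 40 40 8]

/-- Prepares the number of trials. -/
def trialNumberCmd : Cmd := block [
  nconst 7 3, rofNat 8 7, nconst 7 4, rofNat 9 7, rop .div 9 9 2, loop 10 2 (rop .mul 8 8 9)]

/-- Computes the parameters that do not depend on the link function, from the value in real
variable `18`, which bounds the potentials. -/
def sizesCmd : Cmd := block [
  lengthCmd, ceil 2 8, sampleSizeCmd, ceil 1 8, thresholdCmd, trialNumberCmd, ceil 3 8]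

/-- The length of a trial, where `h` bounds the potentials and `u = ν * γ`. -/
noncomputable def trialLength (h u : ℝ) : ℕ := ⌈32 * h / (u * u)⌉₊ + 1

/-- The sample size. -/
noncomputable def sampleSize (h u ε : ℝ) : ℕ := ⌈57600 * h / (ε * ε * (u * u))⌉₊

/-- The number of trials of length `T`. -/
noncomputable def trialNumber (δ : ℝ) (T : ℕ) : ℕ := ⌈3 * (4 / δ) ^ T⌉₊

section
variable (S : ℕ → (ℕ → ℝ) × ℝ) (b : ℕ → Bool) {d : ℕ} {γ ν δ ε p h u : ℝ}

/-- The values of the parameters that the program has read. -/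
structure ReadOK (d : ℕ) (γ δ ε p u : ℝ) (s : Mem) : Prop where
  n0 : s.n 0 = d
  n6 : s.n 6 = 0
  r0 : s.r 0 = γ
  r2 : s.r 2 = δ
  r3 : s.r 3 = ε
  r4 : s.r 4 = p
  r6 : s.r 6 = 1
  r17 : s.r 17 = 0
  r40 : s.r 40 = u
  a4 : ∀ j, s.a 4 j = 0
  draws : s.draws = 0
  flips : s.flips = 0

lemma den_read {l : List ℝ} (hl : l.length ≤ 5) (h0 : l.getD 0 0 = γ) (h1 : l.getD 1 0 = ν)
    (h2 : l.getD 2 0 = δ) (h3 : l.getD 3 0 = ε) (h4 : l.getD 4 0 = p) :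
    ReadOK d γ δ ε p (ν * γ) (den S b readCmd (initMem d l)) := by
  have big : ∀ k, 5 ≤ k → l.getD k 0 = 0 := fun k hk => List.getD_eq_default _ _ (hl.trans hk)
  set s := initMem d l with hs
  have n0 : s.n 0 = d := rfl
  have n6 : s.n 6 = 0 := rfl
  have r0 : s.r 0 = γ := h0
  have r17 : s.r 17 = 0 := big _ (by norm_num)
  have a0 : s.a 0 0 = ν := h1
  have a1 : s.a 1 0 = δ := h2
  have a2 : s.a 2 0 = ε := h3
  have a3 : s.a 3 0 = p := h4
  have a4 : ∀ j, s.a 4 j = 0 := fun j => big _ (by simp)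
  have dr : s.draws = 0 := rfl
  have fl : s.flips = 0 := rfl
  constructor <;> simp [readCmd, block, den, ROp.fn, n0, n6, r0, r17, a0, a1, a2, a3, a4, dr, fl]

lemma den_sizes {s : Mem} (hs : ReadOK d γ δ ε p u s) (h18 : s.r 18 = h) :
    let T := trialLength h u
    let s' := den S b sizesCmd s
    ReadOK d γ δ ε p (u / 8) s' ∧ s'.r 18 = h ∧ s'.n 1 = sampleSize h u ε ∧ s'.n 2 = T ∧
      s'.n 3 = trialNumber δ T ∧ s'.n 4 = sampleSize h u ε + 1 ∧ s'.r 5 = γ - u / 2 ∧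
      s'.r 12 = sampleSize h u ε ∧
      cost S b sizesCmd s ≤ 100 + 13 * T + 6 * sampleSize h u ε + 6 * trialNumber δ T := by
  intro T s'
  set s1 := den S b lengthCmd s with hs1
  set s2 := den S b (ceil 2 8) s1 with hs2
  set s3 := den S b sampleSizeCmd s2 with hs3
  set s4 := den S b (ceil 1 8) s3 with hs4
  set s5 := den S b thresholdCmd s4 with hs5
  set s6 := den S b trialNumberCmd s5 with hs6
  have hs7 : s' = den S b (ceil 3 8) s6 := rfl
  have q1 : s1.r 8 = 32 * h / (u * u) ∧ s1.r 9 = u * u := by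
    simp [hs1, lengthCmd, block, den, ROp.fn, h18, hs.r40]
  have q2 : s2.n 2 + 1 = T := by simp [hs2, den, q1, T, trialLength]
  have q2' : s2.r 18 = h ∧ s2.r 3 = ε ∧ s2.r 9 = u * u := by
    refine ⟨?_, ?_, by simp [hs2, den, q1]⟩ <;>
      simp [hs2, den, hs1, lengthCmd, block, h18, hs.r3]
  have q3 : s3.r 8 = 57600 * h / (ε * ε * (u * u)) ∧ s3.n 2 = T := by
    simp [hs3, sampleSizeCmd, block, den, ROp.fn, q2', q2]
  have q4 : s4.n 1 = sampleSize h u ε := by simp [hs4, den, q3, sampleSize]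
  have r4' : ∀ {v}, v ∉ [8, 9, 10] → s4.r v = s.r v := fun {v} hv => by
    rw [hs4, den_r_of_notMem _ _ _ _ (by simp [Cmd.wr]), hs3, den_r_of_notMem _ _ _ _ (by
      simp [sampleSizeCmd, block, Cmd.wr]; simp at hv; omega), hs2,
      den_r_of_notMem _ _ _ _ (by simp [Cmd.wr]), hs1, den_r_of_notMem _ _ _ _ (by
      simp [lengthCmd, block, Cmd.wr]; simp at hv; omega)]
  have q5 : s5.n 4 = sampleSize h u ε + 1 ∧ s5.r 12 = sampleSize h u ε ∧ s5.r 5 = γ - u / 2 ∧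
      s5.r 40 = u / 8 ∧ s5.r 2 = δ ∧ s5.n 2 = T := by
    simp [hs5, thresholdCmd, block, den, ROp.fn, q4, r4', hs.r40, hs.r0, hs.r2]
    simp [hs4, den, q3]
  obtain ⟨q51, q52, q53, q54, q55, q56⟩ := q5
  have q6 : s6.r 8 = 3 * (4 / δ) ^ T := by
    set s0 := den S b (block [nconst 7 3, rofNat 8 7, nconst 7 4, rofNat 9 7, rop .div 9 9 2]) s5
      with hs0
    have h0 : s0.r 8 = 3 ∧ s0.r 9 = 4 / δ ∧ s0.n 2 = T := by
      simp [hs0, block, den, ROp.fn, q55, q56]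
    obtain ⟨t, ⟨h1, _⟩, h2⟩ := den_loop_ind S b (i := 10) (n := 2) (s := s0)
      (A := rop .mul 8 8 9) (fun k t => t.r 8 = 3 * (4 / δ) ^ k ∧ t.r 9 = 4 / δ)
      (by simp [h0]) (by
        rintro k t _ ⟨h1, h2⟩
        simp [den, ROp.fn, h1, h2, pow_succ, mul_assoc])
    have : s6 = den S b (loop 10 2 (rop .mul 8 8 9)) s0 := rfl
    rw [this, h2, Mem.setN_r, h1, h0.2.2]
  have q7 : s'.n 3 = trialNumber δ T := by simp [hs7, den, q6, trialNumber]
  have rr : ∀ {v}, v ∉ sizesCmd.wr → s'.r v = s.r v := fun hv => den_r_of_notMem _ _ _ _ hv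
  have nn : ∀ {v}, v ∉ sizesCmd.wn → s'.n v = s.n v := fun hv => den_n_of_notMem _ _ _ _ hv
  have r5' : ∀ {v}, v ∉ [8, 9] → s'.r v = s5.r v := fun {v} hv => by
    rw [hs7, den_r_of_notMem _ _ _ _ (by simp [Cmd.wr]), hs6, den_r_of_notMem _ _ _ _ (by
      simp [trialNumberCmd, block, Cmd.wr]; simp at hv; omega)]
  have n5' : ∀ {v}, v ∉ [7, 10, 3] → s'.n v = s5.n v := fun {v} hv => by
    rw [hs7, den_n_of_notMem _ _ _ _ (by simp [Cmd.wn]; simp at hv; omega), hs6,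
      den_n_of_notMem _ _ _ _ (by simp [trialNumberCmd, block, Cmd.wn]; simp at hv; omega)]
  refine ⟨⟨?_, ?_, ?_, ?_, ?_, ?_, ?_, ?_, ?_, fun j => ?_, ?_, ?_⟩, ?_, ?_, ?_, q7, ?_, ?_, ?_, ?_⟩
  · rw [nn (by decide), hs.n0]
  · rw [nn (by decide), hs.n6]
  · rw [rr (by decide), hs.r0]
  · rw [rr (by decide), hs.r2]
  · rw [rr (by decide), hs.r3]
  · rw [rr (by decide), hs.r4]
  · rw [rr (by decide), hs.r6]
  · rw [rr (by decide), hs.r17]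
  · rw [r5' (by decide), q54]
  · have : s'.a 4 = s.a 4 := den_a_of_notMem _ _ _ _ (by decide)
    rw [this, hs.a4]
  · have : s'.draws = s.draws := den_draws_of_noDraw _ _ _ _ (by decide)
    rw [this, hs.draws]
  · have : s'.flips = s.flips := den_flips_of_noFlip _ _ _ _ (by decide)
    rw [this, hs.flips]
  · rw [rr (by decide), h18]
  · rw [n5' (by decide), hs5, den_n_of_notMem _ _ _ _ (by decide), q4]
  · rw [n5' (by decide), q56]
  · rw [n5' (by decide), q51]
  · rw [r5' (by decide), q53]
  · rw [r5' (by decide), q52]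
  · have c1 : cost S b lengthCmd s ≤ 11 := cost_le_costB S b s.n (B := []) _ s (by decide)
      (by decide) (by decide) (by simp)
    have c2 : cost S b sampleSizeCmd s2 ≤ 17 := cost_le_costB S b s2.n (B := []) _ s2 (by decide)
      (by decide) (by decide) (by simp)
    have c3 : cost S b thresholdCmd s4 ≤ 21 := cost_le_costB S b s4.n (B := []) _ s4 (by decide)
      (by decide) (by decide) (by simp)
    have c4 : cost S b trialNumberCmd s5 ≤ 15 + 7 * T := by
      refine (cost_le_costB S b s5.n (B := [2]) _ s5 (by decide)
        (by decide) (by decide) (by simp)).trans ?_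
      simp only [trialNumberCmd, block, costB, q56]
      omega
    simp only [sizesCmd, block, cost]
    rw [← hs1, ← hs2, ← hs3, ← hs4, ← hs5, ← hs6, q1.1, q3.1, q6]
    have e1 : ⌈32 * h / (u * u)⌉₊ + 1 = T := rfl
    have e2 : ⌈57600 * h / (ε * ε * (u * u))⌉₊ = sampleSize h u ε := rfl
    have e3 : ⌈3 * (4 / δ) ^ T⌉₊ = trialNumber δ T := rfl
    rw [e2, e3]
    omega

end
end MarginLearning

/-! ### Initialization for the two kinds of norms -/

namespace MarginLearning
open RealRAM RealRAM.Cmd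

/-- The memory cells in which the link program for finite exponents expects its parameters. -/
noncomputable def LpParams.env (P : LpParams) : ℕ → ℝ
  | 20 => P.b
  | 21 => P.c
  | 22 => P.A
  | 23 => P.ρ
  | 24 => P.p - 1
  | 25 => 1 - 1 / P.p
  | _ => 0

/-- The bound `3 * p` on the potentials. -/
def lpBoundCmd : Cmd := block [nconst 7 3, rofNat 8 7, rop .mul 18 8 4]

/-- Computes the real parameters of the link and prepares its number of rounds. -/
def lpEnvCmd : Cmd := block [
  nconst 7 8, rofNat 8 7, rop .div 8 40 8, rop .add 23 6 8,
  rop .sub 24 4 6, rop .div 25 6 4, rop .sub 25 6 25,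
  rofNat 9 0, rop .div 22 9 8, rop .div 21 18 40, rop .div 21 21 22,
  rop .add 9 6 4, nconst 7 4, rofNat 10 7, rop .mul 9 9 10, rop .div 9 8 9, rop .add 20 6 9,
  rofNat 10 2, rop .mul 10 10 22, rop .div 10 10 9]

/-- Prepares the second part of the number of rounds of the link. -/
def lpRoundsCmd : Cmd := block [rofNat 10 5, rop .mul 10 10 4]

/-- Computes all parameters for a finite exponent. -/
def lpInitCmd : Cmd := block [
  readCmd, lpBoundCmd, sizesCmd, lpEnvCmd, ceil 5 10, lpRoundsCmd, ceil 7 10, nadd 5 5 7]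

/-- Computes six times the least exponent of a power of two that is at least `2 * d`. -/
def softBoundCmd : Cmd := block [
  rcopy 26 6, rcopy 27 17, rofNat 8 0, rop .add 8 8 8,
  loop 10 0 (ifLt 26 8 (block [rop .add 26 26 26, rop .add 27 27 6]) skip),
  nconst 7 6, rofNat 8 7, rop .mul 18 8 27]

/-- Computes the parameters of the link for the exponent `∞`. -/
def softEnvCmd : Cmd := block [
  nconst 7 3, rofNat 8 7, rop .div 8 40 8, rop .add 20 6 8, nadd 5 2 6]

/-- Computes all parameters for the exponent `∞`. -/
def softInitCmd : Cmd := block [readCmd, softBoundCmd, sizesCmd, softEnvCmd]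

section
variable (S : ℕ → (ℕ → ℝ) × ℝ) (b : ℕ → Bool) {d : ℕ} {γ ν δ ε p h u : ℝ}

lemma ReadOK.of_frame {s : Mem} (hs : ReadOK d γ δ ε p u s) (c : Cmd)
    (hn : ∀ v ∈ [0, 6], v ∉ c.wn) (hr : ∀ v ∈ [0, 2, 3, 4, 6, 17, 40], v ∉ c.wr) (ha : 4 ∉ c.wa)
    (hd : c.noDraw = true) (hf : c.noFlip = true) : ReadOK d γ δ ε p u (den S b c s) where
  n0 := by rw [den_n_of_notMem _ _ _ _ (hn _ (by simp)), hs.n0]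
  n6 := by rw [den_n_of_notMem _ _ _ _ (hn _ (by simp)), hs.n6]
  r0 := by rw [den_r_of_notMem _ _ _ _ (hr _ (by simp)), hs.r0]
  r2 := by rw [den_r_of_notMem _ _ _ _ (hr _ (by simp)), hs.r2]
  r3 := by rw [den_r_of_notMem _ _ _ _ (hr _ (by simp)), hs.r3]
  r4 := by rw [den_r_of_notMem _ _ _ _ (hr _ (by simp)), hs.r4]
  r6 := by rw [den_r_of_notMem _ _ _ _ (hr _ (by simp)), hs.r6]
  r17 := by rw [den_r_of_notMem _ _ _ _ (hr _ (by simp)), hs.r17]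
  r40 := by rw [den_r_of_notMem _ _ _ _ (hr _ (by simp)), hs.r40]
  a4 := by rw [den_a_of_notMem _ _ _ _ ha]; exact hs.a4
  draws := by rw [den_draws_of_noDraw _ _ _ _ hd, hs.draws]
  flips := by rw [den_flips_of_noFlip _ _ _ _ hf, hs.flips]

set_option maxHeartbeats 800000 in
/-- Initialization for a finite exponent, and its running time. -/
lemma den_lpInit :
    let T := trialLength (3 * p) (ν * γ)
    let m := sampleSize (3 * p) (ν * γ) ε
    let R := trialNumber δ T
    let P := lpParams p (ν * γ / 8) d T
    Initialized d m T R (m + 1) P.K P.env ((1 - ν / 2) * γ)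
      (den S b lpInitCmd (initMem d [γ, ν, δ, ε, p])) ∧
    cost S b lpInitCmd (initMem d [γ, ν, δ, ε, p]) ≤ 300 + 13 * T + 6 * m + 6 * R + 6 * P.K := by
  intro T m R P
  set s1 := den S b readCmd (initMem d [γ, ν, δ, ε, p]) with hs1
  set s2 := den S b lpBoundCmd s1 with hs2
  set s3 := den S b sizesCmd s2 with hs3
  set s4 := den S b lpEnvCmd s3 with hs4
  set s5 := den S b (ceil 5 10) s4 with hs5
  set s6 := den S b lpRoundsCmd s5 with hs6
  set s7 := den S b (ceil 7 10) s6 with hs7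
  set s8 := den S b (nadd 5 5 7) s7 with hs8
  have hden : den S b lpInitCmd (initMem d [γ, ν, δ, ε, p]) = s8 := rfl
  have o1 : ReadOK d γ δ ε p (ν * γ) s1 := den_read S b (by simp) (by simp) (by simp) (by simp)
    (by simp) (by simp)
  have o2 : ReadOK d γ δ ε p (ν * γ) s2 := o1.of_frame S b _ (by decide) (by decide) (by decide)
    (by decide) (by decide)
  have h18 : s2.r 18 = 3 * p := by simp [hs2, lpBoundCmd, block, den, ROp.fn, o1.r4]
  obtain ⟨o3, g18, g1, g2, g3, g4, g5, g12, gc⟩ := den_sizes S b o2 h18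
  rw [← hs3] at o3 g18 g1 g2 g3 g4 g5 g12
  have q4 : s4.r 20 = P.b ∧ s4.r 21 = P.c ∧ s4.r 22 = P.A ∧ s4.r 23 = P.ρ ∧ s4.r 24 = P.p - 1 ∧
      s4.r 25 = 1 - 1 / P.p ∧ s4.r 10 = T * (d / (ν * γ / 8 / 8)) /
        (ν * γ / 8 / 8 / ((1 + p) * 4)) := by
    simp [hs4, lpEnvCmd, block, den, ROp.fn, o3.r40, o3.r6, o3.r4, o3.n0, g18, g2, P, lpParams, T]
  set K₁ := ⌈T * (d / (ν * γ / 8 / 8)) / (ν * γ / 8 / 8 / ((1 + p) * 4))⌉₊ with hK₁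
  have hK : P.K = K₁ + ⌈(K₁ : ℝ) * p⌉₊ := rfl
  have q5 : s5.n 5 = K₁ := by simp [hs5, den, q4, hK₁]
  have q6 : s6.r 10 = K₁ * p ∧ s6.n 5 = K₁ := by
    simp [hs6, lpRoundsCmd, block, den, ROp.fn, q5]
    left; simp [hs5, den, hs4, lpEnvCmd, block, o3.r4]
  have q8 : s8.n 5 = P.K := by simp [hs8, hs7, den, q6, hK]
  have r8 : ∀ {v}, v ≠ 10 → s8.r v = s4.r v := fun {v} hv => by
    simp [hs8, hs7, hs6, hs5, den, lpRoundsCmd, block, hv]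
  have r83 : ∀ {v}, v ∉ [8, 9, 10, 20, 21, 22, 23, 24, 25] → s8.r v = s3.r v := fun {v} hv => by
    rw [r8 (by simp at hv; omega), hs4, den_r_of_notMem _ _ _ _ (by
      simp [lpEnvCmd, block, Cmd.wr]; simp at hv; omega)]
  have n8 : ∀ {v}, v ∉ [5, 7] → s8.n v = s3.n v := fun {v} hv => by
    simp only [List.mem_cons, List.not_mem_nil, or_false, not_or] at hv
    simp [hs8, hs7, hs6, hs5, hs4, den, lpRoundsCmd, lpEnvCmd, block, hv]
  have a8 : s8.a = s3.a := by
    simp [hs8, hs7, hs6, hs5, hs4, den, lpRoundsCmd, lpEnvCmd, block]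
  have d8 : s8.draws = s3.draws := by
    simp [hs8, hs7, hs6, hs5, hs4, den, lpRoundsCmd, lpEnvCmd, block]
  have f8 : s8.flips = s3.flips := by
    simp [hs8, hs7, hs6, hs5, hs4, den, lpRoundsCmd, lpEnvCmd, block]
  rw [hden]
  refine ⟨⟨?_, ?_, ?_, ?_, ?_, q8, ?_, ?_, ?_, ?_, ?_, ?_, ?_, ?_, ?_⟩, ?_⟩
  · rw [n8 (by decide), o3.n0]
  · rw [n8 (by decide), g1]
  · rw [n8 (by decide), g2]
  · rw [n8 (by decide), g3]
  · rw [n8 (by decide), g4]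
  · rw [n8 (by decide), o3.n6]
  · rw [r83 (by decide), g5]; ring
  · rw [r83 (by decide), o3.r6]
  · rw [r83 (by decide), g12]
  · rw [r83 (by decide), o3.r17]
  · obtain ⟨e0, e1, e2, e3, e4, e5, _⟩ := q4
    simp [r8, e0, e1, e2, e3, e4, e5, LpParams.env]
  · rw [a8]; exact o3.a4
  · rw [d8, o3.draws]
  · rw [f8, o3.flips]
  · have c1 : cost S b readCmd (initMem d [γ, ν, δ, ε, p]) ≤ 67 :=
      (cost_le_costB S b (initMem d [γ, ν, δ, ε, p]).n (B := []) readCmd _ (by decide) (by decide)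
        (by decide) (by simp)).trans (by simp [readCmd, block, costB])
    have c2 : cost S b lpBoundCmd s1 ≤ 7 :=
      (cost_le_costB S b s1.n (B := []) lpBoundCmd _ (by decide) (by decide)
        (by decide) (by simp)).trans (by simp [lpBoundCmd, block, costB])
    have c4 : cost S b lpEnvCmd s3 ≤ 41 :=
      (cost_le_costB S b s3.n (B := []) lpEnvCmd _ (by decide) (by decide)
        (by decide) (by simp)).trans (by simp [lpEnvCmd, block, costB])
    have c6 : cost S b lpRoundsCmd s5 ≤ 5 :=
      (cost_le_costB S b s5.n (B := []) lpRoundsCmd _ (by decide) (by decide)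
        (by decide) (by simp)).trans (by simp [lpRoundsCmd, block, costB])
    simp only [lpInitCmd, block, cost]
    rw [← hs1, ← hs2, ← hs3, ← hs4, ← hs5, ← hs6, q4.2.2.2.2.2.2, q6.1]
    rw [hK]
    change cost S b sizesCmd s2 ≤ 100 + 13 * T + 6 * m + 6 * R at gc
    omega

/-- The logarithm of `2 * d` to the base two, rounded up. -/
noncomputable def ceilLog (d : ℕ) : ℝ := (climb 2 (2 * d) 1 d).2

lemma ceilLog_spec (hd : 2 ≤ d) : Real.log (2 * d) ≤ ceilLog d ∧ ceilLog d ≤ 5 * Real.log d := by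
  obtain ⟨n, hn, h1, h2, h3⟩ := climb_spec 2 (2 * d) 1 d
  have hd' : (2 : ℝ) ≤ d := by exact_mod_cast hd
  have hc : ceilLog d = n := by rw [ceilLog, h1]; simp
  have hlog2 := Real.log_two_gt_d9
  have hlog2' := Real.log_two_lt_d9
  have hlogd : Real.log 2 ≤ Real.log d := Real.log_le_log (by norm_num) hd'
  have hpow : 2 * (d : ℝ) ≤ 2 ^ n := by
    rcases h2 with h2 | rfl
    · exact h2
    · have : ∀ k : ℕ, 2 ≤ k → 2 * k ≤ 2 ^ k := by
        intro k hk
        induction k, hk using Nat.le_induction with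
        | base => norm_num
        | succ k hk ih => rw [pow_succ]; omega
      exact_mod_cast this _ hd
  rw [hc]
  constructor
  · calc Real.log (2 * d) ≤ Real.log (2 ^ n) := Real.log_le_log (by positivity) hpow
      _ = n * Real.log 2 := Real.log_pow _ _
      _ ≤ n * 1 := by gcongr; linarith
      _ = n := mul_one _
  · rcases h3 with rfl | ⟨l, rfl, hl⟩
    · push_cast; linarith
    · have h4 : Real.log (2 ^ l) ≤ Real.log (2 * d) := Real.log_le_log (by positivity) hl.le
      rw [Real.log_pow, Real.log_mul (by norm_num) (by positivity)] at h4
      have h5 : (l : ℝ) * Real.log 2 ≤ (3 * Real.log d) * Real.log 2 := by nlinarith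
      have h6 := le_of_mul_le_mul_right h5 (by linarith)
      push_cast
      linarith

set_option maxHeartbeats 800000 in
/-- Initialization for the exponent `∞`, and its running time. -/
lemma den_softInit :
    let T := trialLength (6 * ceilLog d) (ν * γ)
    let m := sampleSize (6 * ceilLog d) (ν * γ) ε
    let R := trialNumber δ T
    Initialized d m T R (m + 1) T (fun v => if v = 20 then 1 + ν * γ / 8 / 3 else 0)
      ((1 - ν / 2) * γ) (den S b softInitCmd (initMem d [γ, ν, δ, ε])) ∧
    cost S b softInitCmd (initMem d [γ, ν, δ, ε]) ≤
      300 + 13 * T + 6 * m + 6 * R + 13 * d := by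
  intro T m R
  set s1 := den S b readCmd (initMem d [γ, ν, δ, ε]) with hs1
  set s2 := den S b softBoundCmd s1 with hs2
  set s3 := den S b sizesCmd s2 with hs3
  set s4 := den S b softEnvCmd s3 with hs4
  have hden : den S b softInitCmd (initMem d [γ, ν, δ, ε]) = s4 := rfl
  have o1 : ReadOK d γ δ ε 0 (ν * γ) s1 := den_read S b (by simp) (by simp) (by simp) (by simp)
    (by simp) (by simp)
  have o2 : ReadOK d γ δ ε 0 (ν * γ) s2 := o1.of_frame S b _ (by decide) (by decide) (by decide)
    (by decide) (by decide)
  have h18 : s2.r 18 = 6 * ceilLog d := by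
    set l := loop 10 0 (ifLt 26 8 (block [rop .add 26 26 26, rop .add 27 27 6]) skip) with hl
    set s0 := den S b (block [rcopy 26 6, rcopy 27 17, rofNat 8 0, rop .add 8 8 8]) s1 with hs0
    have h0 : s0.r 26 = 1 ∧ s0.r 27 = 0 ∧ s0.r 8 = 2 * d ∧ s0.r 6 = 1 ∧ s0.n 0 = d := by
      simp [hs0, block, den, ROp.fn, o1.r6, o1.r17, o1.n0, two_mul]
    obtain ⟨t, ⟨_, h1, _⟩, h2⟩ := den_loop_ind S b (i := 10) (n := 0) (s := s0)
      (A := ifLt 26 8 (block [rop .add 26 26 26, rop .add 27 27 6]) skip)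
      (fun k t => t.r 26 = (climb 2 (2 * d) 1 k).1 ∧ t.r 27 = (climb 2 (2 * d) 1 k).2 ∧
        t.r 8 = 2 * d ∧ t.r 6 = 1)
      (by simp [h0, climb, iter]) (by
        rintro k t _ ⟨h1, h2, h3, h4⟩
        rw [climb] at h1 h2 ⊢
        simp only [iter, den, Mem.setN_r, h3]
        rw [← h1]
        by_cases hlt : t.r 26 < 2 * d
        · simp [hlt, block, den, ROp.fn, h2, h3, h4, mul_two]
        · simp only [if_neg hlt]
          exact ⟨h1, h2, h3, h4⟩)
    have : s2 = den S b (block [nconst 7 6, rofNat 8 7, rop .mul 18 8 27]) (den S b l s0) := rfl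
    have h3 : (den S b l s0).r 27 = ceilLog d := by
      rw [h2, Mem.setN_r, h1, h0.2.2.2.2, ceilLog]
    rw [this]
    simp [block, den, ROp.fn, h3]
  obtain ⟨o3, g18, g1, g2, g3, g4, g5, g12, gc⟩ := den_sizes S b o2 h18
  rw [← hs3] at o3 g18 g1 g2 g3 g4 g5 g12
  have q4 : s4.r 20 = 1 + ν * γ / 8 / 3 ∧ s4.n 5 = T := by
    simp [hs4, softEnvCmd, block, den, ROp.fn, o3.r40, o3.r6, o3.n6, g2, T]
  have zero : ∀ v ∈ [21, 22, 23, 24, 25], s4.r v = 0 := by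
    intro v hv
    have : (initMem d [γ, ν, δ, ε]).r v = 0 := by
      change [γ, ν, δ, ε].getD (8 * v) 0 = 0
      refine List.getD_eq_default _ _ ?_
      simp at hv ⊢; omega
    rw [← this, ← hden]
    refine den_r_of_notMem _ _ _ _ ?_
    clear this
    revert hv; revert v; decide
  have r8 : ∀ {v}, v ∉ [8, 20] → s4.r v = s3.r v := fun {v} hv => by
    simp only [List.mem_cons, List.not_mem_nil, or_false, not_or] at hv
    simp [hs4, den, softEnvCmd, block, hv]
  have n8 : ∀ {v}, v ∉ [5, 7] → s4.n v = s3.n v := fun {v} hv => by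
    simp only [List.mem_cons, List.not_mem_nil, or_false, not_or] at hv
    simp [hs4, den, softEnvCmd, block, hv]
  rw [hden]
  refine ⟨⟨?_, ?_, ?_, ?_, ?_, q4.2, ?_, ?_, ?_, ?_, ?_, ?_, ?_, ?_, ?_⟩, ?_⟩
  · rw [n8 (by decide), o3.n0]
  · rw [n8 (by decide), g1]
  · rw [n8 (by decide), g2]
  · rw [n8 (by decide), g3]
  · rw [n8 (by decide), g4]
  · rw [n8 (by decide), o3.n6]
  · rw [r8 (by decide), g5]; ring
  · rw [r8 (by decide), o3.r6]
  · rw [r8 (by decide), g12]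
  · rw [r8 (by decide), o3.r17]
  · intro v hv
    rcases List.mem_cons.1 hv with rfl | hv
    · simpa using q4.1
    · rw [zero v hv, if_neg (by rintro rfl; simp at hv)]
  · have : s4.a = s3.a := by simp [hs4, den, softEnvCmd, block]
    rw [this]; exact o3.a4
  · have : s4.draws = s3.draws := by simp [hs4, den, softEnvCmd, block]
    rw [this, o3.draws]
  · have : s4.flips = s3.flips := by simp [hs4, den, softEnvCmd, block]
    rw [this, o3.flips]
  · have c1 : cost S b readCmd (initMem d [γ, ν, δ, ε]) ≤ 67 :=
      (cost_le_costB S b (initMem d [γ, ν, δ, ε]).n (B := []) readCmd _ (by decide) (by decide)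
        (by decide) (by simp)).trans (by simp [readCmd, block, costB])
    have c2 : cost S b softBoundCmd s1 ≤ 19 + 13 * d := by
      refine (cost_le_costB S b s1.n (B := [0]) _ s1 (by decide)
        (by decide) (by decide) (by simp)).trans ?_
      simp only [softBoundCmd, block, costB, o1.n0]
      omega
    have c4 : cost S b softEnvCmd s3 ≤ 11 :=
      (cost_le_costB S b s3.n (B := []) softEnvCmd _ (by decide) (by decide)
        (by decide) (by simp)).trans (by simp [softEnvCmd, block, costB])
    simp only [softInitCmd, block, cost]
    rw [← hs1, ← hs2, ← hs3]
    change cost S b sizesCmd s2 ≤ 100 + 13 * T + 6 * m + 6 * R at gc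
    omega

end
end MarginLearning

/-! ### Bounds on samples and time -/

namespace MarginLearning
open RealRAM RealRAM.Cmd

lemma trialLength_bound {h γ ν : ℝ} (hγ : 0 < γ) (hν : 0 < ν) :
    h / (ν * γ / 8) + trialLength h (ν * γ) * ((1 - ν / 2) * γ + 2 * (ν * γ / 8)) <
      trialLength h (ν * γ) * γ := by
  have hu : 0 < ν * γ := mul_pos hν hγ
  have h1 : 32 * h / (ν * γ * (ν * γ)) < trialLength h (ν * γ) := by
    rw [trialLength]; push_cast
    exact (Nat.le_ceil _).trans_lt (lt_add_one _)
  rw [div_lt_iff₀ (by positivity)] at h1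
  have h2 : h / (ν * γ / 8) < trialLength h (ν * γ) * (ν * γ / 4) := by
    rw [div_lt_iff₀ (by positivity)]; linarith
  linarith

lemma trialNumber_bound {δ : ℝ} (hδ : 0 < δ) (T : ℕ) : 3 ≤ trialNumber δ T * (δ / 4) ^ T := by
  have h := Nat.le_ceil (3 * (4 / δ) ^ T)
  calc (3 : ℝ) = 3 * (4 / δ) ^ T * (δ / 4) ^ T := by
        rw [mul_assoc, ← mul_pow, div_mul_div_comm, mul_comm δ 4, div_self (by positivity), one_pow,
          mul_one]
    _ ≤ _ := by rw [trialNumber]; gcongr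

lemma sampleSize_bound (h ε ν γ : ℝ) :
    57600 * (h / (ε ^ 2 * ν ^ 2 * γ ^ 2)) ≤ sampleSize h (ν * γ) ε := by
  refine le_of_eq_of_le ?_ (Nat.le_ceil _)
  rw [← mul_div_assoc]; congr 1; ring

/-- Absorption of all polynomial factors, apart from those in `y`, into the exponential one. -/
lemma time_le {u Λ y : ℝ} (hu : 2 ≤ u) (hΛ : 1 / 2 ≤ Λ) (hy : 1 ≤ y) {d m T R K : ℕ}
    (hd : (d : ℝ) ≤ u ^ (2 * Λ) * y) (hm : (m : ℝ) ≤ 2 ^ 21 * Λ * y ^ 2) (hT : (T : ℝ) ≤ 1000 * Λ)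
    (hR : (R : ℝ) ≤ 3 * (2 * u) ^ T + 1) (hK : (K : ℝ) ≤ 2 ^ 23 * Λ ^ 3 * y) :
    1500 * ((d : ℝ) + m + T + R + (m + 1) + K + 1) ^ 4 ≤ u ^ (8062 * Λ) * y ^ 8 := by
  have hu0 : 0 < u := by linarith
  set v := u ^ Λ with hv
  have hv0 : 0 < v := Real.rpow_pos_of_pos hu0 _
  have hpow : ∀ n : ℕ, u ^ ((n : ℝ) * Λ) = v ^ n := fun n => by
    rw [mul_comm, Real.rpow_mul_natCast hu0.le]
  have hv2 : 2 ≤ v ^ 2 := by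
    rw [← hpow 2]
    calc (2 : ℝ) ≤ u := hu
      _ = u ^ (1 : ℝ) := (Real.rpow_one u).symm
      _ ≤ _ := Real.rpow_le_rpow_of_exponent_le (by linarith) (by push_cast; linarith)
  have hv1 : 1 ≤ v := by nlinarith
  have hΛv : Λ ≤ v := by
    have h1 : 1 + Λ * (u - 1) ≤ u ^ Λ ∨ Λ < 1 := by
      rcases le_or_gt 1 Λ with h | h
      · left
        have := one_add_mul_self_le_rpow_one_add (s := u - 1) (by linarith) h
        simpa using this
      · exact .inr h
    rcases h1 with h1 | h1
    · nlinarith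
    · linarith
  have two : ∀ k : ℕ, (2 : ℝ) ^ k ≤ v ^ (2 * k) := fun k => by
    rw [pow_mul]; gcongr
  have mono : ∀ {a b : ℕ}, a ≤ b → v ^ a ≤ v ^ b := fun h => pow_le_pow_right₀ hv1 h
  have hy2 : 1 ≤ y ^ 2 := one_le_pow₀ hy
  have hyy : y ≤ y ^ 2 := by nlinarith
  set X := v ^ 2004 * y ^ 2 with hX
  have b1 : (1 : ℝ) ≤ X := one_le_mul_of_one_le_of_one_le (one_le_pow₀ hv1) hy2
  have bd : (d : ℝ) ≤ X := hd.trans (by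
    have : u ^ (2 * Λ) = v ^ 2 := by exact_mod_cast hpow 2
    rw [this]
    exact mul_le_mul (mono (by norm_num)) hyy (by linarith) (by positivity))
  have bm : (m : ℝ) ≤ X := hm.trans (by
    refine mul_le_mul_of_nonneg_right ?_ (by positivity)
    calc (2 : ℝ) ^ 21 * Λ ≤ v ^ (2 * 21) * v := by gcongr; exact two 21
      _ = v ^ 43 := by rw [← pow_succ]
      _ ≤ _ := mono (by norm_num))
  have bT : (T : ℝ) ≤ X := hT.trans (by
    calc 1000 * Λ ≤ 2 ^ 10 * Λ := by nlinarith
      _ ≤ v ^ (2 * 10) * v := by gcongr; exact two 10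
      _ = v ^ 21 := by rw [← pow_succ]
      _ ≤ v ^ 2004 := mono (by norm_num)
      _ ≤ X := le_mul_of_one_le_right (by positivity) hy2)
  have bR : (R : ℝ) ≤ X := hR.trans (by
    have h1 : (2 * u) ^ T ≤ v ^ 2000 := by
      calc (2 * u) ^ T ≤ (u ^ 2) ^ T := by gcongr; nlinarith
        _ = u ^ ((2 * T : ℕ) : ℝ) := by rw [← pow_mul, Real.rpow_natCast]
        _ ≤ u ^ (((2000 : ℕ) : ℝ) * Λ) :=
            Real.rpow_le_rpow_of_exponent_le (by linarith) (by push_cast; linarith)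
        _ = v ^ 2000 := hpow 2000
    have h2 : (1 : ℝ) ≤ v ^ 2000 := one_le_pow₀ hv1
    calc 3 * (2 * u) ^ T + 1 ≤ 2 ^ 2 * v ^ 2000 := by linarith
      _ ≤ v ^ (2 * 2) * v ^ 2000 := by gcongr; exact two 2
      _ = v ^ 2004 := by rw [← pow_add]
      _ ≤ X := le_mul_of_one_le_right (by positivity) hy2)
  have bK : (K : ℝ) ≤ X := hK.trans (by
    refine mul_le_mul ?_ hyy (by linarith) (by positivity)
    calc (2 : ℝ) ^ 23 * Λ ^ 3 ≤ v ^ (2 * 23) * v ^ 3 := by gcongr; exact two 23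
      _ = v ^ 49 := by rw [← pow_add]
      _ ≤ _ := mono (by norm_num))
  have hsum : (d : ℝ) + m + T + R + (m + 1) + K + 1 ≤ 2 ^ 3 * X := by linarith
  have h0 : 0 ≤ (d : ℝ) + m + T + R + (m + 1) + K + 1 := by positivity
  calc 1500 * ((d : ℝ) + m + T + R + (m + 1) + K + 1) ^ 4 ≤ 2 ^ 11 * (2 ^ 3 * X) ^ 4 := by
        have : ((d : ℝ) + m + T + R + (m + 1) + K + 1) ^ 4 ≤ (2 ^ 3 * X) ^ 4 := by gcongr
        have h3 : (0 : ℝ) ≤ (2 ^ 3 * X) ^ 4 := by positivity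
        linarith
    _ = 2 ^ 23 * (v ^ 2004) ^ 4 * y ^ 8 := by rw [hX]; ring
    _ ≤ v ^ (2 * 23) * (v ^ 2004) ^ 4 * y ^ 8 := by gcongr; exact two 23
    _ = v ^ 8062 * y ^ 8 := by rw [← pow_mul, ← pow_add]
    _ = _ := by rw [← hpow 8062]; norm_num

end MarginLearning

/-! ### The two learners -/

namespace MarginLearning
open RealRAM RealRAM.Cmd

lemma linkSyntax_lp : LinkSyntax lpLinkCmd where
  wf := by simp [lpLinkCmd, powCmd, raiseCmd, absCmd, block, WF, Cmd.wn]
  noDraw := by decide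
  noCeil := by decide
  bounds := by decide

lemma linkSyntax_soft : LinkSyntax softLinkCmd where
  wf := by simp [softLinkCmd, raiseCmd, absCmd, block, WF, Cmd.wn]
  noDraw := by decide
  noCeil := by decide
  bounds := by decide

/-- The trials nest four loops (trials, steps, and two loops over examples, coordinates or rounds),
so the running time is of order `N ^ 4` in the sum `N` of the loop bounds. The terms `18 * d + 7`
pay for the output phase. -/
lemma cost_learn_le {p : ℝ≥0∞} {d m T R K : ℕ} {e : ℕ → ℝ} {γ₁ : ℝ} {init lnk : Cmd}
    {params : List ℝ} {L : (Fin d → ℝ) → Fin d → ℝ} (S : ℕ → Example p d) (r : ℕ → Bool)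
    (hl : IsLink lnk K e L) (hs : LinkSyntax lnk) (hdepth : (trialsCmd lnk).depth = 4)
    (hsize : (trialsCmd lnk).size ≤ 1000)
    (hi : Initialized d m T R (m + 1) K e γ₁
      (den (fun n => encode (S n)) r init (initMem d params)))
    (hc : cost (fun n => encode (S n)) r init (initMem d params) ≤
      300 + 13 * T + 6 * m + 6 * R + 6 * K + 13 * d) :
    cost (fun n => encode (S n)) r (learnCmd init lnk) (initMem d params) + 18 * d + 7 ≤
      1500 * (d + m + T + R + (m + 1) + K + 1) ^ 4 := by
  have h1 := cost_learn S r hl hs hi (N := d + m + T + R + (m + 1) + K + 1) (by omega) (by omega)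
    (by omega) (by omega) (by omega) (by omega) (by omega)
  set N := d + m + T + R + (m + 1) + K + 1 with hN
  rw [hdepth] at h1
  have h2 : (trialsCmd lnk).size * N ^ 4 ≤ 1000 * N ^ 4 := Nat.mul_le_mul_right _ hsize
  have h3 : sampleCmd.size * N ^ 2 ≤ 100 * N ^ 4 :=
    Nat.mul_le_mul (by decide) (Nat.pow_le_pow_right (by omega) (by norm_num))
  have h4 : N ≤ N ^ 4 := Nat.le_self_pow (by norm_num) N
  omega

/-- The learner for finite `p`, with explicit constants. -/
lemma learner_lp {p γ ν δ ε : ℝ} {d : ℕ} (hp : 2 ≤ p) (hγ : 0 < γ) (hγ1 : γ < 1) (hν : 0 < ν)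
    (hν1 : ν < 1) (hδ : 0 < δ) (hδ1 : δ < 1) (hε : 0 < ε) (hε1 : ε < 1) (hd : 1 ≤ d) :
    IsProperRobustLearner (learnCmd lpInitCmd lpLinkCmd).toProg [γ, ν, δ, ε, p] (ENNReal.ofReal p) d
      γ ν (1 + δ) ε (1 / 3) (2 ^ 20 * (p / (ε ^ 2 * ν ^ 2 * γ ^ 2)))
      ((2 / δ) ^ (8062 * (p / (ν ^ 2 * γ ^ 2))) * (d / ε) ^ 8) := by
  have : Fact (1 ≤ ENNReal.ofReal p) := ⟨by rw [ENNReal.one_le_ofReal]; linarith⟩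
  have : Fact (1 ≤ (ENNReal.ofReal p).conjExponent) := ⟨by simp [ENNReal.conjExponent]⟩
  have hu : 0 < ν * γ := mul_pos hν hγ
  have hu1 : ν * γ < 1 := mul_lt_one_of_nonneg_of_lt_one_left hν.le hν1 hγ1.le
  set Λ := p / (ν ^ 2 * γ ^ 2) with hΛ
  have hpΛ : p ≤ Λ := by
    rw [hΛ, le_div_iff₀ (by positivity)]
    have : ν ^ 2 * γ ^ 2 ≤ 1 := by rw [← mul_pow]; exact pow_le_one₀ hu.le hu1.le
    nlinarith
  have hΛ2 : 2 ≤ Λ := hp.trans hpΛ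
  set T := trialLength (3 * p) (ν * γ) with hT
  set m := sampleSize (3 * p) (ν * γ) ε with hm
  set R := trialNumber δ T with hR
  set P := lpParams p (ν * γ / 8) d T with hP
  have hd1 : (1 : ℝ) ≤ d := Nat.one_le_cast.2 hd
  have hy1 : 1 ≤ 1 / ε := by rw [le_div_iff₀ hε]; linarith
  have hyd : 1 / ε ≤ d / ε := by gcongr
  have hdy : (d : ℝ) ≤ d / ε := by
    rw [le_div_iff₀ hε]; exact mul_le_of_le_one_right (by linarith) hε1.le
  have hy : 1 ≤ d / ε := hy1.trans hyd
  have hεsq : 1 ≤ 1 / ε ^ 2 := by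
    rw [le_div_iff₀ (by positivity), one_mul]; exact pow_le_one₀ hε.le hε1.le
  have hmreal : (m : ℝ) ≤ 2 ^ 20 * (Λ * (1 / ε ^ 2)) := by
    have h1 := (Nat.ceil_lt_add_one (a := 57600 * (3 * p) / (ε * ε * (ν * γ * (ν * γ))))
      (by positivity)).le
    have h2 : 57600 * (3 * p) / (ε * ε * (ν * γ * (ν * γ))) = 172800 * (Λ * (1 / ε ^ 2)) := by
      rw [hΛ]; field_simp; ring
    rw [h2] at h1
    have h3 : 1 ≤ Λ * (1 / ε ^ 2) := one_le_mul_of_one_le_of_one_le (by linarith) hεsq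
    have h4 : (m : ℝ) = (⌈57600 * (3 * p) / (ε * ε * (ν * γ * (ν * γ)))⌉₊ : ℝ) := rfl
    rw [h4, h2]
    linarith
  have hm0 : 0 < m := Nat.ceil_pos.2 (by positivity)
  have hTreal : (T : ℝ) ≤ 97 * Λ := by
    have h1 := (Nat.ceil_lt_add_one (a := 32 * (3 * p) / (ν * γ * (ν * γ))) (by positivity)).le
    have h2 : 32 * (3 * p) / (ν * γ * (ν * γ)) = 96 * Λ := by rw [hΛ]; field_simp; ring
    rw [h2] at h1
    have h3 : (T : ℝ) = (⌈32 * (3 * p) / (ν * γ * (ν * γ))⌉₊ : ℝ) + 1 := by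
      rw [hT, trialLength]; push_cast; rfl
    rw [h3, h2]
    linarith
  have hT0 : 0 < T := Nat.succ_pos _
  have hRreal : (R : ℝ) ≤ 3 * (2 * (2 / δ)) ^ T + 1 := by
    have h1 := (Nat.ceil_lt_add_one (a := 3 * (4 / δ) ^ T) (by positivity)).le
    have h2 : 2 * (2 / δ) = 4 / δ := by ring
    rw [h2]; exact h1
  have hKreal : (P.K : ℝ) ≤ 2 ^ 23 * Λ ^ 3 * (d / ε) := by
    set x := T * (d / (ν * γ / 8 / 8)) / (ν * γ / 8 / 8 / ((1 + p) * 4)) with hx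
    have hx0 : 0 ≤ x := by positivity
    have hK : (P.K : ℝ) = ⌈x⌉₊ + (⌈(⌈x⌉₊ : ℝ) * p⌉₊ : ℝ) := by
      rw [hP, lpParams]; push_cast; rfl
    have h1 : x ≤ 2 ^ 15 * (T * d * Λ) := by
      have : x = 2 ^ 14 * (T * d) * ((1 + p) / (ν * γ * (ν * γ))) := by
        rw [hx]; field_simp; ring
      rw [this]
      have h2 : (1 + p) / (ν * γ * (ν * γ)) ≤ 2 * Λ := by
        rw [div_le_iff₀ (by positivity)]
        calc 1 + p ≤ 2 * p := by linarith
          _ = _ := by rw [hΛ]; field_simp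
      calc _ ≤ 2 ^ 14 * (T * d) * (2 * Λ) := by gcongr
        _ = _ := by ring
    have h2 := (Nat.ceil_lt_add_one hx0).le
    have h3 := (Nat.ceil_lt_add_one (a := (⌈x⌉₊ : ℝ) * p) (by positivity)).le
    have hT1 : (1 : ℝ) ≤ T := Nat.one_le_cast.2 hT0
    have hTd : 1 ≤ T * d * Λ := one_le_mul_of_one_le_of_one_le
      (one_le_mul_of_one_le_of_one_le hT1 hd1) (by linarith)
    have h4 : (⌈x⌉₊ : ℝ) ≤ 32769 * (T * d * Λ) := by linarith
    have h5 : (⌈x⌉₊ : ℝ) * p ≤ 32769 * (T * d * Λ) * Λ := by gcongr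
    have h6 : T * d * Λ ≤ 97 * Λ ^ 2 * d := by
      calc T * d * Λ ≤ 97 * Λ * d * Λ := by gcongr
        _ = _ := by ring
    have h7 : (P.K : ℝ) ≤ 32769 * (T * d * Λ) * (Λ + 2) := by
      rw [hK]; nlinarith
    calc (P.K : ℝ) ≤ 32769 * (97 * Λ ^ 2 * d) * (Λ + 2) := h7.trans (by gcongr)
      _ ≤ 32769 * (97 * Λ ^ 2 * d) * (2 * Λ) := by gcongr; linarith
      _ ≤ 2 ^ 23 * Λ ^ 3 * d := by
          have : 0 ≤ Λ ^ 3 * d := by positivity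
          nlinarith
      _ ≤ _ := by gcongr
  have htime := time_le (u := 2 / δ) (Λ := Λ) (y := d / ε) (d := d) (m := m) (T := T) (R := R)
    (K := P.K) (by rw [le_div_iff₀ hδ]; linarith) (by linarith) hy
    (hdy.trans (le_mul_of_one_le_left (by positivity) (Real.one_le_rpow (by
      rw [le_div_iff₀ hδ]; linarith) (by linarith))))
    (hmreal.trans (by
      have : 1 / ε ^ 2 ≤ (d / ε) ^ 2 := by
        rw [← one_div_pow]; gcongr
      calc (2 : ℝ) ^ 20 * (Λ * (1 / ε ^ 2)) ≤ 2 ^ 21 * (Λ * (d / ε) ^ 2) := by gcongr <;> norm_num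
        _ = _ := by ring))
    (hTreal.trans (by linarith)) hRreal hKreal
  have hlink : IsLink lpLinkCmd P.K P.env (P.link : (Fin d → ℝ) → Fin d → ℝ) :=
    isLink_lp P rfl rfl rfl rfl rfl rfl
  refine isProperRobustLearner_learnCmd (H := 3 * p) (m := m) (T := T) (R := R) (B := m + 1)
    (K := P.K) (e := P.env) (L := P.link) (κ := 2 * (ν * γ / 8)) (g₀ := 3 * p / (ν * γ / 8))
    hγ hν hν1 hγ1 hδ hδ1 hε hε1 (by linarith)
    (fun w hw x hx => abs_dotProduct_le_one_lp hp hw hx)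
    (fun κ h0 h1 => exists_potential_lp hp h0 h1) hm0 (sampleSize_bound _ _ _ _) ?_ ?_
    (trialNumber_bound hδ T) (stepPotential_lp hp (by positivity) (by linarith) hd hT0)
    (trialLength_bound hγ hν) hlink linkSyntax_lp ?_ (by decide)
    (fun S r => (den_lpInit _ r).1) (fun S r => ?_)
  · refine hmreal.trans (le_of_eq ?_)
    rw [hΛ]; field_simp
  · rw [pow_succ, mul_comm]; exact Nat.mul_le_mul_right _ m.lt_two_pow_self.le
  · simp [lpInitCmd, readCmd, lpBoundCmd, sizesCmd, lengthCmd, sampleSizeCmd, thresholdCmd,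
      trialNumberCmd, lpEnvCmd, lpRoundsCmd, block, WF, Cmd.wn]
  · refine le_trans ?_ htime
    have h := cost_learn_le (params := [γ, ν, δ, ε, p]) (m := m) (R := R) S r hlink linkSyntax_lp
      (by decide) (by decide)
      (den_lpInit (fun n => encode (S n)) r).1
      (((den_lpInit (fun n => encode (S n)) r).2).trans (Nat.le_add_right _ _))
    exact_mod_cast h

/-- The learner for `p = ∞`, with explicit constants. Its running time is a power of `2 / δ` with
exponent of order `log d`, which is rewritten as a power of `d` with exponent of order
`log (2 / δ)`. -/
lemma learner_top {γ ν δ ε : ℝ} {d : ℕ} (hγ : 0 < γ) (hγ1 : γ < 1) (hν : 0 < ν)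
    (hν1 : ν < 1) (hδ : 0 < δ) (hδ1 : δ < 1) (hε : 0 < ε) (hε1 : ε < 1) (hd : 2 ≤ d) :
    IsProperRobustLearner (learnCmd softInitCmd softLinkCmd).toProg [γ, ν, δ, ε] ⊤ d
      γ ν (1 + δ) ε (1 / 3) (2 ^ 21 * (Real.log d / (ε ^ 2 * ν ^ 2 * γ ^ 2)))
      ((d : ℝ) ^ (8062 * (Real.log (2 / δ) / (ν ^ 2 * γ ^ 2))) * (1 / ε) ^ 8) := by
  have : Fact (1 ≤ (⊤ : ℝ≥0∞)) := ⟨le_top⟩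
  have : Fact (1 ≤ (⊤ : ℝ≥0∞).conjExponent) := ⟨by simp [ENNReal.conjExponent]⟩
  have hu : 0 < ν * γ := mul_pos hν hγ
  have hu1 : ν * γ < 1 := mul_lt_one_of_nonneg_of_lt_one_left hν.le hν1 hγ1.le
  have hd0 : 0 < d := by omega
  have hd2 : (2 : ℝ) ≤ d := by exact_mod_cast hd
  obtain ⟨hℓ1, hℓ2⟩ := ceilLog_spec hd
  set ℓ := ceilLog d with hℓ
  set Λ := Real.log d / (ν ^ 2 * γ ^ 2) with hΛ
  have hlog : 1 / 2 ≤ Real.log d := by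
    have := Real.log_le_log (by norm_num) hd2
    have := Real.log_two_gt_d9
    linarith
  have hℓ0 : 1 ≤ ℓ := by
    have h1 : Real.log (2 * d) = Real.log 2 + Real.log d :=
      Real.log_mul (by norm_num) (by positivity)
    have := Real.log_le_log (by norm_num) hd2
    have := Real.log_two_gt_d9
    linarith
  have hlogΛ : Real.log d ≤ Λ := by
    rw [hΛ, le_div_iff₀ (by positivity)]
    have : ν ^ 2 * γ ^ 2 ≤ 1 := by rw [← mul_pow]; exact pow_le_one₀ hu.le hu1.le
    nlinarith
  have hℓΛ : ℓ / (ν * γ * (ν * γ)) ≤ 5 * Λ := by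
    rw [div_le_iff₀ (by positivity)]
    refine hℓ2.trans (le_of_eq ?_)
    rw [hΛ]; field_simp
  have hΛ2 : 1 / 2 ≤ Λ := hlog.trans hlogΛ
  set T := trialLength (6 * ℓ) (ν * γ) with hT
  set m := sampleSize (6 * ℓ) (ν * γ) ε with hm
  set R := trialNumber δ T with hR
  have hy : 1 ≤ 1 / ε := by rw [le_div_iff₀ hε]; linarith
  have hεsq : 1 ≤ 1 / ε ^ 2 := by
    rw [le_div_iff₀ (by positivity), one_mul]; exact pow_le_one₀ hε.le hε1.le
  have hmreal : (m : ℝ) ≤ 2 ^ 21 * (Λ * (1 / ε ^ 2)) := by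
    have h1 := (Nat.ceil_lt_add_one (a := 57600 * (6 * ℓ) / (ε * ε * (ν * γ * (ν * γ))))
      (by positivity)).le
    have h2 : 57600 * (6 * ℓ) / (ε * ε * (ν * γ * (ν * γ))) =
        345600 * (ℓ / (ν * γ * (ν * γ)) * (1 / ε ^ 2)) := by field_simp; ring
    have h3 : 1 / 2 * 1 ≤ Λ * (1 / ε ^ 2) := mul_le_mul hΛ2 hεsq zero_le_one (by linarith)
    have h4 : (m : ℝ) = (⌈57600 * (6 * ℓ) / (ε * ε * (ν * γ * (ν * γ)))⌉₊ : ℝ) := rfl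
    have h5 : ℓ / (ν * γ * (ν * γ)) * (1 / ε ^ 2) ≤ 5 * Λ * (1 / ε ^ 2) := by gcongr
    rw [h4]
    rw [h2] at h1 ⊢
    linarith
  have hm0 : 0 < m := Nat.ceil_pos.2 (by positivity)
  have hTreal : (T : ℝ) ≤ 1000 * Λ := by
    have h1 := (Nat.ceil_lt_add_one (a := 32 * (6 * ℓ) / (ν * γ * (ν * γ))) (by positivity)).le
    have h2 : 32 * (6 * ℓ) / (ν * γ * (ν * γ)) = 192 * (ℓ / (ν * γ * (ν * γ))) := by ring
    have h3 : (T : ℝ) = (⌈32 * (6 * ℓ) / (ν * γ * (ν * γ))⌉₊ : ℝ) + 1 := by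
      rw [hT, trialLength]; push_cast; rfl
    rw [h3]
    rw [h2] at h1 ⊢
    linarith
  have hRreal : (R : ℝ) ≤ 3 * (2 * (2 / δ)) ^ T + 1 := by
    have h1 := (Nat.ceil_lt_add_one (a := 3 * (4 / δ) ^ T) (by positivity)).le
    have h2 : 2 * (2 / δ) = 4 / δ := by ring
    rw [h2]; exact h1
  have hδ2 : 2 ≤ 2 / δ := by rw [le_div_iff₀ hδ]; linarith
  have hdle : (d : ℝ) ≤ (2 / δ) ^ (2 * Λ) * (1 / ε) := by
    have h1 : (d : ℝ) ≤ (2 / δ) ^ (2 * Λ) := by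
      have h2 := Real.log_two_gt_d9
      have h3 := Real.log_le_log (by norm_num) hδ2
      rw [← Real.log_le_log_iff (by positivity) (by positivity),
        Real.log_rpow (by positivity)]
      nlinarith
    exact h1.trans (le_mul_of_one_le_right (by positivity) hy)
  have htime := time_le (u := 2 / δ) (Λ := Λ) (y := 1 / ε) (d := d) (m := m) (T := T) (R := R)
    (K := T) hδ2 hΛ2 hy hdle
    (hmreal.trans (le_of_eq (by rw [one_div_pow]; ring))) hTreal hRreal
    (hTreal.trans (by
      have h0 : 0 ≤ Λ := by linarith
      have h1 : Λ ≤ 4 * Λ ^ 3 := by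
        nlinarith [mul_nonneg h0 (mul_nonneg (show 0 ≤ 2 * Λ - 1 by linarith)
          (show 0 ≤ 2 * Λ + 1 by linarith))]
      have h2 : (0 : ℝ) ≤ 2 ^ 23 * Λ ^ 3 := by positivity
      calc 1000 * Λ ≤ 2 ^ 23 * Λ ^ 3 := by
            have : 0 ≤ Λ ^ 3 := by positivity
            linarith
        _ ≤ _ := le_mul_of_one_le_right h2 hy))
  have hexp : (d : ℝ) ^ (8062 * (Real.log (2 / δ) / (ν ^ 2 * γ ^ 2))) = (2 / δ) ^ (8062 * Λ) := by
    rw [Real.rpow_def_of_pos (by positivity), Real.rpow_def_of_pos (by positivity), hΛ]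
    congr 1; ring
  have hlink : IsLink softLinkCmd T (fun v => if v = 20 then 1 + ν * γ / 8 / 3 else 0)
      (softLink (1 + ν * γ / 8 / 3) T : (Fin d → ℝ) → Fin d → ℝ) := by
    have := isLink_soft (d := d) T (fun v => if v = 20 then 1 + ν * γ / 8 / 3 else 0)
    simpa using this
  refine isProperRobustLearner_learnCmd (H := 6 * ℓ) (m := m) (T := T) (R := R) (B := m + 1)
    (K := T) (κ := 2 * (ν * γ / 8)) (g₀ := 6 * ℓ / (ν * γ / 8))
    hγ hν hν1 hγ1 hδ hδ1 hε hε1 (by linarith)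
    (fun w hw x hx => abs_dotProduct_le_one_top hw hx)
    (fun κ h0 h1 => exists_potential_top h0 h1 hd0 (by linarith)) hm0 (sampleSize_bound _ _ _ _)
    ?_ ?_ (trialNumber_bound hδ T) (stepPotential_soft (by positivity) (by linarith) hd0 hℓ1)
    (trialLength_bound hγ hν) hlink linkSyntax_soft ?_ (by decide)
    (fun S r => (den_softInit _ r).1) (fun S r => ?_)
  · refine hmreal.trans (le_of_eq ?_)
    rw [hΛ]; field_simp
  · rw [pow_succ, mul_comm]; exact Nat.mul_le_mul_right _ m.lt_two_pow_self.le
  · simp [softInitCmd, readCmd, softBoundCmd, sizesCmd, lengthCmd, sampleSizeCmd, thresholdCmd,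
      trialNumberCmd, softEnvCmd, block, WF, Cmd.wn]
  · rw [hexp]
    refine le_trans ?_ htime
    have h := cost_learn_le (params := [γ, ν, δ, ε]) (m := m) (R := R) S r hlink linkSyntax_soft
      (by decide) (by decide)
      (den_softInit (fun n => encode (S n)) r).1
      (((den_softInit (fun n => encode (S n)) r).2).trans (by simp only [hR, hm, hT, hℓ]; omega))
    exact_mod_cast h

end MarginLearning

theorem theorem1 :
    (∃ (P : RealRAM.Prog) (C₁ C₂ : ℝ) (Q : Polynomial ℝ),
      ∀ (p γ ν δ ε : ℝ) (d : ℕ), 2 ≤ p → 0 < γ → γ < 1 → 0 < ν → ν < 1 → 0 < δ → δ < 1 →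
        0 < ε → ε < 1 → 1 ≤ d →
        MarginLearning.IsProperRobustLearner P [γ, ν, δ, ε, p] (ENNReal.ofReal p) d
          γ ν (1 + δ) ε (1 / 3)
          (C₁ * (p / (ε ^ 2 * ν ^ 2 * γ ^ 2)))
          ((2 / δ) ^ (C₂ * (p / (ν ^ 2 * γ ^ 2))) * Q.eval (d / ε))) ∧
    (∃ (P : RealRAM.Prog) (C₁ C₂ : ℝ) (Q : Polynomial ℝ),
      ∀ (γ ν δ ε : ℝ) (d : ℕ), 0 < γ → γ < 1 → 0 < ν → ν < 1 → 0 < δ → δ < 1 →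
        0 < ε → ε < 1 → 2 ≤ d →
        MarginLearning.IsProperRobustLearner P [γ, ν, δ, ε] ⊤ d
          γ ν (1 + δ) ε (1 / 3)
          (C₁ * (Real.log d / (ε ^ 2 * ν ^ 2 * γ ^ 2)))
          ((d : ℝ) ^ (C₂ * (Real.log (2 / δ) / (ν ^ 2 * γ ^ 2))) * Q.eval (1 / ε))) := by
  refine ⟨⟨(MarginLearning.learnCmd MarginLearning.lpInitCmd MarginLearning.lpLinkCmd).toProg,
      2 ^ 20, 8062, Polynomial.X ^ 8, fun p γ ν δ ε d hp h1 h2 h3 h4 h5 h6 h7 h8 hd => ?_⟩,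
    ⟨(MarginLearning.learnCmd MarginLearning.softInitCmd MarginLearning.softLinkCmd).toProg, 2 ^ 21,
      8062, Polynomial.X ^ 8, fun γ ν δ ε d h1 h2 h3 h4 h5 h6 h7 h8 hd => ?_⟩⟩
  · rw [Polynomial.eval_pow, Polynomial.eval_X]
    exact MarginLearning.learner_lp hp h1 h2 h3 h4 h5 h6 h7 h8 hd
  · rw [Polynomial.eval_pow, Polynomial.eval_X]
    exact MarginLearning.learner_top h1 h2 h3 h4 h5 h6 h7 h8 hd
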